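/- Let $\varphi=\frac{1+\sqrt5}{2}$ and $\tau=1-\varphi^{-1}=\varphi^{-2}$. For $\lambda\in(0,1)$ let $g_\lambda:[0,1]\to[0,1]$ be the continuous function determined by $g_\lambda(0)=0$, $g_\lambda(1)=1$ and $$g_\lambda\Bigl(\frac{p+r}{q+s}\Bigr)=(1-\lambda)\,g_\lambda\Bigl(\frac pq\Bigr)+\lambda\, g_\lambda\Bigl(\frac rs\Bigr)$$ for all consecutive Farey fractions $\frac pq<\frac rs$ in $[0,1]$ (the pairs obtained from $\frac01<\frac11$ by repeatedly inserting mediants). For an irrational $x=[0;a_1,a_2,a_3,\ldots]\in(0,1)$ put $$S^{\varphi}_t(x)=\sum_{i=1}^t a_i\Bigl(\tfrac32+\tfrac12(-1)^i\Bigr)=a_1+2a_2+a_3+2a_4+\cdots,\qquad S^{\tau}_t(x)=\sum_{i=1}^t a_i\Bigl(\tfrac32+\tfrac12(-1)^{i-1}\Bigr)=2a_1+a_2+2a_3+a_4+\cdots.$$ Derivatives are two-sided; $g'(x)=+\infty$ means that the difference quotient tends to $+\infty$, and upper and lower limits may be $+\infty$. Then the following hold. (1) Put $\varkappa_1=4$.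 (i) If $x\in(0,1)$ is irrational and $\limsup_{t\to\infty} S^{\tau}_{2t}(x)/t<\varkappa_1$, then $g_\tau'(x)$ exists and equals $+\infty$. (ii) For every $\delta>0$ there is an irrational $y\in(0,1)$ such that $\lim_{t\to\infty}S^{\tau}_{2t}(y)/t$ exists, is less than $\varkappa_1+\delta$, and $g_\tau'(y)=0$. (2) There is a computable real number $\varkappa_2=13.05\ldots$ (that is, $13.05\le\varkappa_2<13.06$) such that both for $(g,S)=(g_{\varphi^{-1}},S^{\varphi})$ and, with the same $\varkappa_2$, for $(g,S)=(g_\tau,S^{\tau})$: (i) if $x\in(0,1)$ is irrational and $\liminf_{t\to\infty} S_{2t}(x)/t>\varkappa_2$, then $g'(x)$ exists and equals $0$; (ii) for every $\delta>0$ there is an irrational $y\in(0,1)$ such that $\lim_{t\to\infty}S_{2t}(y)/t$ exists, is finite and greater than $\varkappa_2-\delta$, and $g'(y)=+\infty$. (3) (i) If $x\in[0,1]$ is irrational and all its partial quotients $a_i$, $i\ge1$, are at most $2$, then $g_\tau'(x)$ exists and equals $+\infty$. (ii) There is a quadratic irrationality $y\in[0,1]$ all of whose partial quotients are at most $3$ and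 for which $g_\tau'(y)=0$. -/

import Mathlib

open Filter Topology

/-- A pair of consecutive Farey fractions `p / q < r / s`, together with the values `u`, `v` that
are assigned to them. -/
structure FareyInterval where
  p : ℕ
  q : ℕ
  r : ℕ
  s : ℕ
  u : ℝ
  v : ℝ

namespace FareyInterval

/-- The left end point `p / q`. -/
noncomputable def lo (I : FareyInterval) : ℝ := (I.p : ℝ) / (I.q : ℝ)

/-- The right end point `r / s`. -/
noncomputable def hi (I : FareyInterval) : ℝ := (I.r : ℝ) / (I.s : ℝ)

/-- The initial pair `0 / 1 < 1 / 1`, with the values `0` and `1`. -/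
def root : FareyInterval := ⟨0, 1, 1, 1, 0, 1⟩

/-- Insert the mediant `(p + r) / (q + s)`, with the value `(1 - lam) * u + lam * v`, and keep the
left half (`false`) or the right half (`true`). -/
noncomputable def child (lam : ℝ) (I : FareyInterval) : Bool → FareyInterval
  | false => ⟨I.p, I.q, I.p + I.r, I.q + I.s, I.u, (1 - lam) * I.u + lam * I.v⟩
  | true => ⟨I.p + I.r, I.q + I.s, I.r, I.s, (1 - lam) * I.u + lam * I.v, I.v⟩

/-- Repeated insertion of mediants. -/
noncomputable def descend (lam : ℝ) : FareyInterval → List Bool → FareyInterval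
  | I, [] => I
  | I, b :: w => descend lam (child lam I b) w

/-- `y` is the value assigned to the real number `x`, an end point of an interval that is
reached from `I`. -/
def HasValue (lam : ℝ) (I : FareyInterval) (x y : ℝ) : Prop :=
  ∃ w : List Bool, (x = (descend lam I w).lo ∧ y = (descend lam I w).u) ∨
    (x = (descend lam I w).hi ∧ y = (descend lam I w).v)

end FareyInterval

/-- The Denjoy-Tichy-Uitz function `g_lam` on `[0, 1]`: it is defined on the Farey fractions by
the mediant rule and extended by
`g_lam x = sup g_lam(z)` over the Farey fractions `z ≤ x`, which is the extension by continuity. -/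
noncomputable def dtu (lam : ℝ) (x : ℝ) : ℝ :=
  sSup {y : ℝ | ∃ z : ℝ, FareyInterval.HasValue lam FareyInterval.root z y ∧ z ≤ x}

/-! The definition is sound for `0 < lam < 1`: `g_lam` takes the prescribed values, obeys the
mediant rule and is continuous. -/

namespace FareyInterval

/-- Positive denominators, and end points and values in the right order. -/
def Valid (I : FareyInterval) : Prop :=
  0 < I.q ∧ 0 < I.s ∧ I.p * I.s < I.r * I.q ∧ I.u < I.v

theorem root_valid : root.Valid := by norm_num [Valid, root]

theorem child_valid {lam : ℝ} (h0 : 0 < lam) (h1 : lam < 1) {I : FareyInterval} (hI : I.Valid)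
    (b : Bool) : (child lam I b).Valid := by
  obtain ⟨hq, hs, hd, hv⟩ := hI
  cases b
  · refine ⟨hq, by simp only [child]; omega, by simp only [child]; nlinarith, ?_⟩
    simp only [child]; nlinarith
  · refine ⟨by simp only [child]; omega, hs, by simp only [child]; nlinarith, ?_⟩
    simp only [child]; nlinarith

theorem Valid.lo_lt_hi {I : FareyInterval} (hI : I.Valid) : I.lo < I.hi := by
  obtain ⟨hq, hs, hd, -⟩ := hI
  unfold lo hi
  rw [div_lt_div_iff₀ (by exact_mod_cast hq) (by exact_mod_cast hs)]
  exact_mod_cast hd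

/-- Two points with values are in the same order as their values. -/
def SameOrder (x y x' y' : ℝ) : Prop :=
  (x < x' ∧ y < y') ∨ (x = x' ∧ y = y') ∨ (x' < x ∧ y' < y)

theorem HasValue.mem {lam : ℝ} (h0 : 0 < lam) (h1 : lam < 1) {I : FareyInterval} (hI : I.Valid)
    {x y : ℝ} (h : HasValue lam I x y) :
    ((x = I.lo ∧ y = I.u) ∨ (I.lo < x ∧ I.u < y)) ∧
      ((x = I.hi ∧ y = I.v) ∨ (x < I.hi ∧ y < I.v)) := by
  obtain ⟨w, h⟩ := h
  induction w generalizing I with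
  | nil =>
    have := hI.lo_lt_hi
    have := hI.2.2.2
    simp only [descend] at h
    grind
  | cons b w ih =>
    have hc := child_valid h0 h1 hI b
    have hm := (child_valid h0 h1 hI (!b))
    have := ih hc h
    have e1 := hc.lo_lt_hi
    have e2 := hm.lo_lt_hi
    have e3 := hc.2.2.2
    have e4 := hm.2.2.2
    cases b <;> simp only [child, lo, hi, Bool.not_false, Bool.not_true] at * <;> grind

theorem HasValue.sameOrder {lam : ℝ} (h0 : 0 < lam) (h1 : lam < 1) {I : FareyInterval}
    (hI : I.Valid) {x y x' y' : ℝ} (h : HasValue lam I x y) (h' : HasValue lam I x' y') :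
    SameOrder x y x' y' := by
  obtain ⟨w, hw⟩ := id h
  obtain ⟨w', hw'⟩ := id h'
  have m := h.mem h0 h1 hI
  have m' := h'.mem h0 h1 hI
  clear h h'
  induction w generalizing I w' with
  | nil => simp only [descend] at hw; unfold SameOrder; grind
  | cons b w ih =>
    cases w' with
    | nil => simp only [descend] at hw'; unfold SameOrder; grind
    | cons b' w' =>
      have n : HasValue lam (child lam I b) x y := ⟨w, hw⟩
      have n' : HasValue lam (child lam I b') x' y' := ⟨w', hw'⟩
      have k := n.mem h0 h1 (child_valid h0 h1 hI b)
      have k' := n'.mem h0 h1 (child_valid h0 h1 hI b')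
      by_cases e : b = b'
      · subst e
        exact ih (child_valid h0 h1 hI b) hw w' hw' k k'
      · unfold SameOrder
        cases b <;> cases b' <;> simp only [child, lo, hi] at * <;> grind

theorem exists_small {lam : ℝ} (h0 : 0 < lam) (h1 : lam < 1) (c : ℝ) (n : ℕ) (I : FareyInterval)
    (hI : I.Valid) (hu : I.u ≤ c) (hv : c ≤ I.v) :
    ∃ w : List Bool, (descend lam I w).u ≤ c ∧ c ≤ (descend lam I w).v ∧
      (descend lam I w).v - (descend lam I w).u ≤ (max lam (1 - lam)) ^ n * (I.v - I.u) := by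
  induction n generalizing I with
  | zero => exact ⟨[], hu, hv, by simp [descend]⟩
  | succ n ih =>
    have hp : (0 : ℝ) ≤ (max lam (1 - lam)) ^ n := by positivity
    have hlt := hI.2.2.2
    rcases le_total c ((1 - lam) * I.u + lam * I.v) with hc | hc
    · obtain ⟨w, a, b, d⟩ := ih (child lam I false) (child_valid h0 h1 hI _) hu hc
      refine ⟨false :: w, a, b, d.trans ?_⟩
      rw [pow_succ, mul_assoc]
      refine mul_le_mul_of_nonneg_left ?_ hp
      simp only [child]
      nlinarith [le_max_left lam (1 - lam)]
    · obtain ⟨w, a, b, d⟩ := ih (child lam I true) (child_valid h0 h1 hI _) hc hv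
      refine ⟨true :: w, a, b, d.trans ?_⟩
      rw [pow_succ, mul_assoc]
      refine mul_le_mul_of_nonneg_left ?_ hp
      simp only [child]
      nlinarith [le_max_right lam (1 - lam)]

end FareyInterval

open FareyInterval in
theorem dtu_eq {lam : ℝ} (h0 : 0 < lam) (h1 : lam < 1) {x y : ℝ} (h : HasValue lam root x y) :
    dtu lam x = y := by
  refine IsGreatest.csSup_eq ⟨⟨x, h, le_rfl⟩, ?_⟩
  rintro y' ⟨z, hz, hzx⟩
  have := hz.sameOrder h0 h1 root_valid h
  unfold SameOrder at this
  grind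

theorem dtu_zero {lam : ℝ} (h0 : 0 < lam) (h1 : lam < 1) : dtu lam 0 = 0 :=
  dtu_eq h0 h1 ⟨[], by simp [FareyInterval.descend, FareyInterval.root, FareyInterval.lo]⟩

theorem dtu_one {lam : ℝ} (h0 : 0 < lam) (h1 : lam < 1) : dtu lam 1 = 1 :=
  dtu_eq h0 h1 ⟨[], by simp [FareyInterval.descend, FareyInterval.root, FareyInterval.hi]⟩

open FareyInterval in
/-- The mediant rule. -/
theorem dtu_mediant {lam : ℝ} (h0 : 0 < lam) (h1 : lam < 1) (w : List Bool) :
    dtu lam ((((descend lam root w).p + (descend lam root w).r : ℕ) : ℝ) /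
        (((descend lam root w).q + (descend lam root w).s : ℕ) : ℝ)) =
      (1 - lam) * dtu lam (descend lam root w).lo + lam * dtu lam (descend lam root w).hi := by
  have happ : ∀ (I : FareyInterval) (b : Bool),
      descend lam I (w ++ [b]) = child lam (descend lam I w) b := by
    induction w with
    | nil => intro I b; rfl
    | cons a w ih => intro I b; exact ih _ b
  rw [dtu_eq h0 h1 ⟨w, Or.inl ⟨rfl, rfl⟩⟩, dtu_eq h0 h1 ⟨w, Or.inr ⟨rfl, rfl⟩⟩]
  refine dtu_eq h0 h1 ⟨w ++ [true], Or.inl ?_⟩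
  rw [happ]
  exact ⟨rfl, rfl⟩

open FareyInterval in
theorem dtu_monotone {lam : ℝ} (h0 : 0 < lam) (h1 : lam < 1) : Monotone (dtu lam) := by
  intro x x' hxx
  have hm : ∀ z y : ℝ, HasValue lam root z y → 0 ≤ y ∧ y ≤ 1 := by
    intro z y hz
    have := hz.mem h0 h1 root_valid
    simp only [root] at this
    grind
  unfold dtu
  rcases Set.eq_empty_or_nonempty {y : ℝ | ∃ z : ℝ, HasValue lam root z y ∧ z ≤ x} with h | h
  · rw [h, Real.sSup_empty]
    exact Real.sSup_nonneg fun y ⟨z, hz, _⟩ => (hm z y hz).1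
  · exact csSup_le_csSup ⟨1, fun y ⟨z, hz, _⟩ => (hm z y hz).2⟩ h
      fun y ⟨z, hz, hzx⟩ => ⟨z, hz, hzx.trans hxx⟩

open FareyInterval in
theorem dtu_dense {lam : ℝ} (h0 : 0 < lam) (h1 : lam < 1) {a b : ℝ} (ha : 0 ≤ a) (hab : a < b)
    (hb : b ≤ 1) : ∃ z : ℝ, a < dtu lam z ∧ dtu lam z < b := by
  obtain ⟨n, hn⟩ := exists_pow_lt_of_lt_one (show (0 : ℝ) < (b - a) / 2 by linarith)
    (max_lt h1 (show 1 - lam < 1 by linarith))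
  obtain ⟨w, p, q, r⟩ := exists_small h0 h1 ((a + b) / 2) n root root_valid
    (by simp only [root]; linarith) (by simp only [root]; linarith)
  refine ⟨(descend lam root w).hi, ?_⟩
  rw [dtu_eq h0 h1 ⟨w, Or.inr ⟨rfl, rfl⟩⟩]
  have e : root.v - root.u = 1 := by simp [root]
  rw [e] at r
  constructor <;> linarith

open FareyInterval in
theorem dtu_continuous {lam : ℝ} (h0 : 0 < lam) (h1 : lam < 1) : Continuous (dtu lam) := by
  have hmono := dtu_monotone h0 h1
  have hle : ∀ x, dtu lam x ≤ 1 := fun x => by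
    refine Real.sSup_le ?_ zero_le_one
    rintro y ⟨z, hz, -⟩
    have := (hz.mem h0 h1 root_valid).2
    simp only [root] at this
    grind
  have hge : ∀ x, 0 ≤ dtu lam x := fun x => by
    refine Real.sSup_nonneg ?_
    rintro y ⟨z, hz, -⟩
    have := (hz.mem h0 h1 root_valid).1
    simp only [root] at this
    grind
  rw [continuous_iff_continuousAt]
  intro x
  refine tendsto_order.2 ⟨fun a ha => ?_, fun b hb => ?_⟩
  · rcases lt_or_ge a 0 with h | h
    · exact Eventually.of_forall fun y => h.trans_le (hge y)
    · obtain ⟨z, hz, hz'⟩ := dtu_dense h0 h1 h ha (hle x)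
      filter_upwards [lt_mem_nhds (hmono.reflect_lt hz')] with y hy
      exact hz.trans_le (hmono hy.le)
  · rcases lt_or_ge 1 b with h | h
    · exact Eventually.of_forall fun y => (hle y).trans_lt h
    · obtain ⟨z, hz, hz'⟩ := dtu_dense h0 h1 (hge x) hb h
      filter_upwards [gt_mem_nhds (hmono.reflect_lt hz)] with y hy
      exact (hmono hy.le).trans_lt hz'

/-- The partial quotients of `x = [a_0; a_1, a_2, …]`. -/
noncomputable def partialQuotient (x : ℝ) : ℕ → ℝ
  | 0 => (GenContFract.of x).h
  | i + 1 => ((GenContFract.of x).partDens.get? i).getD 0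

/-- `S^φ_t(x) = a_1 + 2 a_2 + a_3 + 2 a_4 + …` (`t` terms). -/
noncomputable def Sphi (x : ℝ) (t : ℕ) : ℝ :=
  ∑ i ∈ Finset.Icc 1 t, partialQuotient x i * (3 / 2 + 1 / 2 * (-1) ^ i)

/-- `S^τ_t(x) = 2 a_1 + a_2 + 2 a_3 + a_4 + …` (`t` terms). -/
noncomputable def Stau (x : ℝ) (t : ℕ) : ℝ :=
  ∑ i ∈ Finset.Icc 1 t, partialQuotient x i * (3 / 2 + 1 / 2 * (-1) ^ (i - 1))

/-- The two-sided derivative of `g` at `x` exists and equals `+∞`. -/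
def HasInfiniteDerivAt (g : ℝ → ℝ) (x : ℝ) : Prop :=
  Tendsto (fun y => (g y - g x) / (y - x)) (𝓝[≠] x) atTop

/-- `x` is a computable real number: some algorithm computes, from `n`, a dyadic rational at
distance at most `2⁻ⁿ` from `x`. -/
def IsComputableReal (x : ℝ) : Prop :=
  ∃ p : ℕ → ℤ, Computable p ∧ ∀ n : ℕ, |x - (p n : ℝ) / 2 ^ n| ≤ 1 / 2 ^ n

/-!
Fix `lam` with `lam = φ ^ (-α)` and `1 - lam = φ ^ (-β)`, where `φ` is the golden ratio: for `1 / φ`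
the exponents are `(α, β) = (1, 2)`, and for `τ` they are `(2, 1)`. The path of nested Farey intervals
around an irrational `x = [0; a_1, a_2, …]` makes `a_1 - 1` steps to the left, `a_2` steps to the right,
`a_3` steps to the left and so on. A left step multiplies the gap between the values of `g_lam` at the two end points by `φ ^ (-α)`
and a right step by `φ ^ (-β)`, so the gap after `t` partial quotients is `φ ^ (-W_t)` up to a constant
factor, with `W_t` the digit sum that weights odd positions by `α` and even positions by `β`; this is
`S^φ_t` or `S^τ_t`. The length of an interval is the reciprocal of the product of its two denominators.
Since `g_lam` is monotone, slopes at `x` are controlled by the path: the derivative is `0` if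
`q_{2t} ^ 2 / φ ^ W_{2t}` tends to `0`, and `+∞` if `q_{2t} ^ 2 / φ ^ W_{2t+2}` tends to `∞`
(`IsExpansion.hasDerivAt_zero_of_even`, `IsExpansion.hasInfiniteDerivAt_of_even`). Everything else is
about continuants.

Digits are read in pairs, as words `w` over `ℕ × ℕ`. The continuant `K(w)` (`wordCont`) satisfies
`K(u) K(v) ≤ K(uv) ≤ 2 K(u) K(v)` for words with positive digits. A word is *growing* if
`φ ^ weight < K ^ 2`, and `κ₂` is `criticalAverage 1 2`, the supremum of `weight / length` over the
growing words. Reversing a word swaps `α` and `β`, which is why both functions share the constant.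
A growing word, repeated periodically, gives an infinite derivative. Conversely, if the average weight
of the prefixes of `x` stays above `κ > κ₂`, then even a prefix lengthened by a small proportion of
pairs `(1, 1)` is not growing, which leaves a power of `φ` to spare and gives derivative `0`
(`tendsto_zero_of_lt_average`).

The bound `κ₂ ≥ 13.05` comes from one explicit word, and `κ₂ < 13.06` from a linear potential
(`wordCont_potential_le`). For computability, lower bounds are certified by growing words. Upper bounds
are certified by finitely many inequalities `4 K(u) ^ 2 ≤ C ^ weight * D ^ n` for words of one length `n`
with bounded digits (`UpperCert`); that such certificates exist arbitrarily close to `κ₂` follows from a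
separating line between the attainable pairs (weight, `log K`) and the forbidden quadrant
(`exists_slope`). A search for certificates then computes `κ₂`.

For the constant `4`, the bound `q_{2t} ≥ φ ^ (2t - 1)` suffices in one direction, and long blocks of
ones with one large digit show sharpness. For partial quotients at most `2`, each pair of digits
multiplies `q ^ 2 / φ ^ W` by a factor greater than `1`, the closest case being the pair `(2, 1)`;
and `[0; 3, 1, 3, 1, …]` has derivative `0`.
-/

/-! ### Continued fraction expansions -/

/-- The Gauss-map orbit of `x`: the complete quotients `[0; a_{n+1}, a_{n+2}, …]`. -/
noncomputable def cfTail (x : ℝ) : ℕ → ℝ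
  | 0 => x
  | n + 1 => Int.fract (cfTail x n)⁻¹

/-- The partial quotient `a_{n+1}` of `x ∈ (0, 1)`; the index is shifted so that the sequence
starts at `0`. -/
noncomputable def cfDigit (x : ℝ) (n : ℕ) : ℕ := ⌊(cfTail x n)⁻¹⌋₊

/-- `q_{t-1}` for the digit sequence `d`, so that `contDen d (t + 1)` is the denominator of
`[0; d 0, …, d (t - 1)]`. -/
def contDen (d : ℕ → ℕ) : ℕ → ℕ
  | 0 => 0
  | 1 => 1
  | n + 2 => d n * contDen d (n + 1) + contDen d n

/-- The weight of the digit in position `n`: `α` in even and `β` in odd positions. -/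
def letterWeight (α β n : ℕ) : ℕ := if Even n then α else β

/-- The weighted sum of the first `t` digits. -/
def digitSum (α β : ℕ) (d : ℕ → ℕ) (t : ℕ) : ℕ :=
  ∑ i ∈ Finset.range t, d i * letterWeight α β i

/-- `d` is the sequence of partial quotients of `x`, with complete quotients `z`. -/
def IsExpansion (x : ℝ) (d : ℕ → ℕ) (z : ℕ → ℝ) : Prop :=
  z 0 = x ∧ (∀ n, 0 < d n) ∧ ∀ n, 0 < z n ∧ z n < 1 ∧ (z n)⁻¹ = d n + z (n + 1)

theorem irrational_cfTail {x : ℝ} (hx : Irrational x) (n : ℕ) : Irrational (cfTail x n) := by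
  induction n with
  | zero => exact hx
  | succ n ih =>
    simp only [cfTail, Int.fract]
    exact (ih.inv).sub_intCast _

theorem isExpansion_cfDigit {x : ℝ} (hx : Irrational x) (h0 : 0 < x) (h1 : x < 1) :
    IsExpansion x (cfDigit x) (cfTail x) := by
  have hz : ∀ n, 0 < cfTail x n ∧ cfTail x n < 1 := by
    intro n
    cases n with
    | zero => exact ⟨h0, h1⟩
    | succ n =>
      refine ⟨lt_of_le_of_ne (Int.fract_nonneg _) (irrational_cfTail hx (n + 1)).ne_zero.symm,
        Int.fract_lt_one _⟩
  refine ⟨rfl, fun n => ?_, fun n => ⟨(hz n).1, (hz n).2, ?_⟩⟩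
  · exact Nat.floor_pos.2 ((one_lt_inv₀ (hz n).1).2 (hz n).2).le
  · simp only [cfDigit, cfTail, Int.fract]
    rw [natCast_floor_eq_intCast_floor (inv_nonneg.2 (hz n).1.le)]
    ring

theorem IsExpansion.stream_succ_of_stream {x : ℝ} {d : ℕ → ℕ} {z : ℕ → ℝ}
    (h : IsExpansion x d z) {n : ℕ} {b : ℤ}
    (hb : GenContFract.IntFractPair.stream x n = some ⟨b, z n⟩) :
    GenContFract.IntFractPair.stream x (n + 1) = some ⟨d n, z (n + 1)⟩ := by
  obtain ⟨hz0, -, hz⟩ := h.2.2 n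
  obtain ⟨hy0, hy1, -⟩ := h.2.2 (n + 1)
  rw [GenContFract.IntFractPair.stream_succ_of_some hb hz0.ne']
  have hf : ⌊(z n)⁻¹⌋ = (d n : ℤ) := by
    rw [hz, Int.floor_eq_iff]; constructor <;> push_cast <;> linarith
  simp only [GenContFract.IntFractPair.of, Int.fract, hf]
  rw [hz]
  simp

theorem IsExpansion.stream_succ {x : ℝ} {d : ℕ → ℕ} {z : ℕ → ℝ} (h : IsExpansion x d z) (n : ℕ) :
    GenContFract.IntFractPair.stream x (n + 1) = some ⟨d n, z (n + 1)⟩ := by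
  induction n with
  | zero =>
    refine h.stream_succ_of_stream (b := ⌊x⌋) ?_
    have : Int.fract x = z 0 := by
      rw [← h.1]; exact Int.fract_eq_self.2 ⟨(h.2.2 0).1.le, (h.2.2 0).2.1⟩
    simp [GenContFract.IntFractPair.stream, GenContFract.IntFractPair.of, this]
  | succ n ih => exact h.stream_succ_of_stream ih

theorem IsExpansion.partialQuotient {x : ℝ} {d : ℕ → ℕ} {z : ℕ → ℝ} (h : IsExpansion x d z)
    (n : ℕ) : partialQuotient x (n + 1) = d n := by
  have := GenContFract.get?_of_eq_some_of_succ_get?_intFractPair_stream (h.stream_succ n)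
  simp [_root_.partialQuotient, GenContFract.partDens, this, Stream'.Seq.map_get?]

theorem IsExpansion.irrational {x : ℝ} {d : ℕ → ℕ} {z : ℕ → ℝ} (h : IsExpansion x d z) :
    Irrational x := by
  rintro ⟨r, hr⟩
  obtain ⟨n, hn⟩ := (GenContFract.terminates_iff_rat x).2 ⟨r, hr.symm⟩
  have := GenContFract.of_terminatedAt_n_iff_succ_nth_intFractPair_stream_eq_none.1 hn
  rw [h.stream_succ] at this
  simp at this

theorem IsExpansion.mem_Ioo {x : ℝ} {d : ℕ → ℕ} {z : ℕ → ℝ} (h : IsExpansion x d z) :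
    x ∈ Set.Ioo (0 : ℝ) 1 := by
  rw [← h.1]; exact ⟨(h.2.2 0).1, (h.2.2 0).2.1⟩

theorem IsExpansion.sphi {x : ℝ} {d : ℕ → ℕ} {z : ℕ → ℝ} (h : IsExpansion x d z) (t : ℕ) :
    Sphi x t = digitSum 1 2 d t := by
  unfold Sphi digitSum
  rw [← Finset.Ico_add_one_right_eq_Icc, Finset.sum_Ico_eq_sum_range]
  push_cast
  refine Finset.sum_congr (by simp) fun i _ => ?_
  rw [add_comm 1 i, h.partialQuotient, letterWeight]
  rcases Nat.even_or_odd i with hi | hi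
  · rw [pow_succ, hi.neg_one_pow]; simp [hi]; norm_num
  · rw [pow_succ, hi.neg_one_pow]; simp [Nat.not_even_iff_odd.2 hi]; norm_num

theorem IsExpansion.stau {x : ℝ} {d : ℕ → ℕ} {z : ℕ → ℝ} (h : IsExpansion x d z) (t : ℕ) :
    Stau x t = digitSum 2 1 d t := by
  unfold Stau digitSum
  rw [← Finset.Ico_add_one_right_eq_Icc, Finset.sum_Ico_eq_sum_range]
  push_cast
  refine Finset.sum_congr (by simp) fun i _ => ?_
  rw [add_comm 1 i, h.partialQuotient, letterWeight, Nat.add_sub_cancel]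
  rcases Nat.even_or_odd i with hi | hi
  · rw [hi.neg_one_pow]; simp [hi]; norm_num
  · rw [hi.neg_one_pow]; simp [Nat.not_even_iff_odd.2 hi]; norm_num

/-- The points of `[0, 1]` whose expansion starts with `n` prescribed digits. -/
noncomputable def cylinder : ℕ → (ℕ → ℕ) → Set ℝ
  | 0, _ => Set.Icc 0 1
  | n + 1, d => (fun z : ℝ => ((d 0 : ℝ) + z)⁻¹) '' cylinder n fun i => d (i + 1)

theorem cylinder_subset_Icc {d : ℕ → ℕ} (hd : ∀ n, 0 < d n) (n : ℕ) :
    cylinder n d ⊆ Set.Icc 0 1 := by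
  induction n generalizing d with
  | zero => exact subset_rfl
  | succ n ih =>
    rintro _ ⟨z, hz, rfl⟩
    have := ih (fun i => hd (i + 1)) hz
    have h1 : (1 : ℝ) ≤ d 0 := by exact_mod_cast hd 0
    simp only [Set.mem_Icc] at this ⊢
    exact ⟨inv_nonneg.2 (by linarith), inv_le_one_of_one_le₀ (by linarith)⟩

theorem cylinder_succ_subset {d : ℕ → ℕ} (hd : ∀ n, 0 < d n) (n : ℕ) :
    cylinder (n + 1) d ⊆ cylinder n d := by
  induction n generalizing d with
  | zero => exact cylinder_subset_Icc hd 1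
  | succ n ih => exact Set.image_mono (ih fun i => hd (i + 1))

theorem cylinder_nonempty (n : ℕ) (d : ℕ → ℕ) : (cylinder n d).Nonempty := by
  induction n generalizing d with
  | zero => exact ⟨0, by simp [cylinder]⟩
  | succ n ih => exact (ih _).image _

theorem cylinder_isCompact {d : ℕ → ℕ} (hd : ∀ n, 0 < d n) (n : ℕ) :
    IsCompact (cylinder n d) := by
  induction n generalizing d with
  | zero => exact isCompact_Icc
  | succ n ih =>
    refine (ih fun i => hd (i + 1)).image_of_continuousOn ?_
    refine ContinuousOn.inv₀ (by fun_prop) fun z hz => ?_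
    have := (cylinder_subset_Icc (fun i => hd (i + 1)) n hz).1
    have h1 : (1 : ℝ) ≤ d 0 := by exact_mod_cast hd 0
    linarith

/-- Every sequence of positive integers is the sequence of partial quotients of a number. -/
theorem exists_isExpansion {d : ℕ → ℕ} (hd : ∀ n, 0 < d n) : ∃ x z, IsExpansion x d z := by
  obtain ⟨x, hx⟩ := IsCompact.nonempty_iInter_of_sequence_nonempty_isCompact_isClosed
    (fun n => cylinder n d) (cylinder_succ_subset hd) (fun n => cylinder_nonempty n d)
    (cylinder_isCompact hd 0) fun n => (cylinder_isCompact hd n).isClosed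
  let z : ℕ → ℝ := fun n => Nat.rec x (fun n y => y⁻¹ - d n) n
  have hsucc : ∀ n, z (n + 1) = (z n)⁻¹ - d n := fun n => rfl
  have key : ∀ n m, z n ∈ cylinder m fun i => d (n + i) := by
    intro n
    induction n with
    | zero => intro m; simp only [zero_add]; exact Set.mem_iInter.1 hx m
    | succ n ih =>
      intro m
      obtain ⟨y, hy, hyz⟩ := ih (m + 1)
      have : z (n + 1) = y := by rw [hsucc, ← hyz]; simp
      rw [this]
      convert hy using 3 with i
      change d (n + 1 + i) = d (n + (i + 1))
      congr 1
      omega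
  have hpos : ∀ n, 0 ≤ z n := fun n => (key n 0).1
  have hrec : ∀ n, (z n)⁻¹ = d n + z (n + 1) := fun n => by rw [hsucc]; ring
  have hpos' : ∀ n, 0 < z n := fun n => by
    have h1 : (1 : ℝ) ≤ d n := by exact_mod_cast hd n
    have := hpos (n + 1)
    exact inv_pos.1 (by rw [hrec]; linarith)
  refine ⟨x, z, rfl, hd, fun n => ⟨hpos' n, ?_, hrec n⟩⟩
  have h1 : (1 : ℝ) ≤ d n := by exact_mod_cast hd n
  have := hpos' (n + 1)
  exact (one_lt_inv₀ (hpos' n)).1 (by rw [hrec]; linarith)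

/-! ### Derivatives along the Farey path -/

namespace FareyInterval

/-- `I` is an interval of the Farey tree. -/
def Reached (lam : ℝ) (I : FareyInterval) : Prop := ∃ w, I = descend lam root w

theorem descend_append_singleton (lam : ℝ) (w : List Bool) (b : Bool) (I : FareyInterval) :
    descend lam I (w ++ [b]) = child lam (descend lam I w) b := by
  induction w generalizing I with
  | nil => rfl
  | cons a w ih => exact ih _

theorem Reached.child {lam : ℝ} {I : FareyInterval} (h : Reached lam I) (b : Bool) :
    Reached lam (child lam I b) := by
  obtain ⟨w, rfl⟩ := h
  exact ⟨w ++ [b], (descend_append_singleton ..).symm⟩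

theorem Reached.induction {lam : ℝ} {P : FareyInterval → Prop} (h0 : P root)
    (hc : ∀ I b, P I → P (FareyInterval.child lam I b)) {I : FareyInterval}
    (h : Reached lam I) : P I := by
  obtain ⟨w, rfl⟩ := h
  have : ∀ I, P I → P (descend lam I w) := by
    induction w with
    | nil => exact fun I hI => hI
    | cons b w ih => exact fun I hI => ih _ (hc I b hI)
  exact this _ h0

theorem Reached.valid {lam : ℝ} (h0 : 0 < lam) (h1 : lam < 1) {I : FareyInterval}
    (h : Reached lam I) : I.Valid :=
  h.induction root_valid fun _ b hI => child_valid h0 h1 hI b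

theorem Reached.det {lam : ℝ} {I : FareyInterval} (h : Reached lam I) :
    (I.r : ℝ) * I.q - I.p * I.s = 1 := by
  refine h.induction (P := fun I => (I.r : ℝ) * I.q - I.p * I.s = 1) (by simp [root]) ?_
  intro I b hI
  cases b <;> simp only [FareyInterval.child] <;> push_cast <;> linarith

theorem Reached.q_pos {lam : ℝ} {I : FareyInterval} (h : Reached lam I) : (1 : ℝ) ≤ I.q := by
  have := h.induction (P := fun I => 1 ≤ I.q) (by simp [root]) (by
    intro I b hI; cases b <;> simp only [FareyInterval.child] <;> omega)
  exact_mod_cast this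

theorem Reached.s_pos {lam : ℝ} {I : FareyInterval} (h : Reached lam I) : (1 : ℝ) ≤ I.s := by
  have := h.induction (P := fun I => 1 ≤ I.s) (by simp [root]) (by
    intro I b hI; cases b <;> simp only [FareyInterval.child] <;> omega)
  exact_mod_cast this

theorem Reached.hi_sub_lo {lam : ℝ} {I : FareyInterval} (h : Reached lam I) :
    I.hi - I.lo = 1 / (I.q * I.s) := by
  have := h.q_pos
  have := h.s_pos
  have := h.det
  unfold hi lo
  field_simp
  linarith

theorem Reached.dtu_lo {lam : ℝ} (h0 : 0 < lam) (h1 : lam < 1) {I : FareyInterval}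
    (h : Reached lam I) : dtu lam I.lo = I.u := by
  obtain ⟨w, rfl⟩ := h
  exact dtu_eq h0 h1 ⟨w, Or.inl ⟨rfl, rfl⟩⟩

theorem Reached.dtu_hi {lam : ℝ} (h0 : 0 < lam) (h1 : lam < 1) {I : FareyInterval}
    (h : Reached lam I) : dtu lam I.hi = I.v := by
  obtain ⟨w, rfl⟩ := h
  exact dtu_eq h0 h1 ⟨w, Or.inr ⟨rfl, rfl⟩⟩

/-- The mediant of the end points. -/
noncomputable def med (I : FareyInterval) : ℝ := ((I.p + I.r : ℕ) : ℝ) / ((I.q + I.s : ℕ) : ℝ)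

theorem Reached.med_sub_lo {lam : ℝ} {I : FareyInterval} (h : Reached lam I) :
    I.med - I.lo = 1 / (I.q * (I.q + I.s)) := by
  have := (h.child false).hi_sub_lo
  simpa [FareyInterval.child, lo, hi, med] using this

theorem Reached.hi_sub_med {lam : ℝ} {I : FareyInterval} (h : Reached lam I) :
    I.hi - I.med = 1 / ((I.q + I.s) * I.s) := by
  have := (h.child true).hi_sub_lo
  simpa [FareyInterval.child, lo, hi, med] using this

theorem Reached.dtu_med {lam : ℝ} (h0 : 0 < lam) (h1 : lam < 1) {I : FareyInterval}
    (h : Reached lam I) : dtu lam I.med = (1 - lam) * I.u + lam * I.v :=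
  (h.child true).dtu_lo h0 h1

/-- Going right `j` times. -/
theorem Reached.exists_right {lam : ℝ} {I : FareyInterval} (h : Reached lam I) (j : ℕ) :
    ∃ J, Reached lam J ∧ J.hi = I.hi ∧ J.v = I.v ∧ J.s = I.s ∧ J.q = I.q + j * I.s ∧
      J.v - J.u = (1 - lam) ^ j * (I.v - I.u) := by
  induction j with
  | zero => exact ⟨I, h, by simp⟩
  | succ j ih =>
    obtain ⟨J, hJ, e1, e2, e3, e4, e5⟩ := ih
    refine ⟨FareyInterval.child lam J true, hJ.child _, e1, e2, e3, ?_, ?_⟩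
    · simp only [FareyInterval.child, e4, e3]; ring
    · simp only [FareyInterval.child, pow_succ, mul_assoc, mul_left_comm _ (1 - lam), ← e5]; ring

/-- Going left `j` times. -/
theorem Reached.exists_left {lam : ℝ} {I : FareyInterval} (h : Reached lam I) (j : ℕ) :
    ∃ J, Reached lam J ∧ J.lo = I.lo ∧ J.u = I.u ∧ J.q = I.q ∧ J.s = I.s + j * I.q ∧
      J.v - J.u = lam ^ j * (I.v - I.u) := by
  induction j with
  | zero => exact ⟨I, h, by simp⟩
  | succ j ih =>
    obtain ⟨J, hJ, e1, e2, e3, e4, e5⟩ := ih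
    refine ⟨FareyInterval.child lam J false, hJ.child _, e1, e2, e3, ?_, ?_⟩
    · simp only [FareyInterval.child, e4, e3]; ring
    · simp only [FareyInterval.child, pow_succ, mul_assoc, mul_left_comm _ lam, ← e5]; ring

end FareyInterval

/-- Slopes towards the limit `h` of the points `h - 1 / (s * (q + j * s))`, over which `g`
increases by geometrically decreasing amounts. -/
theorem slope_le_of_fan {g : ℝ → ℝ} (hg : Monotone g) {h q s D η C : ℝ} (hq : 0 < q) (hs : 0 < s)
    (hD : 0 ≤ D) (hη : 0 ≤ η) (hC : ∀ j : ℕ, ((j : ℝ) + 1) * η ^ j ≤ C)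
    (hz : ∀ j : ℕ, g h - g (h - 1 / (s * (q + j * s))) ≤ η ^ j * D) {y : ℝ}
    (hy0 : h - 1 / (s * q) ≤ y) (hy : y ≤ h) :
    g h - g y ≤ C * D * (s * (q + s)) * (h - y) := by
  rcases hy.eq_or_lt with rfl | hy
  · simp
  have hex : ∃ j : ℕ, y < h - 1 / (s * (q + j * s)) := by
    obtain ⟨j, hj⟩ := exists_nat_gt (1 / (s * s * (h - y)))
    refine ⟨j, ?_⟩
    have h1 : 0 < h - y := by linarith
    have : 1 / (s * (q + j * s)) < h - y := by
      rw [div_lt_iff₀ (by positivity)] at hj ⊢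
      nlinarith [mul_pos (mul_pos hs hq) h1]
    linarith
  classical
  obtain ⟨j, hj⟩ : ∃ j, Nat.find hex = j + 1 := by
    refine Nat.exists_eq_succ_of_ne_zero fun h0 => ?_
    have := Nat.find_spec hex
    rw [h0] at this
    simp at this hy0
    linarith
  have h1 := Nat.find_spec hex
  have h2 := Nat.find_min hex (m := j) (by omega)
  rw [hj] at h1
  rw [not_lt] at h2
  have h3 : g h - g y ≤ η ^ j * D := by linarith [hg h2, hz j]
  have h4 : 1 / (s * (q + (j + 1) * s)) ≤ h - y := by push_cast at h1; linarith
  have h5 : 1 ≤ ((j : ℝ) + 1) * (s * (q + s)) * (h - y) := by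
    rw [div_le_iff₀ (by positivity)] at h4
    have : (h - y) * (s * (q + (j + 1) * s)) ≤ (h - y) * (((j : ℝ) + 1) * (s * (q + s))) := by
      refine mul_le_mul_of_nonneg_left ?_ (by linarith)
      nlinarith [mul_pos hs hq, mul_nonneg (Nat.cast_nonneg (α := ℝ) j) (mul_pos hs hq).le]
    linarith
  have hy' : 0 < h - y := by linarith
  calc g h - g y ≤ η ^ j * D * 1 := by linarith
    _ ≤ η ^ j * D * (((j : ℝ) + 1) * (s * (q + s)) * (h - y)) := by gcongr
    _ = (((j : ℝ) + 1) * η ^ j) * (D * (s * (q + s)) * (h - y)) := by ring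
    _ ≤ C * (D * (s * (q + s)) * (h - y)) := by
      refine mul_le_mul_of_nonneg_right (hC j) (by positivity)
    _ = _ := by ring

namespace FareyInterval

variable {lam : ℝ} {I : FareyInterval}

theorem Reached.lo_eq {I : FareyInterval} (h : Reached lam I) : I.lo = I.hi - 1 / (I.s * I.q) := by
  have := h.hi_sub_lo
  rw [mul_comm (I.s : ℝ)]; linarith

theorem Reached.hi_eq {I : FareyInterval} (h : Reached lam I) : I.hi = I.lo + 1 / (I.q * I.s) := by
  have := h.hi_sub_lo
  linarith

/-- Slopes at the right end point of a Farey interval. -/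
theorem Reached.slope_hi_le (h0 : 0 < lam) (h1 : lam < 1) (h : Reached lam I) {C : ℝ}
    (hC : ∀ j : ℕ, ((j : ℝ) + 1) * (1 - lam) ^ j ≤ C) {y : ℝ} (hy0 : I.lo ≤ y) (hy : y ≤ I.hi) :
    dtu lam I.hi - dtu lam y ≤ C * (I.v - I.u) * (I.s * (I.q + I.s)) * (I.hi - y) := by
  have hv := (h.valid h0 h1).2.2.2
  have hq := h.q_pos
  have hs := h.s_pos
  refine slope_le_of_fan (dtu_monotone h0 h1) (by linarith) (by linarith) (by linarith)
    (by linarith) hC (fun j => ?_) (by rw [← h.lo_eq]; exact hy0) hy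
  obtain ⟨J, hJ, e1, e2, e3, e4, e5⟩ := h.exists_right j
  have := hJ.lo_eq
  rw [e1, e3, e4] at this
  push_cast at this
  rw [← this, hJ.dtu_lo h0 h1, h.dtu_hi h0 h1, ← e5, e2]

/-- Slopes at the left end point of a Farey interval. -/
theorem Reached.slope_lo_le (h0 : 0 < lam) (h1 : lam < 1) (h : Reached lam I) {C : ℝ}
    (hC : ∀ j : ℕ, ((j : ℝ) + 1) * lam ^ j ≤ C) {y : ℝ} (hy0 : I.lo ≤ y) (hy : y ≤ I.hi) :
    dtu lam y - dtu lam I.lo ≤ C * (I.v - I.u) * (I.q * (I.s + I.q)) * (y - I.lo) := by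
  have hv := (h.valid h0 h1).2.2.2
  have hq := h.q_pos
  have hs := h.s_pos
  have hmono : Monotone fun z => - dtu lam (-z) := fun a b hab =>
    neg_le_neg (dtu_monotone h0 h1 (neg_le_neg hab))
  have := slope_le_of_fan (g := fun z => - dtu lam (-z)) hmono (h := -I.lo) (q := I.s) (s := I.q)
    (D := I.v - I.u) (y := -y) (by linarith) (by linarith) (by linarith)
    (by linarith) hC (fun j => ?_) (by linarith [h.hi_eq]) (by linarith)
  · simp only [neg_neg] at this
    linarith
  obtain ⟨J, hJ, e1, e2, e3, e4, e5⟩ := h.exists_left j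
  have := hJ.hi_eq
  rw [e1, e3, e4] at this
  push_cast at this
  have e : -(-I.lo - 1 / ((I.q : ℝ) * (I.s + j * I.q))) = J.hi := by rw [this]; ring
  simp only [neg_neg, e]
  rw [hJ.dtu_hi h0 h1, h.dtu_lo h0 h1, ← e5, e2]
  linarith

end FareyInterval

open FareyInterval Classical in
/-- The Farey intervals containing `x`. -/
noncomputable def fareyPath (lam x : ℝ) : ℕ → FareyInterval
  | 0 => root
  | n + 1 => child lam (fareyPath lam x n) (decide ((fareyPath lam x n).med < x))

section FareyPath

open FareyInterval

theorem fareyPath_reached (lam x : ℝ) (n : ℕ) : Reached lam (fareyPath lam x n) := by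
  induction n with
  | zero => exact ⟨[], rfl⟩
  | succ n ih => exact ih.child _

theorem fareyPath_succ_of_lt {lam x : ℝ} {n : ℕ} (h : (fareyPath lam x n).med < x) :
    fareyPath lam x (n + 1) = child lam (fareyPath lam x n) true := by
  simp [fareyPath, h]

theorem fareyPath_succ_of_gt {lam x : ℝ} {n : ℕ} (h : x < (fareyPath lam x n).med) :
    fareyPath lam x (n + 1) = child lam (fareyPath lam x n) false := by
  simp [fareyPath, h.not_gt]

theorem med_ne {x : ℝ} (hx : Irrational x) (I : FareyInterval) : I.med ≠ x := by
  intro h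
  exact hx ⟨((I.p + I.r : ℕ) : ℚ) / ((I.q + I.s : ℕ) : ℚ), by rw [← h, med]; push_cast; rfl⟩

theorem fareyPath_mem {lam x : ℝ} (hx : Irrational x) (hx0 : 0 < x) (hx1 : x < 1) (n : ℕ) :
    (fareyPath lam x n).lo < x ∧ x < (fareyPath lam x n).hi := by
  induction n with
  | zero => simpa [fareyPath, root, lo, hi] using ⟨hx0, hx1⟩
  | succ n ih =>
    rcases lt_or_gt_of_ne (med_ne hx (fareyPath lam x n)) with h | h
    · rw [fareyPath_succ_of_lt h]
      exact ⟨h, ih.2⟩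
    · rw [fareyPath_succ_of_gt h]
      exact ⟨ih.1, h⟩

theorem fareyPath_add_le (lam x : ℝ) (n : ℕ) :
    (n : ℝ) + 2 ≤ (fareyPath lam x n).q + (fareyPath lam x n).s := by
  induction n with
  | zero => simp [fareyPath, root]; norm_num
  | succ n ih =>
    have hq := (fareyPath_reached lam x n).q_pos
    have hs := (fareyPath_reached lam x n).s_pos
    simp only [fareyPath]
    cases decide ((fareyPath lam x n).med < x) <;> simp only [child] <;> push_cast <;> linarith

theorem fareyPath_length_le (lam x : ℝ) (n : ℕ) :
    (fareyPath lam x n).hi - (fareyPath lam x n).lo ≤ 1 / ((n : ℝ) + 1) := by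
  have h := fareyPath_reached lam x n
  rw [h.hi_sub_lo]
  have hq := h.q_pos
  have hs := h.s_pos
  refine one_div_le_one_div_of_le (by positivity) ?_
  nlinarith [fareyPath_add_le lam x n]

/-- If `x` lies to the right of the left end point `m` of an interval of its path, the path keeps
this end point until it turns right. -/
theorem exists_turn_right {lam x : ℝ} (hx : Irrational x) (hx0 : 0 < x) (hx1 : x < 1) (n : ℕ) :
    ∃ k, n ≤ k ∧ (fareyPath lam x k).p = (fareyPath lam x n).p ∧
      (fareyPath lam x k).q = (fareyPath lam x n).q ∧ (fareyPath lam x k).u = (fareyPath lam x n).u ∧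
      (fareyPath lam x k).med < x := by
  by_contra! hcon
  have key : ∀ j, (fareyPath lam x (n + j)).p = (fareyPath lam x n).p ∧
      (fareyPath lam x (n + j)).q = (fareyPath lam x n).q ∧
      (fareyPath lam x (n + j)).u = (fareyPath lam x n).u := by
    intro j
    induction j with
    | zero => simp
    | succ j ih =>
      have h := hcon (n + j) (by omega) ih.1 ih.2.1 ih.2.2
      rw [← add_assoc, fareyPath_succ_of_gt (lt_of_le_of_ne h (med_ne hx _).symm)]
      exact ih
  obtain ⟨j, hj⟩ := exists_nat_one_div_lt (sub_pos.2 (fareyPath_mem (lam := lam) hx hx0 hx1 n).1)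
  have h1 := fareyPath_length_le lam x (n + j)
  have h2 := (fareyPath_mem (lam := lam) hx hx0 hx1 (n + j)).2
  have h3 : (fareyPath lam x (n + j)).lo = (fareyPath lam x n).lo := by
    rw [lo, lo, (key j).1, (key j).2.1]
  have h4 : (1 : ℝ) / (((n + j : ℕ) : ℝ) + 1) ≤ 1 / ((j : ℝ) + 1) :=
    one_div_le_one_div_of_le (by positivity) (by push_cast; linarith [Nat.cast_nonneg (α := ℝ) n])
  linarith

theorem exists_turn_left {lam x : ℝ} (hx : Irrational x) (hx0 : 0 < x) (hx1 : x < 1) (n : ℕ) :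
    ∃ k, n ≤ k ∧ (fareyPath lam x k).r = (fareyPath lam x n).r ∧
      (fareyPath lam x k).s = (fareyPath lam x n).s ∧ (fareyPath lam x k).v = (fareyPath lam x n).v ∧
      x < (fareyPath lam x k).med := by
  by_contra! hcon
  have key : ∀ j, (fareyPath lam x (n + j)).r = (fareyPath lam x n).r ∧
      (fareyPath lam x (n + j)).s = (fareyPath lam x n).s ∧
      (fareyPath lam x (n + j)).v = (fareyPath lam x n).v := by
    intro j
    induction j with
    | zero => simp
    | succ j ih =>
      have h := hcon (n + j) (by omega) ih.1 ih.2.1 ih.2.2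
      rw [← add_assoc, fareyPath_succ_of_lt (lt_of_le_of_ne h (med_ne hx _))]
      exact ih
  obtain ⟨j, hj⟩ := exists_nat_one_div_lt (sub_pos.2 (fareyPath_mem (lam := lam) hx hx0 hx1 n).2)
  have h1 := fareyPath_length_le lam x (n + j)
  have h2 := (fareyPath_mem (lam := lam) hx hx0 hx1 (n + j)).1
  have h3 : (fareyPath lam x (n + j)).hi = (fareyPath lam x n).hi := by
    rw [hi, hi, (key j).1, (key j).2.1]
  have h4 : (1 : ℝ) / (((n + j : ℕ) : ℝ) + 1) ≤ 1 / ((j : ℝ) + 1) :=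
    one_div_le_one_div_of_le (by positivity) (by push_cast; linarith [Nat.cast_nonneg (α := ℝ) n])
  linarith

/-- A point close to `x` is separated from `x` by the mediant of a late interval of the path. -/
theorem exists_separating {lam x : ℝ} (hx : Irrational x) (hx0 : 0 < x) (hx1 : x < 1) (N : ℕ) :
    ∀ᶠ y in 𝓝[≠] x, ∃ n, N ≤ n ∧
      (((fareyPath lam x n).lo ≤ y ∧ y ≤ (fareyPath lam x n).med ∧ (fareyPath lam x n).med < x) ∨
      (y ≤ (fareyPath lam x n).hi ∧ (fareyPath lam x n).med ≤ y ∧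
        x < (fareyPath lam x n).med)) := by
  obtain ⟨hl, hh⟩ := fareyPath_mem (lam := lam) hx hx0 hx1 N
  have h1 : ∀ᶠ y in 𝓝[≠] x, y ∈ Set.Ioo (fareyPath lam x N).lo (fareyPath lam x N).hi :=
    nhdsWithin_le_nhds (Ioo_mem_nhds hl hh)
  filter_upwards [h1, self_mem_nhdsWithin] with y hy hne
  classical
  have hex : ∃ j, ¬ ((fareyPath lam x (N + j)).lo ≤ y ∧ y ≤ (fareyPath lam x (N + j)).hi) := by
    obtain ⟨j, hj⟩ := exists_nat_one_div_lt (abs_pos.2 (sub_ne_zero.2 hne))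
    refine ⟨j, fun h => ?_⟩
    have h1 := fareyPath_length_le lam x (N + j)
    have h2 := fareyPath_mem (lam := lam) hx hx0 hx1 (N + j)
    have h4 : (1 : ℝ) / (((N + j : ℕ) : ℝ) + 1) ≤ 1 / ((j : ℝ) + 1) :=
      one_div_le_one_div_of_le (by positivity)
        (by push_cast; linarith [Nat.cast_nonneg (α := ℝ) N])
    have : |y - x| ≤ (fareyPath lam x (N + j)).hi - (fareyPath lam x (N + j)).lo :=
      abs_le.2 ⟨by linarith, by linarith⟩
    linarith
  obtain ⟨j, hj⟩ : ∃ j, Nat.find hex = j + 1 := by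
    refine Nat.exists_eq_succ_of_ne_zero fun h0 => ?_
    have := Nat.find_spec hex
    rw [h0] at this
    exact this ⟨hy.1.le, hy.2.le⟩
  have h1 := Nat.find_spec hex
  have h2 := Nat.find_min hex (m := j) (by omega)
  rw [hj] at h1
  rw [not_not] at h2
  refine ⟨N + j, by omega, ?_⟩
  rcases lt_or_gt_of_ne (med_ne hx (fareyPath lam x (N + j))) with h | h
  · left
    rw [← add_assoc, fareyPath_succ_of_lt h] at h1
    refine ⟨h2.1, ?_, h⟩
    by_contra! h3
    exact h1 ⟨h3.le, h2.2⟩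
  · right
    rw [← add_assoc, fareyPath_succ_of_gt h] at h1
    refine ⟨h2.2, ?_, h⟩
    by_contra! h3
    exact h1 ⟨h2.1, h3.le⟩

theorem exists_bound_mul_pow {η : ℝ} (h0 : 0 ≤ η) (h1 : η < 1) (k : ℕ) :
    ∃ C : ℝ, 0 < C ∧ ∀ j : ℕ, ((j : ℝ) + 1) ^ k * η ^ j ≤ C := by
  have h : Tendsto (fun j : ℕ => ((j : ℝ) + 1) ^ k * η ^ j) atTop (𝓝 0) := by
    rcases h0.eq_or_lt with rfl | h0
    · refine tendsto_const_nhds.congr' ?_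
      filter_upwards [eventually_gt_atTop 0] with j hj
      simp [hj.ne']
    have h2 := (tendsto_pow_const_mul_const_pow_of_lt_one k h0.le h1).comp (tendsto_add_atTop_nat 1)
    have h3 := h2.const_mul η⁻¹
    rw [mul_zero] at h3
    refine h3.congr fun j => ?_
    simp only [Function.comp_apply, pow_succ]
    push_cast
    field_simp
  obtain ⟨C, hC⟩ := h.bddAbove_range
  exact ⟨max C 1, by positivity, fun j => (hC ⟨j, rfl⟩).trans (le_max_left _ _)⟩

theorem child_gap (lam : ℝ) (I : FareyInterval) :
    (child lam I false).v - (child lam I false).u = lam * (I.v - I.u) ∧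
      (child lam I true).v - (child lam I true).u = (1 - lam) * (I.v - I.u) := by
  simp only [child]; constructor <;> ring

/-- If the value gaps times the squares of the denominators tend to `0` along the path of `x`, the
derivative at `x` is `0`. -/
theorem hasDerivAt_zero_of_fareyPath {lam x : ℝ} (h0 : 0 < lam) (h1 : lam < 1) (hx : Irrational x)
    (hx0 : 0 < x) (hx1 : x < 1)
    (h : Tendsto (fun n => ((fareyPath lam x n).v - (fareyPath lam x n).u) *
      ((fareyPath lam x n).q + (fareyPath lam x n).s : ℝ) ^ 2) atTop (𝓝 0)) :
    HasDerivAt (dtu lam) 0 x := by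
  rw [hasDerivAt_iff_tendsto_slope]
  obtain ⟨C₁, hC₁, hb₁⟩ := exists_bound_mul_pow h0.le h1 1
  obtain ⟨C₂, hC₂, hb₂⟩ := exists_bound_mul_pow (show 0 ≤ 1 - lam by linarith) (by linarith) 1
  simp only [pow_one] at hb₁ hb₂
  have hmono := dtu_monotone h0 h1
  set C := max C₁ C₂ + 1 with hC
  have hC₁' : C₁ ≤ C := by rw [hC]; linarith [le_max_left C₁ C₂]
  have hC₂' : C₂ ≤ C := by rw [hC]; linarith [le_max_right C₁ C₂]
  have hC1 : 1 ≤ C := by rw [hC]; linarith [le_max_right C₁ C₂]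
  rw [Metric.tendsto_nhds]
  intro ε hε
  obtain ⟨N, hN⟩ := (Metric.tendsto_atTop.1 h) (ε / (4 * C)) (by positivity)
  have hN' : ∀ n ≥ N, ((fareyPath lam x n).v - (fareyPath lam x n).u) *
      ((fareyPath lam x n).q + (fareyPath lam x n).s : ℝ) ^ 2 ≤ ε / (4 * C) := fun n hn => by
    have := hN n hn
    rw [Real.dist_eq, sub_zero] at this
    exact (le_abs_self _).trans this.le
  have hε4 : ε / (4 * C) ≤ ε / 2 := by
    rw [div_le_div_iff₀ (by positivity) (by positivity)]; nlinarith
  filter_upwards [exists_separating (lam := lam) hx hx0 hx1 N, self_mem_nhdsWithin] with y hy hne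
  rw [Real.dist_eq, sub_zero, slope_def_field]
  obtain ⟨n, hn, ⟨hy1, hy2, hmx⟩ | ⟨hy1, hy2, hmx⟩⟩ := hy
  · set I := fareyPath lam x n with hI
    have hR : Reached lam I := fareyPath_reached lam x n
    have hgap := sub_pos.2 (hR.valid h0 h1).2.2.2
    have hq := hR.q_pos
    have hs := hR.s_pos
    have a1 : dtu lam I.med - dtu lam y ≤ ε / 2 * (I.med - y) := by
      have := (hR.child false).slope_hi_le h0 h1 hb₂ (y := y) hy1 hy2
      refine this.trans (mul_le_mul_of_nonneg_right ?_ (sub_nonneg.2 hy2))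
      rw [(child_gap lam I).1]
      simp only [child]
      push_cast
      calc C₂ * (lam * (I.v - I.u)) * ((I.q + I.s) * (I.q + (I.q + I.s)))
          ≤ C * (1 * (I.v - I.u)) * ((I.q + I.s) * (2 * (I.q + I.s))) := by
            gcongr; linarith
        _ = 2 * C * ((I.v - I.u) * (I.q + I.s : ℝ) ^ 2) := by ring
        _ ≤ 2 * C * (ε / (4 * C)) := by gcongr; exact hN' n hn
        _ = ε / 2 := by field_simp; norm_num
    have a2 : dtu lam x - dtu lam I.med ≤ ε / 2 * (x - I.med) := by
      obtain ⟨k, hk, e1, e2, e3, e4⟩ := exists_turn_right (lam := lam) hx hx0 hx1 (n + 1)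
      set J := fareyPath lam x k with hJ
      have hRJ : Reached lam J := fareyPath_reached lam x k
      have hJlo : J.lo = I.med := by
        rw [lo, e1, e2, fareyPath_succ_of_lt hmx]; rfl
      have hJx := (fareyPath_mem (lam := lam) hx hx0 hx1 k).2
      have hgapJ := sub_pos.2 (hRJ.valid h0 h1).2.2.2
      have hqJ := hRJ.q_pos
      have hsJ := hRJ.s_pos
      have b1 : dtu lam x - dtu lam I.med ≤ J.v - J.u := by
        rw [← hJlo, hRJ.dtu_lo h0 h1, ← hRJ.dtu_hi h0 h1]
        linarith [hmono hJx.le]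
      have b2 : 1 ≤ (J.q + J.s : ℝ) ^ 2 * (x - I.med) := by
        have : 1 / ((J.q : ℝ) * (J.q + J.s)) ≤ x - I.med := by
          rw [← hRJ.med_sub_lo, hJlo]; linarith
        rw [div_le_iff₀ (by positivity)] at this
        have h3 : 0 < x - I.med := by linarith
        nlinarith [mul_pos h3 (show (0 : ℝ) < J.s * (J.q + J.s) by positivity)]
      calc dtu lam x - dtu lam I.med ≤ (J.v - J.u) * 1 := by linarith
        _ ≤ (J.v - J.u) * ((J.q + J.s : ℝ) ^ 2 * (x - I.med)) := by gcongr
        _ = ((J.v - J.u) * (J.q + J.s : ℝ) ^ 2) * (x - I.med) := by ring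
        _ ≤ ε / (4 * C) * (x - I.med) :=
          mul_le_mul_of_nonneg_right (hN' k (by omega)) (by linarith)
        _ ≤ ε / 2 * (x - I.med) := mul_le_mul_of_nonneg_right hε4 (by linarith)
    have hyx : y < x := by linarith
    have := hmono hyx.le
    rw [abs_div, abs_of_nonpos (by linarith), abs_of_neg (by linarith),
      div_lt_iff₀ (by linarith)]
    nlinarith
  · set I := fareyPath lam x n with hI
    have hR : Reached lam I := fareyPath_reached lam x n
    have hgap := sub_pos.2 (hR.valid h0 h1).2.2.2
    have hq := hR.q_pos
    have hs := hR.s_pos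
    have a1 : dtu lam y - dtu lam I.med ≤ ε / 2 * (y - I.med) := by
      have := (hR.child true).slope_lo_le h0 h1 hb₁ (y := y) hy2 hy1
      refine this.trans (mul_le_mul_of_nonneg_right ?_ (sub_nonneg.2 hy2))
      rw [(child_gap lam I).2]
      simp only [child]
      push_cast
      calc C₁ * ((1 - lam) * (I.v - I.u)) * ((I.q + I.s) * (I.s + (I.q + I.s)))
          ≤ C * (1 * (I.v - I.u)) * ((I.q + I.s) * (2 * (I.q + I.s))) := by
            gcongr <;> linarith
        _ = 2 * C * ((I.v - I.u) * (I.q + I.s : ℝ) ^ 2) := by ring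
        _ ≤ 2 * C * (ε / (4 * C)) := by gcongr; exact hN' n hn
        _ = ε / 2 := by field_simp; norm_num
    have a2 : dtu lam I.med - dtu lam x ≤ ε / 2 * (I.med - x) := by
      obtain ⟨k, hk, e1, e2, e3, e4⟩ := exists_turn_left (lam := lam) hx hx0 hx1 (n + 1)
      set J := fareyPath lam x k with hJ
      have hRJ : Reached lam J := fareyPath_reached lam x k
      have hJhi : J.hi = I.med := by
        rw [hi, e1, e2, fareyPath_succ_of_gt hmx]; rfl
      have hJx := (fareyPath_mem (lam := lam) hx hx0 hx1 k).1
      have hgapJ := sub_pos.2 (hRJ.valid h0 h1).2.2.2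
      have hqJ := hRJ.q_pos
      have hsJ := hRJ.s_pos
      have b1 : dtu lam I.med - dtu lam x ≤ J.v - J.u := by
        rw [← hJhi, hRJ.dtu_hi h0 h1, ← hRJ.dtu_lo h0 h1]
        linarith [hmono hJx.le]
      have b2 : 1 ≤ (J.q + J.s : ℝ) ^ 2 * (I.med - x) := by
        have : 1 / ((J.q + J.s : ℝ) * J.s) ≤ I.med - x := by
          rw [← hRJ.hi_sub_med, hJhi]; linarith
        rw [div_le_iff₀ (by positivity)] at this
        have h3 : 0 < I.med - x := by linarith
        nlinarith [mul_pos h3 (show (0 : ℝ) < J.q * (J.q + J.s) by positivity)]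
      calc dtu lam I.med - dtu lam x ≤ (J.v - J.u) * 1 := by linarith
        _ ≤ (J.v - J.u) * ((J.q + J.s : ℝ) ^ 2 * (I.med - x)) := by gcongr
        _ = ((J.v - J.u) * (J.q + J.s : ℝ) ^ 2) * (I.med - x) := by ring
        _ ≤ ε / (4 * C) * (I.med - x) :=
          mul_le_mul_of_nonneg_right (hN' k (by omega)) (by linarith)
        _ ≤ ε / 2 * (I.med - x) := mul_le_mul_of_nonneg_right hε4 (by linarith)
    have hyx : x < y := by linarith
    have := hmono hyx.le
    rw [abs_div, abs_of_nonneg (by linarith), abs_of_pos (by linarith),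
      div_lt_iff₀ (by linarith)]
    nlinarith

/-- If the value gaps times the squares of the smaller denominators tend to `∞` along the path of
`x`, the derivative at `x` is `+∞`. -/
theorem hasInfiniteDerivAt_of_fareyPath {lam x : ℝ} (h0 : 0 < lam) (h1 : lam < 1)
    (hx : Irrational x) (hx0 : 0 < x) (hx1 : x < 1)
    (h : Tendsto (fun n => ((fareyPath lam x n).v - (fareyPath lam x n).u) *
      (min (fareyPath lam x n).q (fareyPath lam x n).s : ℝ) ^ 2) atTop atTop) :
    HasInfiniteDerivAt (dtu lam) x := by
  unfold HasInfiniteDerivAt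
  have hmono := dtu_monotone h0 h1
  have h1' : 0 < 1 - lam := by linarith
  rw [tendsto_atTop]
  intro B
  set c := lam * (1 - lam) / 2 with hc
  have hc0 : 0 < c := by positivity
  obtain ⟨N, hN⟩ := eventually_atTop.1 (tendsto_atTop.1 h (|B| / c))
  have hN' : ∀ n ≥ N, |B| ≤ c * (((fareyPath lam x n).v - (fareyPath lam x n).u) *
      (min (fareyPath lam x n).q (fareyPath lam x n).s : ℝ) ^ 2) := fun n hn => by
    have := hN n hn
    rwa [div_le_iff₀' hc0] at this
  -- a difference of arguments at most `2 / M ^ 2` and one of values at least `2 * c * D`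
  have key : ∀ {D M X Y : ℝ}, 0 < D → 0 < M → |B| ≤ c * (D * M ^ 2) → 0 < X → X ≤ 2 / M ^ 2 →
      2 * c * D ≤ Y → B ≤ Y / X := by
    intro D M X Y hD hM hB hX hXM hY
    rw [le_div_iff₀ hX]
    calc B * X ≤ |B| * X := mul_le_mul_of_nonneg_right (le_abs_self B) hX.le
      _ ≤ c * (D * M ^ 2) * (2 / M ^ 2) := by gcongr
      _ = 2 * c * D := by field_simp
      _ ≤ Y := hY
  have hlen : ∀ {a b M : ℝ}, 0 < M → M ≤ a → M ≤ b → 1 / (a * b) ≤ 1 / M ^ 2 := by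
    intro a b M hM ha hb
    refine one_div_le_one_div_of_le (by positivity) ?_
    nlinarith
  filter_upwards [exists_separating (lam := lam) hx hx0 hx1 N, self_mem_nhdsWithin] with y hy hne
  obtain ⟨n, hn, ⟨hy1, hy2, hmx⟩ | ⟨hy1, hy2, hmx⟩⟩ := hy
  · set I := fareyPath lam x n with hI
    have hR : Reached lam I := fareyPath_reached lam x n
    have hgap := sub_pos.2 (hR.valid h0 h1).2.2.2
    have hq := hR.q_pos
    have hs := hR.s_pos
    have hyx : y < x := by linarith
    rw [← neg_div_neg_eq, neg_sub, neg_sub]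
    have hRL := hR.child false
    rcases lt_or_ge y (child lam I false).med with hyz | hyz
    · have hM : (0 : ℝ) < min (I.q : ℝ) I.s := lt_min (by linarith) (by linarith)
      refine key hgap hM (hN' n hn) (by linarith) ?_ ?_
      · have b1 := hR.hi_sub_lo
        have b2 := hlen hM (min_le_left _ _) (min_le_right (I.q : ℝ) I.s)
        have b3 := (fareyPath_mem (lam := lam) hx hx0 hx1 n).2
        have b4 : 2 / (min I.q I.s : ℝ) ^ 2 = 1 / (min I.q I.s : ℝ) ^ 2 + 1 / (min I.q I.s : ℝ) ^ 2 := by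
          ring
        have b5 : 0 < 1 / (min I.q I.s : ℝ) ^ 2 := by positivity
        linarith
      · have b1 := hmono hmx.le
        have b2 := hmono hyz.le
        rw [hR.dtu_med h0 h1] at b1
        rw [hRL.dtu_med h0 h1] at b2
        simp only [child] at b2
        rw [hc]
        linarith
    · obtain ⟨k, hk, e1, e2, e3, e4⟩ := exists_turn_right (lam := lam) hx hx0 hx1 (n + 1)
      set J := fareyPath lam x k with hJ
      have hRJ : Reached lam J := fareyPath_reached lam x k
      rw [fareyPath_succ_of_lt hmx] at e1 e2 e3
      have hJlo : J.lo = I.med := by rw [lo, e1, e2]; rfl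
      have hqJ : (J.q : ℝ) = I.q + I.s := by rw [e2, ← hI]; simp [child]
      have hJx := (fareyPath_mem (lam := lam) hx hx0 hx1 k).2
      have hgapJ := sub_pos.2 (hRJ.valid h0 h1).2.2.2
      have hqJ1 := hRJ.q_pos
      have hsJ := hRJ.s_pos
      have hM : (0 : ℝ) < min (J.q : ℝ) J.s := lt_min (by linarith) (by linarith)
      refine key hgapJ hM (hN' k (by omega)) (by linarith) ?_ ?_
      · have b1 := hRJ.hi_sub_lo
        have b2 := hlen hM (min_le_left _ _) (min_le_right (J.q : ℝ) J.s)
        have b3 := hRL.hi_sub_med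
        have b4 : 2 / (min J.q J.s : ℝ) ^ 2 = 1 / (min J.q J.s : ℝ) ^ 2 + 1 / (min J.q J.s : ℝ) ^ 2 := by
          ring
        have b5 : min (J.q : ℝ) J.s ≤ I.q + I.s := (min_le_left _ _).trans hqJ.le
        have b6 := hlen hM (b5.trans (show (I.q + I.s : ℝ) ≤ I.q + (I.q + I.s) by linarith)) b5
        have b7 : (child lam I false).hi = I.med := rfl
        have b8 : ((child lam I false).s : ℝ) = I.q + I.s := by simp [child]
        have b9 : ((child lam I false).q : ℝ) = I.q := by simp [child]
        rw [b7, b8, b9] at b3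
        linarith
      · have b1 := hmono e4.le
        have b2 := hmono hy2
        rw [hRJ.dtu_med h0 h1] at b1
        rw [← hJlo, hRJ.dtu_lo h0 h1] at b2
        have : 2 * c * (J.v - J.u) ≤ lam * (J.v - J.u) :=
          mul_le_mul_of_nonneg_right (by rw [hc]; nlinarith) hgapJ.le
        linarith
  · set I := fareyPath lam x n with hI
    have hR : Reached lam I := fareyPath_reached lam x n
    have hgap := sub_pos.2 (hR.valid h0 h1).2.2.2
    have hq := hR.q_pos
    have hs := hR.s_pos
    have hyx : x < y := by linarith
    have hRL := hR.child true
    rcases lt_or_ge (child lam I true).med y with hyz | hyz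
    · have hM : (0 : ℝ) < min (I.q : ℝ) I.s := lt_min (by linarith) (by linarith)
      refine key hgap hM (hN' n hn) (by linarith) ?_ ?_
      · have b1 := hR.hi_sub_lo
        have b2 := hlen hM (min_le_left _ _) (min_le_right (I.q : ℝ) I.s)
        have b3 := (fareyPath_mem (lam := lam) hx hx0 hx1 n).1
        have b4 : 2 / (min I.q I.s : ℝ) ^ 2 = 1 / (min I.q I.s : ℝ) ^ 2 + 1 / (min I.q I.s : ℝ) ^ 2 := by
          ring
        have b5 : 0 < 1 / (min I.q I.s : ℝ) ^ 2 := by positivity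
        linarith
      · have b1 := hmono hmx.le
        have b2 := hmono hyz.le
        rw [hR.dtu_med h0 h1] at b1
        rw [hRL.dtu_med h0 h1] at b2
        simp only [child] at b2
        rw [hc]
        linarith
    · obtain ⟨k, hk, e1, e2, e3, e4⟩ := exists_turn_left (lam := lam) hx hx0 hx1 (n + 1)
      set J := fareyPath lam x k with hJ
      have hRJ : Reached lam J := fareyPath_reached lam x k
      rw [fareyPath_succ_of_gt hmx] at e1 e2 e3
      have hJhi : J.hi = I.med := by rw [hi, e1, e2]; rfl
      have hsJ : (J.s : ℝ) = I.q + I.s := by rw [e2, ← hI]; simp [child]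
      have hJx := (fareyPath_mem (lam := lam) hx hx0 hx1 k).1
      have hgapJ := sub_pos.2 (hRJ.valid h0 h1).2.2.2
      have hqJ1 := hRJ.q_pos
      have hsJ1 := hRJ.s_pos
      have hM : (0 : ℝ) < min (J.q : ℝ) J.s := lt_min (by linarith) (by linarith)
      refine key hgapJ hM (hN' k (by omega)) (by linarith) ?_ ?_
      · have b1 := hRJ.hi_sub_lo
        have b2 := hlen hM (min_le_left _ _) (min_le_right (J.q : ℝ) J.s)
        have b3 := hRL.med_sub_lo
        have b4 : 2 / (min J.q J.s : ℝ) ^ 2 = 1 / (min J.q J.s : ℝ) ^ 2 + 1 / (min J.q J.s : ℝ) ^ 2 := by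
          ring
        have b5 : min (J.q : ℝ) J.s ≤ I.q + I.s := (min_le_right _ _).trans hsJ.le
        have b6 := hlen hM b5 (b5.trans (show (I.q + I.s : ℝ) ≤ I.q + I.s + I.s by linarith))
        have b7 : (child lam I true).lo = I.med := rfl
        have b8 : ((child lam I true).q : ℝ) = I.q + I.s := by simp [child]
        have b9 : ((child lam I true).s : ℝ) = I.s := by simp [child]
        rw [b7, b8, b9] at b3
        linarith
      · have b1 := hmono e4.le
        have b2 := hmono hy2
        rw [hRJ.dtu_med h0 h1] at b1
        rw [← hJhi, hRJ.dtu_hi h0 h1] at b2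
        have : 2 * c * (J.v - J.u) ≤ (1 - lam) * (J.v - J.u) :=
          mul_le_mul_of_nonneg_right (by rw [hc]; nlinarith) hgapJ.le
        linarith

/-! ### Farey intervals and convergents -/

section Denominators

variable {d : ℕ → ℕ}

theorem contDen_pos (hd : ∀ n, 0 < d n) (n : ℕ) : 0 < contDen d (n + 1) := by
  induction n with
  | zero => simp [contDen]
  | succ n ih => exact Nat.add_pos_left (Nat.mul_pos (hd n) ih) _

theorem contDen_le_succ (hd : ∀ n, 0 < d n) (n : ℕ) : contDen d n ≤ contDen d (n + 1) := by
  cases n with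
  | zero => simp [contDen]
  | succ n => exact (Nat.le_mul_of_pos_left _ (hd n)).trans (Nat.le_add_right _ _)

theorem digitSum_succ (α β t : ℕ) :
    digitSum α β d (t + 1) = digitSum α β d t + d t * letterWeight α β t := by
  simp [digitSum, Finset.sum_range_succ]

theorem digitSum_mono (α β : ℕ) : Monotone (digitSum α β d) :=
  monotone_nat_of_le_succ fun t => by rw [digitSum_succ]; omega

end Denominators

/-- The interval `I` of the path of `x` is reached after `t` full runs and `k` steps of the next
run; `z` is the complete quotient there, and `φ ^ α` accounts for the step which the root omits. -/
structure IsRunState (α β : ℕ) (d : ℕ → ℕ) (x z : ℝ) (I : FareyInterval) (t k : ℕ) : Prop where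
  one_le : 1 ≤ k
  le_digit : k ≤ d t
  gap : I.v - I.u = Real.goldenRatio ^ α /
    Real.goldenRatio ^ (digitSum α β d t + k * letterWeight α β t)
  even : Even t → I.q = contDen d (t + 1) ∧ I.s = contDen d t + k * contDen d (t + 1) ∧
    I.r - I.s * x = (z⁻¹ - k) * (I.q * x - I.p)
  odd : ¬ Even t → I.s = contDen d (t + 1) ∧ I.q = contDen d t + k * contDen d (t + 1) ∧
    I.q * x - I.p = (z⁻¹ - k) * (I.r - I.s * x)

theorem med_lt_iff {I : FareyInterval} (hq : 0 < I.q) (x : ℝ) :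
    I.med < x ↔ (I.r : ℝ) - I.s * x < I.q * x - I.p := by
  have : (0 : ℝ) < ((I.q + I.s : ℕ) : ℝ) := by exact_mod_cast Nat.add_pos_left hq _
  rw [med, div_lt_iff₀ this]
  push_cast
  constructor <;> intro h <;> linarith

set_option maxHeartbeats 1000000 in
/-- Each interval of the path of `x` belongs to a run of equal turns, and the runs have the lengths
`d 0 - 1, d 1, d 2, …`. -/
theorem exists_isRunState {lam x : ℝ} {α β : ℕ} {d : ℕ → ℕ} {z : ℕ → ℝ} (h0 : 0 < lam)
    (h1 : lam < 1) (hα : lam = (Real.goldenRatio ^ α)⁻¹) (hβ : 1 - lam = (Real.goldenRatio ^ β)⁻¹)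
    (h : IsExpansion x d z) (n : ℕ) :
    ∃ t k, IsRunState α β d x (z t) (fareyPath lam x n) t k ∧ digitSum 1 1 d t + k = n + 1 := by
  have hφ := Real.goldenRatio_pos
  induction n with
  | zero =>
    refine ⟨0, 1, ⟨le_rfl, h.2.1 0, ?_, fun _ => ?_, fun hn => absurd Even.zero hn⟩, by simp [digitSum]⟩
    · simp [fareyPath, root, digitSum, letterWeight, div_self (pow_pos hφ α).ne']
    · have := (h.2.2 0).1
      refine ⟨by simp [fareyPath, root, contDen], by simp [fareyPath, root, contDen], ?_⟩
      rw [h.1] at this ⊢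
      simp only [fareyPath, root]
      push_cast
      field_simp
      ring
  | succ n ih =>
    obtain ⟨t, k, hI, hn⟩ := ih
    set I := fareyPath lam x n with hIdef
    have hR : Reached lam I := fareyPath_reached lam x n
    obtain ⟨hlo, hhi⟩ := fareyPath_mem (lam := lam) h.irrational h.mem_Ioo.1 h.mem_Ioo.2 n
    have hq := hR.q_pos
    have hs := hR.s_pos
    have hA : 0 < I.q * x - I.p := by
      have : I.lo < x := hlo
      rw [lo, div_lt_iff₀ (by linarith)] at this
      linarith
    have hB : 0 < I.r - I.s * x := by
      have : x < I.hi := hhi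
      rw [hi, lt_div_iff₀ (by linarith)] at this
      linarith
    have hz := (h.2.2 t).2.2
    obtain ⟨hz0, hz1, -⟩ := h.2.2 (t + 1)
    have hqn : 0 < I.q := by exact_mod_cast (show (0 : ℝ) < I.q by linarith)
    have hgap := hI.gap
    have hcg := child_gap lam I
    have hle := hI.le_digit
    rcases hle.eq_or_lt with hk | hk
    · -- the run is complete
      have hzk : (z t)⁻¹ - k = z (t + 1) := by rw [hz, hk]; ring
      refine ⟨t + 1, 1, ⟨le_rfl, h.2.1 _, ?_, fun ht => ?_, fun ht => ?_⟩, ?_⟩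
      · rcases Nat.even_or_odd t with ht | ht
        · have hm : I.med < x := by
            rw [med_lt_iff hqn, (hI.even ht).2.2, hzk]; nlinarith
          rw [fareyPath_succ_of_lt hm, ← hIdef, hcg.2, hgap, hβ, digitSum_succ, hk, one_mul,
            pow_add _ _ (letterWeight α β (t + 1))]
          have : ¬ Even (t + 1) := by rw [Nat.even_add_one]; simpa using ht
          simp only [letterWeight, this, if_false]
          field_simp
        · have hm : x < I.med := by
            refine lt_of_not_ge fun hle => ?_
            rcases hle.lt_or_eq with hlt | heq
            · rw [med_lt_iff hqn, (hI.odd (by simpa using ht)).2.2, hzk] at hlt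
              nlinarith
            · exact med_ne h.irrational I heq
          rw [fareyPath_succ_of_gt hm, ← hIdef, hcg.1, hgap, hα, digitSum_succ, hk, one_mul,
            pow_add _ _ (letterWeight α β (t + 1))]
          have : Even (t + 1) := by rw [Nat.even_add_one]; simpa using ht
          simp only [letterWeight, this, if_true]
          field_simp
      · have ht' : ¬ Even t := by rw [Nat.even_add_one] at ht; exact ht
        obtain ⟨e1, e2, e3⟩ := hI.odd ht'
        have hm : x < I.med := by
          refine lt_of_not_ge fun hle => ?_
          rcases hle.lt_or_eq with hlt | heq
          · rw [med_lt_iff hqn, e3, hzk] at hlt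
            nlinarith
          · exact med_ne h.irrational I heq
        rw [fareyPath_succ_of_gt hm, ← hIdef]
        simp only [child, contDen, e1, e2, hk]
        refine ⟨by ring, by ring, ?_⟩
        rw [hzk, e1, e2, hk] at e3
        push_cast at e3 ⊢
        field_simp
        linear_combination -e3
      · have ht' : Even t := by rw [Nat.even_add_one] at ht; simpa using ht
        obtain ⟨e1, e2, e3⟩ := hI.even ht'
        have hm : I.med < x := by
          rw [med_lt_iff hqn, e3, hzk]; nlinarith
        rw [fareyPath_succ_of_lt hm, ← hIdef]
        simp only [child, contDen, e1, e2, hk]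
        refine ⟨by ring, by ring, ?_⟩
        rw [hzk, e1, e2, hk] at e3
        push_cast at e3 ⊢
        field_simp
        linear_combination -e3
      · rw [digitSum_succ, ← hk]
        simp only [letterWeight, ite_self]
        omega
    · -- the run goes on
      have hzk : 1 < (z t)⁻¹ - k := by
        rw [hz]
        have : (k : ℝ) + 1 ≤ d t := by exact_mod_cast hk
        linarith
      refine ⟨t, k + 1, ⟨by omega, hk, ?_, fun ht => ?_, fun ht => ?_⟩, by omega⟩
      · rcases Nat.even_or_odd t with ht | ht
        · have hm : x < I.med := by
            refine lt_of_not_ge fun hle => ?_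
            rcases hle.lt_or_eq with hlt | heq
            · rw [med_lt_iff hqn, (hI.even ht).2.2] at hlt
              nlinarith
            · exact med_ne h.irrational I heq
          rw [fareyPath_succ_of_gt hm, ← hIdef, hcg.1, hgap, hα, add_mul, one_mul, ← add_assoc,
            pow_add _ (_ + _) (letterWeight α β t)]
          simp only [letterWeight, ht, if_true]
          field_simp
        · have hm : I.med < x := by
            rw [med_lt_iff hqn, (hI.odd (by simpa using ht)).2.2]; nlinarith
          rw [fareyPath_succ_of_lt hm, ← hIdef, hcg.2, hgap, hβ, add_mul, one_mul, ← add_assoc,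
            pow_add _ (_ + _) (letterWeight α β t)]
          simp only [letterWeight, Nat.not_even_iff_odd.2 ht, if_false]
          field_simp
      · obtain ⟨e1, e2, e3⟩ := hI.even ht
        have hm : x < I.med := by
          refine lt_of_not_ge fun hle => ?_
          rcases hle.lt_or_eq with hlt | heq
          · rw [med_lt_iff hqn, e3] at hlt
            nlinarith
          · exact med_ne h.irrational I heq
        rw [fareyPath_succ_of_gt hm, ← hIdef]
        refine ⟨e1, by simp only [child, e1, e2]; ring, ?_⟩
        simp only [child]
        push_cast
        linear_combination e3
      · obtain ⟨e1, e2, e3⟩ := hI.odd ht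
        have hm : I.med < x := by
          rw [med_lt_iff hqn, e3]; nlinarith
        rw [fareyPath_succ_of_lt hm, ← hIdef]
        refine ⟨e1, by simp only [child, e1, e2]; ring, ?_⟩
        simp only [child]
        push_cast
        linear_combination e3

/-- The values of `t` along the path tend to infinity. -/
theorem exists_forall_run_le {d : ℕ → ℕ} (T : ℕ) :
    ∃ N, ∀ n ≥ N, ∀ t k, k ≤ d t → digitSum 1 1 d t + k = n + 1 → T ≤ t := by
  refine ⟨digitSum 1 1 d T, fun n hn t k hk h => ?_⟩
  by_contra! hlt
  have h1 : digitSum 1 1 d (t + 1) ≤ digitSum 1 1 d T := digitSum_mono 1 1 hlt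
  rw [digitSum_succ] at h1
  simp only [letterWeight, ite_self] at h1
  omega

section Criteria

variable {lam x : ℝ} {α β : ℕ} {d : ℕ → ℕ} {z : ℕ → ℝ}

theorem one_le_letterWeight (hα1 : 1 ≤ α) (hβ1 : 1 ≤ β) (t : ℕ) : 1 ≤ letterWeight α β t := by
  unfold letterWeight; split_ifs <;> assumption

/-- Criterion for a zero derivative in terms of all denominators. -/
theorem IsExpansion.hasDerivAt_zero (h0 : 0 < lam)
    (h1 : lam < 1) (hα : lam = (Real.goldenRatio ^ α)⁻¹) (hβ : 1 - lam = (Real.goldenRatio ^ β)⁻¹)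
    (hα1 : 1 ≤ α) (hβ1 : 1 ≤ β) (h : IsExpansion x d z)
    (hlim : Tendsto (fun t => (contDen d (t + 1) : ℝ) ^ 2 / Real.goldenRatio ^ digitSum α β d t)
      atTop (𝓝 0)) : HasDerivAt (dtu lam) 0 x := by
  have hφ := Real.one_lt_goldenRatio
  have hφ0 := Real.goldenRatio_pos
  refine hasDerivAt_zero_of_fareyPath h0 h1 h.irrational h.mem_Ioo.1 h.mem_Ioo.2 ?_
  obtain ⟨C, hC, hb⟩ := exists_bound_mul_pow (η := Real.goldenRatio⁻¹) (by positivity)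
    (inv_lt_one_of_one_lt₀ hφ) 2
  rw [Metric.tendsto_atTop] at hlim ⊢
  intro ε hε
  obtain ⟨T, hT⟩ := hlim (ε / (4 * C * Real.goldenRatio ^ α)) (by positivity)
  obtain ⟨N, hN⟩ := exists_forall_run_le (d := d) T
  refine ⟨N, fun n hn => ?_⟩
  obtain ⟨t, k, hI, hnk⟩ := exists_isRunState h0 h1 hα hβ h n
  have hTt := hT t (hN n hn t k hI.le_digit hnk)
  rw [Real.dist_eq, sub_zero] at hTt ⊢
  set I := fareyPath lam x n
  have hqs : (I.q + I.s : ℝ) ≤ 2 * ((k + 1) * contDen d (t + 1)) := by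
    have h1 : (contDen d t : ℝ) ≤ contDen d (t + 1) := by exact_mod_cast contDen_le_succ h.2.1 t
    have h2 : (0 : ℝ) ≤ k * contDen d (t + 1) := by positivity
    by_cases ht : Even t
    · obtain ⟨e1, e2, -⟩ := hI.even ht
      rw [e1, e2]; push_cast; nlinarith
    · obtain ⟨e1, e2, -⟩ := hI.odd ht
      rw [e1, e2]; push_cast; nlinarith
  have hpow : Real.goldenRatio ^ k ≤ Real.goldenRatio ^ (k * letterWeight α β t) :=
    pow_le_pow_right₀ hφ.le (Nat.le_mul_of_pos_right _ (one_le_letterWeight hα1 hβ1 t))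
  have hk2 := hb k
  rw [inv_pow, ← div_eq_mul_inv] at hk2
  rw [hI.gap, abs_of_nonneg (by positivity)]
  rw [abs_of_nonneg (by positivity)] at hTt
  calc Real.goldenRatio ^ α / Real.goldenRatio ^ (digitSum α β d t + k * letterWeight α β t) *
        (I.q + I.s : ℝ) ^ 2
      ≤ Real.goldenRatio ^ α / (Real.goldenRatio ^ digitSum α β d t * Real.goldenRatio ^ k) *
        (2 * ((k + 1) * contDen d (t + 1))) ^ 2 := by
        rw [pow_add]
        gcongr
    _ = 4 * Real.goldenRatio ^ α * (((k : ℝ) + 1) ^ 2 / Real.goldenRatio ^ k) *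
        ((contDen d (t + 1) : ℝ) ^ 2 / Real.goldenRatio ^ digitSum α β d t) := by
        field_simp
        ring
    _ ≤ 4 * Real.goldenRatio ^ α * C *
        ((contDen d (t + 1) : ℝ) ^ 2 / Real.goldenRatio ^ digitSum α β d t) := by gcongr
    _ < 4 * Real.goldenRatio ^ α * C * (ε / (4 * C * Real.goldenRatio ^ α)) := by gcongr
    _ = ε := by field_simp

/-- Criterion for an infinite derivative in terms of all denominators. -/
theorem IsExpansion.hasInfiniteDerivAt (h0 : 0 < lam)
    (h1 : lam < 1) (hα : lam = (Real.goldenRatio ^ α)⁻¹) (hβ : 1 - lam = (Real.goldenRatio ^ β)⁻¹)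
    (h : IsExpansion x d z)
    (hlim : Tendsto (fun t => (contDen d (t + 1) : ℝ) ^ 2 /
      Real.goldenRatio ^ digitSum α β d (t + 1)) atTop atTop) :
    HasInfiniteDerivAt (dtu lam) x := by
  have hφ := Real.one_lt_goldenRatio
  have hφ0 := Real.goldenRatio_pos
  refine hasInfiniteDerivAt_of_fareyPath h0 h1 h.irrational h.mem_Ioo.1 h.mem_Ioo.2 ?_
  rw [tendsto_atTop] at hlim ⊢
  intro B
  obtain ⟨T, hT⟩ := eventually_atTop.1 (hlim (|B|))
  obtain ⟨N, hN⟩ := exists_forall_run_le (d := d) T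
  refine eventually_atTop.2 ⟨N, fun n hn => ?_⟩
  obtain ⟨t, k, hI, hnk⟩ := exists_isRunState h0 h1 hα hβ h n
  have hTt := hT t (hN n hn t k hI.le_digit hnk)
  set I := fareyPath lam x n
  have hqs : (contDen d (t + 1) : ℝ) ≤ min (I.q : ℝ) I.s := by
    have h2 : contDen d (t + 1) ≤ k * contDen d (t + 1) := Nat.le_mul_of_pos_left _ hI.one_le
    by_cases ht : Even t
    · obtain ⟨e1, e2, -⟩ := hI.even ht
      exact le_min (by exact_mod_cast e1.ge) (by exact_mod_cast (by omega))
    · obtain ⟨e1, e2, -⟩ := hI.odd ht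
      exact le_min (by exact_mod_cast (by omega)) (by exact_mod_cast e1.ge)
  have hpow : Real.goldenRatio ^ (digitSum α β d t + k * letterWeight α β t) ≤
      Real.goldenRatio ^ (digitSum α β d (t + 1)) := by
    refine pow_le_pow_right₀ hφ.le ?_
    rw [digitSum_succ]
    exact Nat.add_le_add_left (Nat.mul_le_mul_right _ hI.le_digit) _
  have h1α : 1 ≤ Real.goldenRatio ^ α := one_le_pow₀ hφ.le
  rw [hI.gap]
  calc B ≤ |B| := le_abs_self B
    _ ≤ (contDen d (t + 1) : ℝ) ^ 2 / Real.goldenRatio ^ digitSum α β d (t + 1) := hTt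
    _ = 1 / Real.goldenRatio ^ digitSum α β d (t + 1) * (contDen d (t + 1) : ℝ) ^ 2 := by ring
    _ ≤ _ := by gcongr

theorem tendsto_of_even_odd {X : Type*} {f : ℕ → X} {l : Filter X}
    (h0 : Tendsto (fun t => f (2 * t)) atTop l) (h1 : Tendsto (fun t => f (2 * t + 1)) atTop l) :
    Tendsto f atTop l := by
  intro s hs
  obtain ⟨a, ha⟩ := mem_atTop_sets.1 (h0 hs)
  obtain ⟨b, hb⟩ := mem_atTop_sets.1 (h1 hs)
  refine mem_atTop_sets.2 ⟨2 * (a + b), fun n hn => ?_⟩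
  rcases Nat.even_or_odd' n with ⟨c, rfl | rfl⟩
  · exact ha c (by omega)
  · exact hb c (by omega)

/-- It is enough to control the denominators of even index. -/
theorem IsExpansion.hasDerivAt_zero_of_even (h0 : 0 < lam)
    (h1 : lam < 1) (hα : lam = (Real.goldenRatio ^ α)⁻¹) (hβ : 1 - lam = (Real.goldenRatio ^ β)⁻¹)
    (hα1 : 1 ≤ α) (hβ1 : 1 ≤ β) (h : IsExpansion x d z)
    (hlim : Tendsto (fun t => (contDen d (2 * t + 1) : ℝ) ^ 2 /
      Real.goldenRatio ^ digitSum α β d (2 * t)) atTop (𝓝 0)) : HasDerivAt (dtu lam) 0 x := by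
  have hφ := Real.one_lt_goldenRatio
  have hφ0 := Real.goldenRatio_pos
  refine h.hasDerivAt_zero h0 h1 hα hβ hα1 hβ1 (tendsto_of_even_odd hlim ?_)
  obtain ⟨C, hC, hb⟩ := exists_bound_mul_pow (η := Real.goldenRatio⁻¹) (by positivity)
    (inv_lt_one_of_one_lt₀ hφ) 2
  have hlim' := hlim.const_mul C
  rw [mul_zero] at hlim'
  refine squeeze_zero (fun t => by positivity) (fun t => ?_) hlim'
  have hq : (contDen d (2 * t + 1 + 1) : ℝ) ≤ (d (2 * t) + 1) * contDen d (2 * t + 1) := by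
    have h1 : (contDen d (2 * t) : ℝ) ≤ contDen d (2 * t + 1) := by
      exact_mod_cast contDen_le_succ h.2.1 _
    rw [contDen]; push_cast; linarith
  have hpow : Real.goldenRatio ^ (d (2 * t)) ≤
      Real.goldenRatio ^ (d (2 * t) * letterWeight α β (2 * t)) :=
    pow_le_pow_right₀ hφ.le (Nat.le_mul_of_pos_right _ (one_le_letterWeight hα1 hβ1 _))
  have hk2 := hb (d (2 * t))
  rw [inv_pow, ← div_eq_mul_inv] at hk2
  calc (contDen d (2 * t + 1 + 1) : ℝ) ^ 2 / Real.goldenRatio ^ digitSum α β d (2 * t + 1)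
      ≤ ((d (2 * t) + 1) * contDen d (2 * t + 1)) ^ 2 /
        (Real.goldenRatio ^ digitSum α β d (2 * t) * Real.goldenRatio ^ (d (2 * t))) := by
        rw [digitSum_succ, pow_add]; gcongr
    _ = (((d (2 * t) : ℝ) + 1) ^ 2 / Real.goldenRatio ^ (d (2 * t))) *
        ((contDen d (2 * t + 1) : ℝ) ^ 2 / Real.goldenRatio ^ digitSum α β d (2 * t)) := by
        field_simp
    _ ≤ _ := by gcongr

theorem IsExpansion.hasInfiniteDerivAt_of_even (h0 : 0 < lam)
    (h1 : lam < 1) (hα : lam = (Real.goldenRatio ^ α)⁻¹) (hβ : 1 - lam = (Real.goldenRatio ^ β)⁻¹)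
    (h : IsExpansion x d z)
    (hlim : Tendsto (fun t => (contDen d (2 * t + 1) : ℝ) ^ 2 /
      Real.goldenRatio ^ digitSum α β d (2 * t + 2)) atTop atTop) :
    HasInfiniteDerivAt (dtu lam) x := by
  have hφ := Real.one_lt_goldenRatio
  have hφ0 := Real.goldenRatio_pos
  refine h.hasInfiniteDerivAt h0 h1 hα hβ (tendsto_of_even_odd ?_ ?_)
  · refine tendsto_atTop_mono (fun t => ?_) hlim
    have := pow_le_pow_right₀ hφ.le (digitSum_mono (d := d) α β (show 2 * t + 1 ≤ 2 * t + 2 by omega))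
    gcongr
  · refine tendsto_atTop_mono (fun t => ?_) hlim
    have := contDen_le_succ h.2.1 (2 * t + 1)
    gcongr

end Criteria

end FareyPath

/-! ### Words of pairs of digits -/

/-- The product of the matrices `!![a, 1; 1, 0]` and `!![b, 1; 1, 0]`. -/
def stepMatrix (p : ℕ × ℕ) : Matrix (Fin 2) (Fin 2) ℕ := !![p.1 * p.2 + 1, p.1; p.2, 1]

/-- The continuant matrix of a word of pairs of digits. -/
def wordMatrix (w : List (ℕ × ℕ)) : Matrix (Fin 2) (Fin 2) ℕ := (w.map stepMatrix).prod

/-- The continuant of the word, i.e. the denominator of the continued fraction with these digits. -/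
def wordCont (w : List (ℕ × ℕ)) : ℕ := wordMatrix w 0 0

/-- The weighted digit sum of a word of pairs. -/
def wordWeight (α β : ℕ) (w : List (ℕ × ℕ)) : ℕ := (w.map fun p => α * p.1 + β * p.2).sum

/-- All digits of the word are positive. -/
def PositiveWord (w : List (ℕ × ℕ)) : Prop := ∀ p ∈ w, 0 < p.1 ∧ 0 < p.2

/-- The `n`-fold repetition of a word. -/
def wordPow (w : List (ℕ × ℕ)) (n : ℕ) : List (ℕ × ℕ) := (List.replicate n w).flatten

section WordMatrix

theorem wordMatrix_nil : wordMatrix [] = 1 := by simp [wordMatrix]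

theorem wordMatrix_cons (p : ℕ × ℕ) (w : List (ℕ × ℕ)) :
    wordMatrix (p :: w) = stepMatrix p * wordMatrix w := by simp [wordMatrix]

theorem wordMatrix_append (u v : List (ℕ × ℕ)) :
    wordMatrix (u ++ v) = wordMatrix u * wordMatrix v := by simp [wordMatrix]

theorem wordCont_nil : wordCont [] = 1 := by simp [wordCont, wordMatrix_nil]

theorem wordMatrix_cons_zero (p : ℕ × ℕ) (w : List (ℕ × ℕ)) (j : Fin 2) :
    wordMatrix (p :: w) 0 j = (p.1 * p.2 + 1) * wordMatrix w 0 j + p.1 * wordMatrix w 1 j := by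
  simp [wordMatrix_cons, stepMatrix, Matrix.mul_apply, Fin.sum_univ_two]

theorem wordMatrix_cons_one (p : ℕ × ℕ) (w : List (ℕ × ℕ)) (j : Fin 2) :
    wordMatrix (p :: w) 1 j = p.2 * wordMatrix w 0 j + wordMatrix w 1 j := by
  simp [wordMatrix_cons, stepMatrix, Matrix.mul_apply, Fin.sum_univ_two]

theorem wordMatrix_concat_zero (p : ℕ × ℕ) (w : List (ℕ × ℕ)) (i : Fin 2) :
    wordMatrix (w ++ [p]) i 0 = wordMatrix w i 0 * (p.1 * p.2 + 1) + wordMatrix w i 1 * p.2 := by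
  simp [wordMatrix, stepMatrix, Matrix.mul_apply, Fin.sum_univ_two]

theorem wordMatrix_concat_one (p : ℕ × ℕ) (w : List (ℕ × ℕ)) (i : Fin 2) :
    wordMatrix (w ++ [p]) i 1 = wordMatrix w i 0 * p.1 + wordMatrix w i 1 := by
  simp [wordMatrix, stepMatrix, Matrix.mul_apply, Fin.sum_univ_two]

theorem wordCont_append (u v : List (ℕ × ℕ)) :
    wordCont (u ++ v) = wordCont u * wordCont v + wordMatrix u 0 1 * wordMatrix v 1 0 := by
  simp [wordCont, wordMatrix_append, Matrix.mul_apply, Fin.sum_univ_two]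

theorem PositiveWord.of_cons {p : ℕ × ℕ} {w : List (ℕ × ℕ)} (h : PositiveWord (p :: w)) :
    (0 < p.1 ∧ 0 < p.2) ∧ PositiveWord w :=
  ⟨h p (by simp), fun q hq => h q (by simp [hq])⟩

theorem PositiveWord.append {u v : List (ℕ × ℕ)} (hu : PositiveWord u) (hv : PositiveWord v) :
    PositiveWord (u ++ v) := fun p hp => (List.mem_append.1 hp).elim (hu p) (hv p)

theorem PositiveWord.pow {w : List (ℕ × ℕ)} (hw : PositiveWord w) (n : ℕ) :
    PositiveWord (wordPow w n) := by
  intro p hp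
  simp only [wordPow, List.mem_flatten, List.mem_replicate] at hp
  obtain ⟨l, ⟨-, rfl⟩, hp⟩ := hp
  exact hw p hp

theorem wordMatrix_one_zero_le {w : List (ℕ × ℕ)} (h : PositiveWord w) :
    wordMatrix w 1 0 ≤ wordCont w := by
  unfold wordCont
  cases w with
  | nil => simp [wordMatrix_nil]
  | cons p w =>
    obtain ⟨⟨h1, h2⟩, -⟩ := h.of_cons
    rw [wordMatrix_cons_one, wordMatrix_cons_zero]
    have := Nat.mul_le_mul_right (wordMatrix w 0 0) (Nat.le_mul_of_pos_left p.2 h1)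
    have := Nat.le_mul_of_pos_left (wordMatrix w 1 0) h1
    nlinarith

theorem wordMatrix_zero_one_le {w : List (ℕ × ℕ)} (h : PositiveWord w) :
    wordMatrix w 0 1 ≤ wordCont w := by
  unfold wordCont
  rcases w.eq_nil_or_concat' with rfl | ⟨w, p, rfl⟩
  · simp [wordMatrix_nil]
  · obtain ⟨h1, h2⟩ := h p (by simp)
    rw [wordMatrix_concat_one, wordMatrix_concat_zero]
    have := Nat.mul_le_mul_left (wordMatrix w 0 0) (Nat.le_mul_of_pos_right p.1 h2)
    have := Nat.le_mul_of_pos_right (wordMatrix w 0 1) h2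
    nlinarith

theorem wordCont_mul_le (u v : List (ℕ × ℕ)) :
    wordCont u * wordCont v ≤ wordCont (u ++ v) := by
  rw [wordCont_append]; exact Nat.le_add_right _ _

theorem wordCont_append_le {u v : List (ℕ × ℕ)} (hu : PositiveWord u) (hv : PositiveWord v) :
    wordCont (u ++ v) ≤ 2 * wordCont u * wordCont v := by
  rw [wordCont_append]
  have := Nat.mul_le_mul (wordMatrix_zero_one_le hu) (wordMatrix_one_zero_le hv)
  linarith

theorem wordCont_pos (w : List (ℕ × ℕ)) : 0 < wordCont w := by
  induction w with
  | nil => simp [wordCont_nil]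
  | cons p w ih =>
    unfold wordCont at *
    rw [wordMatrix_cons_zero]
    exact Nat.add_pos_left (Nat.mul_pos (Nat.succ_pos _) ih) _

theorem wordPow_zero (w : List (ℕ × ℕ)) : wordPow w 0 = [] := by simp [wordPow]

theorem wordPow_succ (w : List (ℕ × ℕ)) (n : ℕ) : wordPow w (n + 1) = w ++ wordPow w n := by
  simp [wordPow, List.replicate_succ]

theorem pow_le_wordCont_wordPow (w : List (ℕ × ℕ)) (n : ℕ) :
    wordCont w ^ n ≤ wordCont (wordPow w n) := by
  induction n with
  | zero => simp [wordPow_zero, wordCont_nil]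
  | succ n ih =>
    rw [wordPow_succ, pow_succ']
    exact (Nat.mul_le_mul_left _ ih).trans (wordCont_mul_le _ _)

theorem wordCont_wordPow_le {w : List (ℕ × ℕ)} (hw : PositiveWord w) (n : ℕ) :
    wordCont (wordPow w n) ≤ (2 * wordCont w) ^ n := by
  induction n with
  | zero => simp [wordPow_zero, wordCont_nil]
  | succ n ih =>
    rw [wordPow_succ, pow_succ']
    exact (wordCont_append_le hw (hw.pow n)).trans (Nat.mul_le_mul_left _ ih)

theorem wordWeight_nil (α β : ℕ) : wordWeight α β [] = 0 := by simp [wordWeight]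

theorem wordWeight_cons (α β : ℕ) (p : ℕ × ℕ) (w : List (ℕ × ℕ)) :
    wordWeight α β (p :: w) = α * p.1 + β * p.2 + wordWeight α β w := by simp [wordWeight]

theorem wordWeight_append (α β : ℕ) (u v : List (ℕ × ℕ)) :
    wordWeight α β (u ++ v) = wordWeight α β u + wordWeight α β v := by simp [wordWeight]

theorem wordWeight_wordPow (α β : ℕ) (w : List (ℕ × ℕ)) (n : ℕ) :
    wordWeight α β (wordPow w n) = n * wordWeight α β w := by
  induction n with
  | zero => simp [wordPow_zero, wordWeight_nil]
  | succ n ih => rw [wordPow_succ, wordWeight_append, ih]; ring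

theorem length_wordPow (w : List (ℕ × ℕ)) (n : ℕ) : (wordPow w n).length = n * w.length := by
  simp [wordPow]

/-- The golden ratio bounds all growth rates from below. -/
theorem goldenRatio_pow_le_wordMatrix {w : List (ℕ × ℕ)} (h : PositiveWord w) :
    Real.goldenRatio ^ (2 * w.length + 1) ≤
      Real.goldenRatio * wordMatrix w 0 0 + wordMatrix w 1 0 := by
  have hφ := Real.goldenRatio_pos
  have hsq := Real.goldenRatio_sq
  induction w with
  | nil => simp [wordMatrix_nil]
  | cons p w ih =>
    obtain ⟨⟨h1, h2⟩, hw⟩ := h.of_cons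
    have ih := ih hw
    rw [wordMatrix_cons_one, wordMatrix_cons_zero, List.length_cons]
    have h1' : (1 : ℝ) ≤ p.1 := by exact_mod_cast h1
    have h2' : (1 : ℝ) ≤ p.2 := by exact_mod_cast h2
    have hx : (0 : ℝ) ≤ wordMatrix w 0 0 := by positivity
    have hy : (0 : ℝ) ≤ wordMatrix w 1 0 := by positivity
    push_cast
    have h12 : (1 : ℝ) ≤ p.1 * p.2 := by nlinarith
    calc Real.goldenRatio ^ (2 * (w.length + 1) + 1)
        = Real.goldenRatio ^ 2 * Real.goldenRatio ^ (2 * w.length + 1) := by ring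
      _ ≤ Real.goldenRatio ^ 2 * (Real.goldenRatio * wordMatrix w 0 0 + wordMatrix w 1 0) := by
        gcongr
      _ = Real.goldenRatio * ((1 + 1) * wordMatrix w 0 0 + 1 * wordMatrix w 1 0) +
          (1 * wordMatrix w 0 0 + wordMatrix w 1 0) := by
        rw [hsq]; linear_combination (wordMatrix w 0 0 : ℝ) * hsq
      _ ≤ _ := by gcongr

theorem goldenRatio_pow_le_wordCont {w : List (ℕ × ℕ)} (h : PositiveWord w) :
    Real.goldenRatio ^ (2 * w.length) ≤ Real.goldenRatio * wordCont w := by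
  have hφ := Real.goldenRatio_pos
  have h1 := goldenRatio_pow_le_wordMatrix h
  have h2 : (wordMatrix w 1 0 : ℝ) ≤ wordCont w := by exact_mod_cast wordMatrix_one_zero_le h
  have h3 : Real.goldenRatio * wordMatrix w 0 0 + wordMatrix w 1 0 ≤
      Real.goldenRatio * (Real.goldenRatio * wordCont w) := by
    have : Real.goldenRatio * (Real.goldenRatio * wordCont w) =
        Real.goldenRatio * wordCont w + wordCont w := by
      linear_combination (wordCont w : ℝ) * Real.goldenRatio_sq
    rw [this]
    unfold wordCont at *
    linarith
  rw [pow_succ'] at h1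
  exact le_of_mul_le_mul_left (h1.trans h3) hφ

end WordMatrix

section Prefix

/-- The first `t` pairs of a digit sequence. -/
def prefixWord (d : ℕ → ℕ) (t : ℕ) : List (ℕ × ℕ) :=
  (List.range t).map fun i => (d (2 * i), d (2 * i + 1))

theorem prefixWord_succ (d : ℕ → ℕ) (t : ℕ) :
    prefixWord d (t + 1) = prefixWord d t ++ [(d (2 * t), d (2 * t + 1))] := by
  simp [prefixWord, List.range_succ]

theorem length_prefixWord (d : ℕ → ℕ) (t : ℕ) : (prefixWord d t).length = t := by
  simp [prefixWord]

theorem positiveWord_prefixWord {d : ℕ → ℕ} (hd : ∀ n, 0 < d n) (t : ℕ) :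
    PositiveWord (prefixWord d t) := by
  intro p hp
  simp only [prefixWord, List.mem_map] at hp
  obtain ⟨i, -, rfl⟩ := hp
  exact ⟨hd _, hd _⟩

theorem wordMatrix_prefixWord (d : ℕ → ℕ) (t : ℕ) :
    wordMatrix (prefixWord d t) 0 0 = contDen d (2 * t + 1) ∧
      wordMatrix (prefixWord d t) 0 1 = contDen d (2 * t) := by
  induction t with
  | zero => simp [prefixWord, wordMatrix_nil, contDen]
  | succ t ih =>
    rw [prefixWord_succ, wordMatrix_concat_zero, wordMatrix_concat_one, ih.1, ih.2]
    have e : 2 * (t + 1) = 2 * t + 2 := by ring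
    rw [e]
    simp only [contDen]
    constructor <;> ring

theorem wordCont_prefixWord (d : ℕ → ℕ) (t : ℕ) :
    wordCont (prefixWord d t) = contDen d (2 * t + 1) := (wordMatrix_prefixWord d t).1

theorem wordWeight_prefixWord (α β : ℕ) (d : ℕ → ℕ) (t : ℕ) :
    wordWeight α β (prefixWord d t) = digitSum α β d (2 * t) := by
  induction t with
  | zero => simp [prefixWord, wordWeight, digitSum]
  | succ t ih =>
    rw [prefixWord_succ, wordWeight_append, ih, show 2 * (t + 1) = 2 * t + 1 + 1 by ring,
      digitSum_succ, digitSum_succ]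
    have : ¬ Even (2 * t + 1) := by simp
    simp only [letterWeight, even_two_mul, this, if_true, if_false, wordWeight_cons,
      wordWeight_nil]
    ring

end Prefix

section Transpose

/-- Reading a word backwards, which exchanges the two positions in each pair. -/
def reverseWord (w : List (ℕ × ℕ)) : List (ℕ × ℕ) := (w.map Prod.swap).reverse

theorem wordMatrix_reverseWord (w : List (ℕ × ℕ)) :
    wordMatrix (reverseWord w) = (wordMatrix w).transpose := by
  rw [wordMatrix, wordMatrix, Matrix.transpose_list_prod, reverseWord]
  simp only [List.map_reverse, List.map_map]
  congr 2
  refine List.map_congr_left fun p _ => ?_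
  ext i j
  fin_cases i <;> fin_cases j <;> simp [stepMatrix, mul_comm]

theorem wordCont_reverseWord (w : List (ℕ × ℕ)) : wordCont (reverseWord w) = wordCont w := by
  simp [wordCont, wordMatrix_reverseWord]

theorem wordWeight_reverseWord (α β : ℕ) (w : List (ℕ × ℕ)) :
    wordWeight β α (reverseWord w) = wordWeight α β w := by
  simp only [wordWeight, reverseWord, List.map_reverse, List.sum_reverse, List.map_map]
  congr 1
  refine List.map_congr_left fun p _ => ?_
  simp [add_comm]

theorem length_reverseWord (w : List (ℕ × ℕ)) : (reverseWord w).length = w.length := by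
  simp [reverseWord]

theorem PositiveWord.reverseWord {w : List (ℕ × ℕ)} (h : PositiveWord w) :
    PositiveWord (reverseWord w) := by
  intro p hp
  simp only [_root_.reverseWord, List.mem_reverse, List.mem_map] at hp
  obtain ⟨q, hq, rfl⟩ := hp
  exact (h q hq).symm

end Transpose

/-! ### Growing words and the critical average -/

/-- The words along which the squared denominator grows faster than the values shrink. -/
def growingWords (α β : ℕ) : Set (List (ℕ × ℕ)) :=
  {w | PositiveWord w ∧ Real.goldenRatio ^ wordWeight α β w < (wordCont w : ℝ) ^ 2}

/-- The supremum of the average weights of the words in `growingWords`. -/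
noncomputable def criticalAverage (α β : ℕ) : ℝ :=
  sSup ((fun w : List (ℕ × ℕ) => (wordWeight α β w : ℝ) / w.length) '' growingWords α β)

theorem reverseWord_mem_growingWords {α β : ℕ} {w : List (ℕ × ℕ)} (h : w ∈ growingWords α β) :
    reverseWord w ∈ growingWords β α :=
  ⟨h.1.reverseWord, by rw [wordWeight_reverseWord, wordCont_reverseWord]; exact h.2⟩

theorem criticalAverage_comm (α β : ℕ) : criticalAverage α β = criticalAverage β α := by
  have key : ∀ α β : ℕ,
      (fun w : List (ℕ × ℕ) => (wordWeight α β w : ℝ) / w.length) '' growingWords α β ⊆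
      (fun w : List (ℕ × ℕ) => (wordWeight β α w : ℝ) / w.length) '' growingWords β α := by
    rintro α β _ ⟨w, hw, rfl⟩
    exact ⟨reverseWord w, reverseWord_mem_growingWords hw, by
      simp [wordWeight_reverseWord, length_reverseWord]⟩
  exact congrArg sSup ((key α β).antisymm (key β α))

theorem length_pos_of_mem_growingWords {α β : ℕ} {w : List (ℕ × ℕ)} (h : w ∈ growingWords α β) :
    0 < w.length := by
  refine List.length_pos_iff.2 ?_
  rintro rfl
  simpa [wordWeight_nil, wordCont_nil] using h.2

theorem goldenRatio_tendsto_pow : Tendsto (fun n : ℕ => Real.goldenRatio ^ n) atTop atTop :=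
  tendsto_pow_atTop_atTop_of_one_lt Real.one_lt_goldenRatio

/-- If the average weight exceeds all averages of growing words, then the values shrink faster than
the squared denominators grow: appending a small proportion of light pairs `(1, 1)` to a prefix does
not make it a growing word. -/
theorem tendsto_zero_of_lt_average {α β : ℕ} (hαβ : α + β = 3) {d : ℕ → ℕ} (hd : ∀ n, 0 < d n)
    {κ c : ℝ} (hκ : ∀ w ∈ growingWords α β, (wordWeight α β w : ℝ) ≤ κ * w.length) (hκ0 : 0 ≤ κ)
    (hc : κ < c) (hlim : ∀ᶠ t : ℕ in atTop, c * t ≤ digitSum α β d (2 * t)) :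
    Tendsto (fun t => (contDen d (2 * t + 1) : ℝ) ^ 2 /
      Real.goldenRatio ^ digitSum α β d (2 * t)) atTop (𝓝 0) := by
  have hφ := Real.goldenRatio_pos
  obtain ⟨p, hp⟩ := exists_nat_gt (κ / (c - κ))
  have hc' : 0 < c - κ := by linarith
  have hp0 : 0 < p := by
    have : (0 : ℝ) < p := lt_of_le_of_lt (by positivity) hp
    exact_mod_cast this
  rw [div_lt_iff₀ hc'] at hp
  have hdiv : Tendsto (fun t : ℕ => t / p) atTop atTop :=
    Nat.tendsto_div_const_atTop hp0.ne'
  have hz : Tendsto (fun t : ℕ => Real.goldenRatio ^ 2 / Real.goldenRatio ^ (t / p)) atTop (𝓝 0) :=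
    tendsto_const_nhds.div_atTop (goldenRatio_tendsto_pow.comp hdiv)
  refine squeeze_zero' (Eventually.of_forall fun t => by positivity) ?_ hz
  filter_upwards [hlim, eventually_gt_atTop 0] with t ht ht0
  set m := t / p with hm
  set w := prefixWord d t ++ wordPow [(1, 1)] m with hw
  have hpos1 : PositiveWord [((1 : ℕ), (1 : ℕ))] := by simp [PositiveWord]
  have hpos : PositiveWord w := (positiveWord_prefixWord hd t).append (hpos1.pow m)
  have hlen : w.length = t + m := by simp [hw, length_prefixWord, length_wordPow]
  have hwt : wordWeight α β w = digitSum α β d (2 * t) + 3 * m := by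
    rw [hw, wordWeight_append, wordWeight_prefixWord, wordWeight_wordPow, wordWeight_cons,
      wordWeight_nil]
    simp only [mul_one, hαβ]
    ring
  have hmt : (m : ℝ) * p ≤ t := by exact_mod_cast Nat.div_mul_le_self t p
  have hnot : w ∉ growingWords α β := by
    intro hmem
    have h1 := hκ w hmem
    rw [hwt, hlen] at h1
    push_cast at h1
    have ht0' : (0 : ℝ) < t := by exact_mod_cast ht0
    have h2 : κ * m * p < (c - κ) * t * p := by
      calc κ * m * p = κ * (m * p) := by ring
        _ ≤ κ * t := by gcongr
        _ < p * (c - κ) * t := by gcongr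
        _ = _ := by ring
    have h3 : κ * m < (c - κ) * t := lt_of_mul_lt_mul_right h2 (by positivity)
    nlinarith
  have hle : (wordCont w : ℝ) ^ 2 ≤ Real.goldenRatio ^ wordWeight α β w := by
    by_contra! h
    exact hnot ⟨hpos, h⟩
  rw [hwt] at hle
  have h4 : Real.goldenRatio ^ (2 * m) ≤ Real.goldenRatio * wordCont (wordPow [(1, 1)] m) := by
    have := goldenRatio_pow_le_wordCont (hpos1.pow m)
    simpa [length_wordPow] using this
  have h5 : (contDen d (2 * t + 1) : ℝ) * wordCont (wordPow [(1, 1)] m) ≤ wordCont w := by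
    rw [← wordCont_prefixWord]
    exact_mod_cast wordCont_mul_le _ _
  rw [div_le_div_iff₀ (by positivity) (by positivity)]
  have h6 : (contDen d (2 * t + 1) : ℝ) * Real.goldenRatio ^ (2 * m) ≤
      Real.goldenRatio * wordCont w := by
    calc (contDen d (2 * t + 1) : ℝ) * Real.goldenRatio ^ (2 * m)
        ≤ contDen d (2 * t + 1) * (Real.goldenRatio * wordCont (wordPow [(1, 1)] m)) := by gcongr
      _ = Real.goldenRatio * (contDen d (2 * t + 1) * wordCont (wordPow [(1, 1)] m)) := by ring
      _ ≤ _ := by gcongr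
  have h7 := pow_le_pow_left₀ (by positivity) h6 2
  have h8 : 0 < Real.goldenRatio ^ (3 * m) := by positivity
  refine le_of_mul_le_mul_right ?_ h8
  calc (contDen d (2 * t + 1) : ℝ) ^ 2 * Real.goldenRatio ^ m * Real.goldenRatio ^ (3 * m)
      = ((contDen d (2 * t + 1) : ℝ) * Real.goldenRatio ^ (2 * m)) ^ 2 := by ring
    _ ≤ (Real.goldenRatio * wordCont w) ^ 2 := h7
    _ = Real.goldenRatio ^ 2 * (wordCont w : ℝ) ^ 2 := by ring
    _ ≤ Real.goldenRatio ^ 2 * Real.goldenRatio ^ (digitSum α β d (2 * t) + 3 * m) := by gcongr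
    _ = _ := by ring

/-! ### Periodic expansions -/

section Periodic

/-- The purely periodic digit sequence with period `w`. -/
def periodicDigit (w : List (ℕ × ℕ)) (n : ℕ) : ℕ :=
  if Even n then (w.getD (n / 2 % w.length) (1, 1)).1 else (w.getD (n / 2 % w.length) (1, 1)).2

theorem periodicDigit_pos {w : List (ℕ × ℕ)} (hw : PositiveWord w) (n : ℕ) :
    0 < periodicDigit w n := by
  have : ∀ i, 0 < (w.getD i (1, 1)).1 ∧ 0 < (w.getD i (1, 1)).2 := by
    intro i
    rcases lt_or_ge i w.length with h | h
    · rw [List.getD_eq_getElem _ _ h]; exact hw _ (List.getElem_mem h)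
    · rw [List.getD_eq_default _ _ h]; simp
  unfold periodicDigit
  split_ifs
  exacts [(this _).1, (this _).2]

theorem prefixWord_periodicDigit (w : List (ℕ × ℕ)) (n : ℕ) :
    prefixWord (periodicDigit w) (n * w.length) = wordPow w n := by
  have hfun : ∀ i, (periodicDigit w (2 * i), periodicDigit w (2 * i + 1)) =
      w.getD (i % w.length) (1, 1) := by
    intro i
    have h2 : (2 * i + 1) / 2 = i := by omega
    have : ¬ Even (2 * i + 1) := by simp
    simp [periodicDigit, this, h2]
  unfold prefixWord
  simp only [hfun]
  induction n with
  | zero => simp [wordPow_zero]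
  | succ n ih =>
    rw [wordPow_succ, add_mul, one_mul, add_comm, List.range_add, List.map_append, List.map_map]
    congr 1
    · refine List.ext_getElem (by simp) fun i h1 h2 => ?_
      simp [Nat.mod_eq_of_lt h2, h2]
    · rw [← ih]
      refine List.map_congr_left fun i _ => ?_
      simp

variable {α β : ℕ} {w : List (ℕ × ℕ)}

theorem digitSum_periodicDigit (n : ℕ) :
    digitSum α β (periodicDigit w) (2 * (n * w.length)) = n * wordWeight α β w := by
  rw [← wordWeight_prefixWord, prefixWord_periodicDigit, wordWeight_wordPow]

theorem periodic_bounds (hw : 0 < w.length) (t : ℕ) :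
    t / w.length * wordWeight α β w ≤ digitSum α β (periodicDigit w) (2 * t) ∧
      digitSum α β (periodicDigit w) (2 * t + 2) ≤ (t / w.length + 1) * wordWeight α β w := by
  rw [← digitSum_periodicDigit, ← digitSum_periodicDigit]
  have h1 := Nat.div_mul_le_self t w.length
  have h2 : t < (t / w.length + 1) * w.length := by
    rw [add_mul, one_mul, mul_comm]
    exact Nat.lt_mul_div_succ t hw
  exact ⟨digitSum_mono _ _ (by omega), digitSum_mono _ _ (by omega)⟩

theorem tendsto_average_periodicDigit (hw : 0 < w.length) :
    Tendsto (fun t : ℕ => (digitSum α β (periodicDigit w) (2 * t) : ℝ) / t) atTop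
      (𝓝 ((wordWeight α β w : ℝ) / w.length)) := by
  have hz : Tendsto (fun t : ℕ => (wordWeight α β w : ℝ) / t) atTop (𝓝 0) :=
    tendsto_const_div_atTop_nhds_zero_nat _
  rw [← tendsto_sub_nhds_zero_iff]
  refine squeeze_zero_norm' ?_ hz
  filter_upwards [eventually_gt_atTop 0] with t ht
  obtain ⟨h1, h2⟩ := periodic_bounds (α := α) (β := β) hw t
  have h3 := digitSum_mono (d := periodicDigit w) α β (show 2 * t ≤ 2 * t + 2 by omega)
  have h4 := Nat.div_mul_le_self t w.length
  have h5 : t < (t / w.length + 1) * w.length := by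
    rw [add_mul, one_mul, mul_comm]
    exact Nat.lt_mul_div_succ t hw
  set n := t / w.length
  set S := wordWeight α β w
  set D := digitSum α β (periodicDigit w) (2 * t)
  set ℓ := w.length
  have ht' : (0 : ℝ) < t := by exact_mod_cast ht
  have hℓ : (0 : ℝ) < ℓ := by exact_mod_cast hw
  have hS : (0 : ℝ) ≤ S := by positivity
  have g1 : (n : ℝ) * S ≤ D := by exact_mod_cast h1
  have g2 : (D : ℝ) ≤ (n + 1) * S := by exact_mod_cast h3.trans h2
  have g4 : (n : ℝ) * ℓ ≤ t := by exact_mod_cast h4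
  have g5 : (t : ℝ) ≤ (n + 1) * ℓ := by exact_mod_cast h5.le
  have e : (D : ℝ) / t - S / ℓ = (D * ℓ - S * t) / (t * ℓ) := by field_simp
  rw [e, Real.norm_eq_abs, abs_div, abs_of_pos (show (0 : ℝ) < t * ℓ by positivity),
    div_le_div_iff₀ (by positivity) ht']
  have : |(D : ℝ) * ℓ - S * t| ≤ S * ℓ := by
    rw [abs_le]
    constructor <;> nlinarith [mul_le_mul_of_nonneg_right g1 hℓ.le,
      mul_le_mul_of_nonneg_right g2 hℓ.le, mul_le_mul_of_nonneg_left g4 hS,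
      mul_le_mul_of_nonneg_left g5 hS]
  nlinarith

theorem contDen_mono {d : ℕ → ℕ} (hd : ∀ n, 0 < d n) : Monotone (contDen d) :=
  monotone_nat_of_le_succ (contDen_le_succ hd)

theorem tendsto_atTop_periodicDigit (hw : PositiveWord w)
    (h : Real.goldenRatio ^ wordWeight α β w < (wordCont w : ℝ) ^ 2) :
    Tendsto (fun t => (contDen (periodicDigit w) (2 * t + 1) : ℝ) ^ 2 /
      Real.goldenRatio ^ digitSum α β (periodicDigit w) (2 * t + 2)) atTop atTop := by
  have hφ := Real.one_lt_goldenRatio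
  have hφ0 := Real.goldenRatio_pos
  have hlen := length_pos_of_mem_growingWords (show w ∈ growingWords α β from ⟨hw, h⟩)
  set S := wordWeight α β w
  have hratio : 1 < (wordCont w : ℝ) ^ 2 / Real.goldenRatio ^ S :=
    (one_lt_div (by positivity)).2 h
  have hdiv : Tendsto (fun t : ℕ => t / w.length) atTop atTop :=
    Nat.tendsto_div_const_atTop hlen.ne'
  have hz := ((tendsto_pow_atTop_atTop_of_one_lt hratio).comp hdiv).atTop_div_const
    (show 0 < Real.goldenRatio ^ S by positivity)
  refine tendsto_atTop_mono (fun t => ?_) hz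
  have h1 := pow_le_pow_right₀ hφ.le (periodic_bounds (α := α) (β := β) hlen t).2
  have h2 : wordCont w ^ (t / w.length) ≤ contDen (periodicDigit w) (2 * t + 1) := by
    refine (pow_le_wordCont_wordPow w _).trans ?_
    rw [← prefixWord_periodicDigit, wordCont_prefixWord]
    refine contDen_mono (periodicDigit_pos hw) ?_
    have := Nat.div_mul_le_self t w.length
    omega
  have h2' : (wordCont w : ℝ) ^ (t / w.length) ≤ contDen (periodicDigit w) (2 * t + 1) := by
    exact_mod_cast h2
  simp only [Function.comp_apply]
  calc ((wordCont w : ℝ) ^ 2 / Real.goldenRatio ^ S) ^ (t / w.length) / Real.goldenRatio ^ S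
      = ((wordCont w : ℝ) ^ (t / w.length)) ^ 2 /
        Real.goldenRatio ^ ((t / w.length + 1) * S) := by
        rw [div_pow, div_div, ← pow_mul, ← pow_mul, ← pow_mul, ← pow_add]
        congr 2 <;> ring
    _ ≤ _ := by gcongr

/-- The factor `2` covers the failure of continuants to be multiplicative along the period. -/
theorem tendsto_zero_periodicDigit (hw : PositiveWord w) (hlen : 0 < w.length)
    (h : (2 * wordCont w : ℝ) ^ 2 < Real.goldenRatio ^ wordWeight α β w) :
    Tendsto (fun t => (contDen (periodicDigit w) (2 * t + 1) : ℝ) ^ 2 /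
      Real.goldenRatio ^ digitSum α β (periodicDigit w) (2 * t)) atTop (𝓝 0) := by
  have hφ := Real.one_lt_goldenRatio
  have hφ0 := Real.goldenRatio_pos
  set S := wordWeight α β w
  have hratio : (2 * wordCont w : ℝ) ^ 2 / Real.goldenRatio ^ S < 1 :=
    (div_lt_one (by positivity)).2 h
  have hdiv : Tendsto (fun t : ℕ => t / w.length) atTop atTop :=
    Nat.tendsto_div_const_atTop hlen.ne'
  have hz := ((tendsto_pow_atTop_nhds_zero_of_lt_one (by positivity) hratio).comp hdiv).const_mul
    ((2 * wordCont w : ℝ) ^ 2)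
  rw [mul_zero] at hz
  refine squeeze_zero (fun t => by positivity) (fun t => ?_) hz
  have h1 := pow_le_pow_right₀ hφ.le (periodic_bounds (α := α) (β := β) hlen t).1
  have h2 : contDen (periodicDigit w) (2 * t + 1) ≤ (2 * wordCont w) ^ (t / w.length + 1) := by
    refine le_trans ?_ (wordCont_wordPow_le hw _)
    rw [← prefixWord_periodicDigit, wordCont_prefixWord]
    refine contDen_mono (periodicDigit_pos hw) ?_
    have : t < (t / w.length + 1) * w.length := by
      rw [add_mul, one_mul, mul_comm]
      exact Nat.lt_mul_div_succ t hlen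
    omega
  have h2' : (contDen (periodicDigit w) (2 * t + 1) : ℝ) ≤
      (2 * wordCont w : ℝ) ^ (t / w.length + 1) := by exact_mod_cast h2
  simp only [Function.comp_apply]
  calc (contDen (periodicDigit w) (2 * t + 1) : ℝ) ^ 2 /
        Real.goldenRatio ^ digitSum α β (periodicDigit w) (2 * t)
      ≤ ((2 * wordCont w : ℝ) ^ (t / w.length + 1)) ^ 2 /
        Real.goldenRatio ^ (t / w.length * S) := by gcongr
    _ = _ := by
        rw [div_pow (_ ^ 2) (Real.goldenRatio ^ S), ← mul_div_assoc, ← pow_mul, ← pow_mul, ← pow_mul, ← pow_add]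
        congr 2 <;> ring

end Periodic

/-! ### Bounds for the critical average -/

section UpperBound

/-- The linear part of the potential after appending the pair `(a, b)` to a word with denominators
`q` and `q'`. -/
theorem potential_base {a b : ℕ} (ha : 1 ≤ a) (ha7 : a ≤ 7) (hb : 1 ≤ b) (hb4 : b ≤ 4) {q q' : ℝ}
    (h0 : 0 ≤ q') (h1 : q' ≤ q) :
    (if b = 1 then (1.01 : ℝ) else 1) * ((a * (b + 0.1366) + 1) * q + (b + 0.1366) * q') ≤
      1.1431 ^ (a + 2 * b) * 4.036 *
        ((if 2 * q' ≤ q then 1 else 1.01) * (q + 0.1366 * q')) := by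
  split_ifs with hb1 hq hq
  · subst hb1
    interval_cases a <;> norm_num <;> linarith
  · subst hb1
    rw [not_le] at hq
    interval_cases a <;> norm_num <;> linarith
  · have : 2 ≤ b := by omega
    clear hb hb1
    interval_cases b <;> interval_cases a <;> norm_num <;> linarith
  · have : 2 ≤ b := by omega
    clear hb hb1
    rw [not_le] at hq
    interval_cases b <;> interval_cases a <;> norm_num <;> linarith

theorem potential_step {a b : ℕ} (ha : 1 ≤ a) (hb : 1 ≤ b) {q q' : ℝ}
    (h0 : 0 ≤ q') (h1 : q' ≤ q) :
    (if b = 1 then (1.01 : ℝ) else 1) * ((a * (b + 0.1366) + 1) * q + (b + 0.1366) * q') ≤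
      1.1431 ^ (a + 2 * b) * 4.036 *
        ((if 2 * q' ≤ q then 1 else 1.01) * (q + 0.1366 * q')) := by
  have hq : 0 ≤ q := h0.trans h1
  set N : ℝ := (if 2 * q' ≤ q then 1 else 1.01) * (q + 0.1366 * q') with hN
  -- `b ≤ 4` and arbitrary `a`
  have hsmall : ∀ b : ℕ, 1 ≤ b → b ≤ 4 →
      (if b = 1 then (1.01 : ℝ) else 1) * ((a * (b + 0.1366) + 1) * q + (b + 0.1366) * q') ≤
      1.1431 ^ (a + 2 * b) * 4.036 * N := by
    intro b hb hb4
    rcases le_total a 7 with ha7 | ha7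
    · exact potential_base ha ha7 hb hb4 h0 h1
    · induction a, ha7 using Nat.le_induction with
      | base => exact potential_base (by norm_num) le_rfl hb hb4 h0 h1
      | succ a ha7 ih =>
        have ih := ih (by omega)
        have hκ : (0 : ℝ) ≤ if b = 1 then (1.01 : ℝ) else 1 := by split_ifs <;> norm_num
        have ha' : (7 : ℝ) ≤ a := by exact_mod_cast ha7
        have hb' : (1 : ℝ) ≤ b := by exact_mod_cast hb
        have e : (((a + 1 : ℕ) : ℝ) * (b + 0.1366) + 1) * q + (b + 0.1366) * q' ≤
            1.1431 * ((a * (b + 0.1366) + 1) * q + (b + 0.1366) * q') := by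
          push_cast
          have h2 : 0 ≤ ((a : ℝ) - 7) * ((b + 0.1366) * q) :=
            mul_nonneg (by linarith) (by positivity)
          have h3 : 0 ≤ (b + 0.1366) * q' := by positivity
          have h4 : 0 ≤ (b + 0.1366) * q := by positivity
          linarith
        calc _ ≤ (if b = 1 then (1.01 : ℝ) else 1) *
              (1.1431 * ((a * (b + 0.1366) + 1) * q + (b + 0.1366) * q')) :=
              mul_le_mul_of_nonneg_left e hκ
          _ = 1.1431 * ((if b = 1 then (1.01 : ℝ) else 1) *
              ((a * (b + 0.1366) + 1) * q + (b + 0.1366) * q')) := by ring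
          _ ≤ 1.1431 * (1.1431 ^ (a + 2 * b) * 4.036 * N) := by gcongr
          _ = _ := by rw [show a + 1 + 2 * b = a + 2 * b + 1 by ring, pow_succ]; ring
  rcases le_total b 4 with hb4 | hb4
  · exact hsmall b hb hb4
  · induction b, hb4 using Nat.le_induction with
    | base => exact hsmall 4 (by norm_num) le_rfl
    | succ b hb4 ih =>
      have ih := ih (by omega)
      have hb' : (4 : ℝ) ≤ b := by exact_mod_cast hb4
      rw [if_neg (by omega), one_mul] at ih ⊢
      have e : ((a : ℝ) * (((b + 1 : ℕ) : ℝ) + 0.1366) + 1) * q +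
          (((b + 1 : ℕ) : ℝ) + 0.1366) * q' ≤
          1.1431 ^ 2 * ((a * (b + 0.1366) + 1) * q + (b + 0.1366) * q') := by
        push_cast
        have h2 : 0 ≤ ((b : ℝ) - 4) * (a * q + q') := mul_nonneg (by linarith) (by positivity)
        have h3 : 0 ≤ a * q + q' := by positivity
        nlinarith
      calc _ ≤ 1.1431 ^ 2 * ((a * (b + 0.1366) + 1) * q + (b + 0.1366) * q') := e
        _ ≤ 1.1431 ^ 2 * (1.1431 ^ (a + 2 * b) * 4.036 * N) := by gcongr
        _ = _ := by rw [show a + 2 * (b + 1) = a + 2 * b + 2 by ring, pow_add _ _ 2]; ring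

/-- The growth of continuants against the weight `a + 2 * b`. The potential `q + 0.1366 * q'`, with
a penalty when `q' > q / 2`, is a nearly optimal one: `0.1366` is close to the slope of the
eigenvector for the pair `(7, 3)`, and the constants make the steps `(7, 3)` and `(7, 4)` nearly
sharp. -/
theorem wordCont_potential_le {w : List (ℕ × ℕ)} (h : PositiveWord w) :
    (if 2 * (wordMatrix w 0 1 : ℝ) ≤ wordMatrix w 0 0 then (1 : ℝ) else 1.01) *
      ((wordMatrix w 0 0 : ℝ) + 0.1366 * (wordMatrix w 0 1 : ℝ)) ≤
      1.1431 ^ wordWeight 1 2 w * 4.036 ^ w.length := by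
  induction w using List.reverseRecOn with
  | nil => simp [wordMatrix_nil, wordWeight_nil]
  | append_singleton w p ih =>
    have hw : PositiveWord w := fun r hr => h r (by simp [hr])
    obtain ⟨h1, h2⟩ := h p (by simp)
    have ih := ih hw
    have hle : (wordMatrix w 0 1 : ℝ) ≤ wordMatrix w 0 0 := by
      exact_mod_cast wordMatrix_zero_one_le hw
    have hstep := potential_step (a := p.1) (b := p.2) h1 h2 (Nat.cast_nonneg _) hle
    rw [wordMatrix_concat_zero, wordMatrix_concat_one, wordWeight_append, wordWeight_cons,
      wordWeight_nil, List.length_append]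
    set q : ℝ := ((wordMatrix w 0 0 : ℕ) : ℝ)
    set q' : ℝ := ((wordMatrix w 0 1 : ℕ) : ℝ)
    have hq' : 0 ≤ q' := Nat.cast_nonneg _
    have hq : 0 ≤ q := Nat.cast_nonneg _
    push_cast
    have hcoef : (if 2 * (q * p.1 + q') ≤ q * (p.1 * p.2 + 1) + q' * p.2 then (1 : ℝ) else 1.01) ≤
        if p.2 = 1 then (1.01 : ℝ) else 1 := by
      split_ifs with c1 c2 c2
      · norm_num
      · norm_num
      · norm_num
      · refine absurd ?_ c1
        have : (2 : ℝ) ≤ p.2 := by exact_mod_cast (by omega : 2 ≤ p.2)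
        have h3 : 0 ≤ ((p.2 : ℝ) - 2) * (q * p.1 + q') := mul_nonneg (by linarith) (by positivity)
        nlinarith
    calc _ ≤ (if p.2 = 1 then (1.01 : ℝ) else 1) *
          (q * (p.1 * p.2 + 1) + q' * p.2 + 0.1366 * (q * p.1 + q')) := by gcongr
      _ = (if p.2 = 1 then (1.01 : ℝ) else 1) *
          ((p.1 * (p.2 + 0.1366) + 1) * q + (p.2 + 0.1366) * q') := by ring
      _ ≤ _ := hstep
      _ ≤ 1.1431 ^ (p.1 + 2 * p.2) * 4.036 * (1.1431 ^ wordWeight 1 2 w * 4.036 ^ w.length) := by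
        gcongr
      _ = _ := by
        simp only [List.length_cons, List.length_nil, one_mul, add_zero, zero_add, pow_add, pow_one]
        ring

theorem wordCont_le_pow {w : List (ℕ × ℕ)} (h : PositiveWord w) :
    (wordCont w : ℝ) ≤ 1.1431 ^ wordWeight 1 2 w * 4.036 ^ w.length := by
  refine le_trans ?_ (wordCont_potential_le h)
  have h1 : (0 : ℝ) ≤ wordMatrix w 0 0 := Nat.cast_nonneg _
  have h2 : (0 : ℝ) ≤ wordMatrix w 0 1 := Nat.cast_nonneg _
  unfold wordCont
  split_ifs <;> linarith

theorem goldenRatio_bounds : 1.618033 < Real.goldenRatio ∧ Real.goldenRatio < 1.618034 := by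
  have h1 : (2.236066 : ℝ) < √5 := Real.lt_sqrt_of_sq_lt (by norm_num)
  have h2 : √5 < 2.236068 := by rw [Real.sqrt_lt' (by norm_num)]; norm_num
  unfold Real.goldenRatio
  constructor <;> linarith

set_option exponentiation.threshold 1000 in
theorem wordWeight_le_of_mem_growingWords {w : List (ℕ × ℕ)} (hw : w ∈ growingWords 1 2) :
    (wordWeight 1 2 w : ℝ) ≤ 222 / 17 * w.length := by
  have hφ := goldenRatio_bounds.1
  set S := wordWeight 1 2 w
  set n := w.length
  have h1 : Real.goldenRatio ^ S < ((1.1431 : ℝ) ^ S * 4.036 ^ n) ^ 2 :=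
    hw.2.trans_le (pow_le_pow_left₀ (Nat.cast_nonneg _) (wordCont_le_pow hw.1) 2)
  set g : ℝ := Real.goldenRatio / 1.1431 ^ 2 with hg
  have hg1 : 1.618033 / 1.1431 ^ 2 < g := by rw [hg]; gcongr
  have hg2 : 1 < g := lt_trans (by norm_num) hg1
  have h2 : g ^ S < (4.036 ^ 2) ^ n := by
    rw [hg, div_pow, div_lt_iff₀ (by positivity)]
    calc _ < _ := h1
      _ = _ := by rw [mul_pow, ← pow_mul, ← pow_mul, ← pow_mul, ← pow_mul]; ring
  have h3 : (4.036 ^ 2 : ℝ) ^ 17 ≤ g ^ 222 :=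
    calc (4.036 ^ 2 : ℝ) ^ 17 ≤ (1.618033 / 1.1431 ^ 2) ^ 222 := by norm_num
      _ ≤ _ := by gcongr
  have h4 : g ^ (17 * S) < g ^ (222 * n) := by
    calc g ^ (17 * S) = (g ^ S) ^ 17 := by rw [← pow_mul, mul_comm]
      _ < ((4.036 ^ 2) ^ n) ^ 17 := pow_lt_pow_left₀ h2 (by positivity) (by norm_num)
      _ = ((4.036 ^ 2) ^ 17) ^ n := by rw [← pow_mul, ← pow_mul _ 17, mul_comm]
      _ ≤ (g ^ 222) ^ n := by gcongr
      _ = _ := by rw [pow_mul]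
  have h5 : 17 * S < 222 * n := (pow_lt_pow_iff_right₀ hg2).1 h4
  have h6 : (17 : ℝ) * S < 222 * n := by exact_mod_cast h5
  linarith

end UpperBound

section LowerBound

/-- A growing word whose average weight is `13.05`. -/
def heavyWord : List (ℕ × ℕ) := wordPow (List.replicate 39 (7, 3) ++ [(7, 4)]) 3

/-- The first column of the continuant matrix, computed digit by digit. -/
theorem wordMatrix_col (w : List (ℕ × ℕ)) :
    (wordMatrix w 0 0, wordMatrix w 1 0) =
      w.foldr (fun p v => ((p.1 * p.2 + 1) * v.1 + p.1 * v.2, p.2 * v.1 + v.2)) (1, 0) := by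
  induction w with
  | nil => simp [wordMatrix_nil]
  | cons p w ih =>
    rw [List.foldr_cons, ← ih, wordMatrix_cons_zero, wordMatrix_cons_one]

theorem wordCont_eq_foldr (w : List (ℕ × ℕ)) : wordCont w =
    (w.foldr (fun p v => ((p.1 * p.2 + 1) * v.1 + p.1 * v.2, p.2 * v.1 + v.2)) (1, 0)).1 :=
  congrArg Prod.fst (wordMatrix_col w)

theorem goldenRatio_pow_lt_of_nat {S K : ℕ} (hS : S ≠ 0)
    (h : 1618034 ^ S < K ^ 2 * 1000000 ^ S) : Real.goldenRatio ^ S < (K : ℝ) ^ 2 := by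
  have h' : (1618034 : ℝ) ^ S < (K : ℝ) ^ 2 * 1000000 ^ S := by exact_mod_cast h
  calc Real.goldenRatio ^ S < (1618034 / 1000000) ^ S := by
        refine pow_lt_pow_left₀ ?_ Real.goldenRatio_pos.le hS
        linarith [goldenRatio_bounds.2]
    _ < _ := by rw [div_pow, div_lt_iff₀ (by positivity)]; exact h'

theorem wordWeight_heavyWord : wordWeight 1 2 heavyWord = 1566 := by
  rw [heavyWord, wordWeight_wordPow, wordWeight_append]
  simp [wordWeight]

theorem heavyWord_mem : heavyWord ∈ growingWords 1 2 := by
  constructor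
  · refine PositiveWord.pow ?_ 3
    intro p hp
    simp only [List.mem_append, List.mem_replicate, List.mem_singleton] at hp
    rcases hp with ⟨-, rfl⟩ | rfl <;> simp
  · have e1 := wordWeight_heavyWord
    have e3 : wordWeight 1 2 heavyWord ≠ 0 := by rw [e1]; norm_num
    refine goldenRatio_pow_lt_of_nat e3 ?_
    rw [e1, wordCont_eq_foldr]
    decide +kernel

end LowerBound

theorem bddAbove_averages :
    ∀ y ∈ (fun w : List (ℕ × ℕ) => (wordWeight 1 2 w : ℝ) / w.length) '' growingWords 1 2,
      y ≤ 222 / 17 := by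
  rintro _ ⟨w, hw, rfl⟩
  have := length_pos_of_mem_growingWords hw
  rw [div_le_iff₀ (by exact_mod_cast this)]
  exact wordWeight_le_of_mem_growingWords hw

theorem criticalAverage_bounds : 13.05 ≤ criticalAverage 1 2 ∧ criticalAverage 1 2 < 13.06 := by
  constructor
  · refine le_csSup ⟨_, bddAbove_averages⟩ ⟨heavyWord, heavyWord_mem, ?_⟩
    have e2 : heavyWord.length = 120 := by simp [heavyWord, length_wordPow]
    simp only [wordWeight_heavyWord, e2]
    norm_num
  · refine lt_of_le_of_lt (csSup_le ⟨_, heavyWord, heavyWord_mem, rfl⟩ bddAbove_averages) ?_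
    norm_num

theorem wordWeight_le_criticalAverage {w : List (ℕ × ℕ)} (hw : w ∈ growingWords 1 2) :
    (wordWeight 1 2 w : ℝ) ≤ criticalAverage 1 2 * w.length := by
  have := length_pos_of_mem_growingWords hw
  rw [← div_le_iff₀ (by exact_mod_cast this)]
  exact le_csSup ⟨_, bddAbove_averages⟩ ⟨w, hw, rfl⟩

/-! ### Computability from certificates -/

section PrimitiveRecursion

/-- All pairs of positive integers up to `B`. -/
def boundedPairs (B : ℕ) : List (ℕ × ℕ) :=
  (List.range B).flatMap fun a => (List.range B).map fun b => (a + 1, b + 1)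

/-- All words of `n` pairs of positive integers up to `B`. -/
def boundedWords (B : ℕ) : ℕ → List (List (ℕ × ℕ))
  | 0 => [[]]
  | n + 1 => (boundedWords B n).flatMap fun w => (boundedPairs B).map fun p => p :: w

theorem mem_boundedPairs {B : ℕ} {p : ℕ × ℕ} :
    p ∈ boundedPairs B ↔ (0 < p.1 ∧ p.1 ≤ B) ∧ 0 < p.2 ∧ p.2 ≤ B := by
  obtain ⟨a, b⟩ := p
  simp only [boundedPairs, List.mem_flatMap, List.mem_map, List.mem_range, Prod.mk.injEq]
  constructor
  · rintro ⟨i, hi, j, hj, rfl, rfl⟩; omega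
  · rintro ⟨h1, h2⟩; exact ⟨a - 1, by omega, b - 1, by omega, by omega, by omega⟩

theorem mem_boundedWords {B n : ℕ} {w : List (ℕ × ℕ)} :
    w ∈ boundedWords B n ↔ w.length = n ∧ ∀ p ∈ w, p ∈ boundedPairs B := by
  induction n generalizing w with
  | zero =>
    simp only [boundedWords, List.mem_singleton, List.length_eq_zero_iff]
    constructor
    · rintro rfl; simp
    · exact fun h => h.1
  | succ n ih =>
    simp only [boundedWords, List.mem_flatMap, List.mem_map, ih]
    constructor
    · rintro ⟨u, ⟨h1, h2⟩, p, hp, rfl⟩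
      refine ⟨by simp [h1], ?_⟩
      intro q hq
      rcases List.mem_cons.1 hq with rfl | hq
      exacts [hp, h2 q hq]
    · rintro ⟨h1, h2⟩
      cases w with
      | nil => simp at h1
      | cons p u =>
        exact ⟨u, ⟨by simpa using h1, fun q hq => h2 q (by simp [hq])⟩, p, h2 p (by simp), rfl⟩

theorem primrec_pow : Primrec₂ ((· ^ ·) : ℕ → ℕ → ℕ) :=
  Primrec₂.unpaired'.1 Nat.Primrec.pow

theorem primrec_boundedPairs : Primrec boundedPairs := by
  refine Primrec.list_flatMap Primrec.list_range ?_
  refine Primrec.list_map (Primrec.list_range.comp Primrec.fst) ?_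
  exact (Primrec.succ.comp (Primrec.snd.comp Primrec.fst)).pair (Primrec.succ.comp Primrec.snd)

theorem primrec_boundedWords : Primrec₂ boundedWords := by
  have h : Primrec₂ fun (B : ℕ) (s : ℕ × List (List (ℕ × ℕ))) =>
      s.2.flatMap fun w => (boundedPairs B).map fun p => p :: w := by
    refine Primrec.list_flatMap (Primrec.snd.comp Primrec.snd) ?_
    refine Primrec.list_map (primrec_boundedPairs.comp (Primrec.fst.comp Primrec.fst)) ?_
    exact Primrec.list_cons.comp Primrec.snd (Primrec.snd.comp Primrec.fst)
  refine (Primrec.nat_rec (Primrec.const [[]]) h).of_eq fun B n => ?_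
  induction n with
  | zero => rfl
  | succ n ih =>
    simp only [boundedWords] at ih ⊢
    rw [← ih]

theorem primrec_wordCont : Primrec wordCont := by
  have h : Primrec₂ fun (_ : List (ℕ × ℕ)) (s : (ℕ × ℕ) × (ℕ × ℕ)) =>
      ((s.1.1 * s.1.2 + 1) * s.2.1 + s.1.1 * s.2.2, s.1.2 * s.2.1 + s.2.2) := by
    have a : Primrec fun x : List (ℕ × ℕ) × ((ℕ × ℕ) × (ℕ × ℕ)) => x.2.1.1 :=
      Primrec.fst.comp (Primrec.fst.comp Primrec.snd)
    have b : Primrec fun x : List (ℕ × ℕ) × ((ℕ × ℕ) × (ℕ × ℕ)) => x.2.1.2 :=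
      Primrec.snd.comp (Primrec.fst.comp Primrec.snd)
    have c : Primrec fun x : List (ℕ × ℕ) × ((ℕ × ℕ) × (ℕ × ℕ)) => x.2.2.1 :=
      Primrec.fst.comp (Primrec.snd.comp Primrec.snd)
    have d : Primrec fun x : List (ℕ × ℕ) × ((ℕ × ℕ) × (ℕ × ℕ)) => x.2.2.2 :=
      Primrec.snd.comp (Primrec.snd.comp Primrec.snd)
    refine Primrec.pair ?_ ?_
    · exact Primrec.nat_add.comp (Primrec.nat_mul.comp
        (Primrec.succ.comp (Primrec.nat_mul.comp a b)) c) (Primrec.nat_mul.comp a d)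
    · exact Primrec.nat_add.comp (Primrec.nat_mul.comp b c) d
  refine (Primrec.fst.comp (Primrec.list_foldr Primrec.id (Primrec.const (1, 0)) h)).of_eq
    fun w => ?_
  rw [wordCont_eq_foldr]
  rfl

theorem primrec_wordWeight : Primrec (wordWeight 1 2) := by
  have h : Primrec₂ fun (_ : List (ℕ × ℕ)) (s : (ℕ × ℕ) × ℕ) => 1 * s.1.1 + 2 * s.1.2 + s.2 := by
    have a : Primrec fun x : List (ℕ × ℕ) × ((ℕ × ℕ) × ℕ) => x.2.1.1 :=
      Primrec.fst.comp (Primrec.fst.comp Primrec.snd)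
    have b : Primrec fun x : List (ℕ × ℕ) × ((ℕ × ℕ) × ℕ) => x.2.1.2 :=
      Primrec.snd.comp (Primrec.fst.comp Primrec.snd)
    exact Primrec.nat_add.comp (Primrec.nat_add.comp (Primrec.nat_mul.comp (Primrec.const 1) a)
      (Primrec.nat_mul.comp (Primrec.const 2) b)) (Primrec.snd.comp Primrec.snd)
  refine (Primrec.list_foldr Primrec.id (Primrec.const 0) h).of_eq fun w => ?_
  induction w with
  | nil => simp [wordWeight]
  | cons p w ih =>
    rw [wordWeight_cons, ← ih]
    rfl

theorem primrecPred_positiveWord : PrimrecPred PositiveWord := by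
  refine PrimrecPred.forall_mem_list (p := fun p : ℕ × ℕ => 0 < p.1 ∧ 0 < p.2) ?_
  exact (Primrec.nat_lt.comp (Primrec.const 0) Primrec.fst).and
    (Primrec.nat_lt.comp (Primrec.const 0) Primrec.snd)

end PrimitiveRecursion

section Certificates

theorem primrec_natCast_int : Primrec fun n : ℕ => (n : ℤ) := by
  refine Primrec.encode_iff.1 (Primrec.nat_double.of_eq fun n => ?_)
  rfl

/-- A certificate for `(m - 1) / 2 ^ N ≤ criticalAverage 1 2`: the word `w` has a large average, and
the fraction `e / (f + 1) > φ` shows that `w` is growing. -/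
def LowerCert (N m : ℕ) (w : List (ℕ × ℕ)) (e f : ℕ) : Prop :=
  PositiveWord w ∧ e * (f + 1) + (f + 1) ^ 2 < e ^ 2 ∧
    e ^ wordWeight 1 2 w < wordCont w ^ 2 * (f + 1) ^ wordWeight 1 2 w ∧
    m * w.length ≤ wordWeight 1 2 w * 2 ^ N + w.length

/-- A certificate for `criticalAverage 1 2 ≤ (m + 1) / 2 ^ N`: with `C = c / (c' + 1)`,
`D = d / (d' + 1)` and `ρ = e / (e' + 1) < φ`, the words `u` of `n` pairs of digits up to `B` satisfy
`4 * K(u) ^ 2 ≤ C ^ weight * D ^ n`, digits above `B` cannot violate this, and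
`C ^ (m + 1) * D ^ (2 ^ N) ≤ ρ ^ (m + 1)`. -/
def UpperCert (N m n B c c' d d' e e' : ℕ) : Prop :=
  (0 < n ∧ 0 < B) ∧ e ^ 2 < e * (e' + 1) + (e' + 1) ^ 2 ∧
    (B + 1) ^ 2 * (c' + 1) ≤ c * B ^ 2 ∧ c * (e' + 1) ≤ e * (c' + 1) ∧
    c ^ (m + 1) * d ^ 2 ^ N * (e' + 1) ^ (m + 1) ≤
      e ^ (m + 1) * (c' + 1) ^ (m + 1) * (d' + 1) ^ 2 ^ N ∧
    ∀ u ∈ boundedWords B n, 4 * wordCont u ^ 2 * ((c' + 1) ^ wordWeight 1 2 u * (d' + 1) ^ n) ≤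
      c ^ wordWeight 1 2 u * d ^ n

variable {α : Type*} [Primcodable α]

theorem Primrec.add_fun {f g : α → ℕ} (hf : Primrec f) (hg : Primrec g) :
    Primrec fun a => f a + g a := Primrec.nat_add.comp hf hg

theorem Primrec.mul_fun {f g : α → ℕ} (hf : Primrec f) (hg : Primrec g) :
    Primrec fun a => f a * g a := Primrec.nat_mul.comp hf hg

theorem Primrec.pow_fun {f g : α → ℕ} (hf : Primrec f) (hg : Primrec g) :
    Primrec fun a => f a ^ g a := primrec_pow.comp hf hg

theorem Primrec.lt_fun {f g : α → ℕ} (hf : Primrec f) (hg : Primrec g) :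
    PrimrecPred fun a => f a < g a := Primrec.nat_lt.comp hf hg

theorem Primrec.le_fun {f g : α → ℕ} (hf : Primrec f) (hg : Primrec g) :
    PrimrecPred fun a => f a ≤ g a := Primrec.nat_le.comp hf hg

theorem primrecPred_lowerCert {N m e f : α → ℕ} {w : α → List (ℕ × ℕ)} (hN : Primrec N)
    (hm : Primrec m) (hw : Primrec w) (he : Primrec e) (hf : Primrec f) :
    PrimrecPred fun a => LowerCert (N a) (m a) (w a) (e a) (f a) := by
  have hS := primrec_wordWeight.comp hw
  have hK := primrec_wordCont.comp hw
  have hl := Primrec.list_length.comp hw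
  have h1 : Primrec fun _ : α => 1 := Primrec.const 1
  have h2 : Primrec fun _ : α => 2 := Primrec.const 2
  have hf1 := hf.add_fun h1
  exact (primrecPred_positiveWord.comp hw).and <|
    (((he.mul_fun hf1).add_fun (hf1.pow_fun h2)).lt_fun (he.pow_fun h2)).and <|
    ((he.pow_fun hS).lt_fun ((hK.pow_fun h2).mul_fun (hf1.pow_fun hS))).and <|
    (hm.mul_fun hl).le_fun ((hS.mul_fun (h2.pow_fun hN)).add_fun hl)

theorem primrecPred_upperCert {N m n B c c' d d' e e' : α → ℕ} (hN : Primrec N) (hm : Primrec m)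
    (hn : Primrec n) (hB : Primrec B) (hc : Primrec c) (hc' : Primrec c') (hd : Primrec d)
    (hd' : Primrec d') (he : Primrec e) (he' : Primrec e') :
    PrimrecPred fun a => UpperCert (N a) (m a) (n a) (B a) (c a) (c' a) (d a) (d' a) (e a)
      (e' a) := by
  have h0 : Primrec fun _ : α => 0 := Primrec.const 0
  have h1 : Primrec fun _ : α => 1 := Primrec.const 1
  have h2 : Primrec fun _ : α => 2 := Primrec.const 2
  have hm1 := hm.add_fun h1
  have hc1 := hc'.add_fun h1
  have hd1 := hd'.add_fun h1
  have he1 := he'.add_fun h1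
  have h2N := h2.pow_fun hN
  have hall : PrimrecRel fun (u : List (ℕ × ℕ)) (a : α) =>
      4 * wordCont u ^ 2 * ((c' a + 1) ^ wordWeight 1 2 u * (d' a + 1) ^ n a) ≤
        c a ^ wordWeight 1 2 u * d a ^ n a := by
    have g4 : Primrec fun _ : List (ℕ × ℕ) × α => 4 := Primrec.const 4
    have g2 : Primrec fun _ : List (ℕ × ℕ) × α => 2 := Primrec.const 2
    have hK : Primrec fun x : List (ℕ × ℕ) × α => wordCont x.1 := primrec_wordCont.comp Primrec.fst
    have hS : Primrec fun x : List (ℕ × ℕ) × α => wordWeight 1 2 x.1 :=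
      primrec_wordWeight.comp Primrec.fst
    have gc : Primrec fun x : List (ℕ × ℕ) × α => c x.2 := hc.comp Primrec.snd
    have gd : Primrec fun x : List (ℕ × ℕ) × α => d x.2 := hd.comp Primrec.snd
    have gn : Primrec fun x : List (ℕ × ℕ) × α => n x.2 := hn.comp Primrec.snd
    have gc1 : Primrec fun x : List (ℕ × ℕ) × α => c' x.2 + 1 := hc1.comp Primrec.snd
    have gd1 : Primrec fun x : List (ℕ × ℕ) × α => d' x.2 + 1 := hd1.comp Primrec.snd
    exact ((g4.mul_fun (hK.pow_fun g2)).mul_fun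
      ((gc1.pow_fun hS).mul_fun (gd1.pow_fun gn))).le_fun
      ((gc.pow_fun hS).mul_fun (gd.pow_fun gn))
  exact ((h0.lt_fun hn).and (h0.lt_fun hB)).and <|
    ((he.pow_fun h2).lt_fun ((he.mul_fun he1).add_fun (he1.pow_fun h2))).and <|
    ((((hB.add_fun h1).pow_fun h2).mul_fun hc1).le_fun (hc.mul_fun (hB.pow_fun h2))).and <|
    ((hc.mul_fun he1).le_fun (he.mul_fun hc1)).and <|
    ((((hc.pow_fun hm1).mul_fun (hd.pow_fun h2N)).mul_fun (he1.pow_fun hm1)).le_fun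
      (((he.pow_fun hm1).mul_fun (hc1.pow_fun hm1)).mul_fun (hd1.pow_fun h2N))).and <|
    (hall.forall_mem_list.comp (primrec_boundedWords.comp hB hn) Primrec.id)

/-- If for each `N` some certificates place `κ` within `1 / 2 ^ N` of a dyadic number, then `κ` is
computable: search for the certificates. -/
theorem isComputableReal_of_certs {κ : ℝ}
    (hsound : ∀ N m w e f, LowerCert N m w e f → (m : ℝ) / 2 ^ N - 1 / 2 ^ N ≤ κ)
    (hsound' : ∀ N m n B c c' d d' e e', UpperCert N m n B c c' d d' e e' →
      κ ≤ (m : ℝ) / 2 ^ N + 1 / 2 ^ N)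
    (hex : ∀ N, ∃ m, (∃ w e f, LowerCert N m w e f) ∧
      ∃ n B c c' d d' e e', UpperCert N m n B c c' d d' e e') : IsComputableReal κ := by
  let P : ℕ → ℕ × List (ℕ × ℕ) × List ℕ → Prop := fun N x =>
    LowerCert N x.1 x.2.1 (x.2.2.getD 0 0) (x.2.2.getD 1 0) ∧
    UpperCert N x.1 (x.2.2.getD 2 0) (x.2.2.getD 3 0) (x.2.2.getD 4 0) (x.2.2.getD 5 0)
      (x.2.2.getD 6 0) (x.2.2.getD 7 0) (x.2.2.getD 8 0) (x.2.2.getD 9 0)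
  have hP : PrimrecPred fun y : ℕ × ℕ × List (ℕ × ℕ) × List ℕ => P y.1 y.2 := by
    have hm : Primrec fun y : ℕ × ℕ × List (ℕ × ℕ) × List ℕ => y.2.1 :=
      Primrec.fst.comp Primrec.snd
    have hw : Primrec fun y : ℕ × ℕ × List (ℕ × ℕ) × List ℕ => y.2.2.1 :=
      Primrec.fst.comp (Primrec.snd.comp Primrec.snd)
    have hl : Primrec fun y : ℕ × ℕ × List (ℕ × ℕ) × List ℕ => y.2.2.2 :=
      Primrec.snd.comp (Primrec.snd.comp Primrec.snd)
    have hg : ∀ i : ℕ, Primrec fun y : ℕ × ℕ × List (ℕ × ℕ) × List ℕ => y.2.2.2.getD i 0 :=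
      fun i => (Primrec.list_getD 0).comp hl (Primrec.const i)
    exact (primrecPred_lowerCert Primrec.fst hm hw (hg 0) (hg 1)).and
      (primrecPred_upperCert Primrec.fst hm (hg 2) (hg 3) (hg 4) (hg 5) (hg 6) (hg 7) (hg 8) (hg 9))
  let dec : ℕ → ℕ × List (ℕ × ℕ) × List ℕ := fun k =>
    ((Encodable.decode k : Option (ℕ × List (ℕ × ℕ) × List ℕ))).getD (0, [], [])
  have hdec : Primrec dec := Primrec.option_getD.comp Primrec.decode (Primrec.const _)
  classical
  have hQ : ComputablePred fun p : ℕ × ℕ => P p.1 (dec p.2) :=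
    ⟨inferInstance, (PrimrecPred.decide
      (hP.comp (Primrec.fst.pair (hdec.comp Primrec.snd)))).to_comp⟩
  have hQex : ∀ N, ∃ k, P N (dec k) := by
    intro N
    obtain ⟨m, ⟨w, e, f, h1⟩, n, B, c, c', d, d', r, r', h2⟩ := hex N
    refine ⟨Encodable.encode (m, w, [e, f, n, B, c, c', d, d', r, r']), ?_⟩
    simp only [dec, Encodable.encodek, Option.getD_some]
    exact ⟨h1, h2⟩
  have hfind := Computable.find (P := fun N k => P N (dec k)) hQ hQex
  refine ⟨fun N => ((dec (Nat.find (hQex N))).1 : ℤ), ?_, fun N => ?_⟩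
  · exact primrec_natCast_int.to_comp.comp ((Primrec.fst.comp hdec).to_comp.comp hfind)
  · obtain ⟨h1, h2⟩ := Nat.find_spec (hQex N)
    have g1 := hsound _ _ _ _ _ h1
    have g2 := hsound' _ _ _ _ _ _ _ _ _ _ h2
    rw [abs_le]
    push_cast
    constructor <;> linarith

end Certificates

/-! ### Soundness of the certificates -/

section Soundness

theorem lt_goldenRatio_of {r : ℝ} (h : r ^ 2 < r + 1) : r < Real.goldenRatio := by
  have h1 := Real.goldenRatio_sq
  have h2 := Real.one_lt_goldenRatio
  by_contra! h3
  nlinarith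

theorem goldenRatio_lt_of {r : ℝ} (h0 : 0 ≤ r) (h : r + 1 < r ^ 2) : Real.goldenRatio < r := by
  have h1 := Real.goldenRatio_sq
  have h2 := Real.one_lt_goldenRatio
  by_contra! h3
  nlinarith

/-- Multiplying by a constant `c ≥ 1 + 1 / B` dominates increasing a digit which is at least `B`. -/
theorem mul_pow_min_le {B : ℕ} (hB : 0 < B) {c : ℝ} (hc : 1 + 1 / (B : ℝ) ≤ c) (a : ℕ) :
    (a : ℝ) * c ^ min a B ≤ c ^ a * (min a B : ℕ) := by
  have hB' : (0 : ℝ) < B := by exact_mod_cast hB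
  have hc0 : 0 < c := lt_of_lt_of_le (by positivity) hc
  rcases le_total a B with h | h
  · rw [min_eq_left h, mul_comm]
  · induction a, h using Nat.le_induction with
    | base => rw [min_self, mul_comm]
    | succ a ha ih =>
      rw [min_eq_right (by omega)] at ih ⊢
      have ha' : (B : ℝ) ≤ a := by exact_mod_cast ha
      have h1 : ((a + 1 : ℕ) : ℝ) ≤ c * a := by
        push_cast
        calc (a : ℝ) + 1 ≤ (1 + 1 / B) * a := by
              rw [add_mul, one_mul, div_mul_eq_mul_div, one_mul]
              have : 1 ≤ (a : ℝ) / B := (one_le_div hB').2 ha'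
              linarith
          _ ≤ c * a := by gcongr
      calc ((a + 1 : ℕ) : ℝ) * c ^ B ≤ c * a * c ^ B := by gcongr
        _ = c * (a * c ^ B) := by ring
        _ ≤ c * (c ^ a * B) := by gcongr
        _ = _ := by ring

/-- Lower all digits to at most `B`. -/
def capWord (B : ℕ) (w : List (ℕ × ℕ)) : List (ℕ × ℕ) := w.map fun p => (min p.1 B, min p.2 B)

theorem capWord_bound {B : ℕ} (hB : 0 < B) {c : ℝ} (hc : 1 + 1 / (B : ℝ) ≤ c)
    {w : List (ℕ × ℕ)} (h : PositiveWord w) :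
    ∀ i, (wordMatrix w i 0 : ℝ) * c ^ wordWeight 1 2 (capWord B w) ≤
      c ^ wordWeight 1 2 w * (wordMatrix (capWord B w) i 0 : ℝ) := by
  have hB' : (0 : ℝ) < B := by exact_mod_cast hB
  have hc1 : 1 ≤ c := le_trans (by linarith [show (0 : ℝ) ≤ 1 / B by positivity]) hc
  have hc0 : 0 < c := by linarith
  induction w with
  | nil => simp [capWord, wordMatrix_nil, wordWeight_nil]
  | cons p w ih =>
    obtain ⟨⟨h1, h2⟩, hw⟩ := h.of_cons
    have ih0 := ih hw 0
    have ih1 := ih hw 1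
    have hcap : capWord B (p :: w) = (min p.1 B, min p.2 B) :: capWord B w := rfl
    obtain ⟨a, b⟩ := p
    simp only at h1 h2 hcap
    rw [hcap]
    have ha := mul_pow_min_le hB hc a
    have hb := mul_pow_min_le hB hc b
    set a' := min a B with ha'
    set b' := min b B with hb'
    have ha1 : a' ≤ a := min_le_left _ _
    have hb1 : b' ≤ b := min_le_left _ _
    set S' := wordWeight 1 2 (capWord B w)
    set S := wordWeight 1 2 w
    have ea : c ^ a' ≤ c ^ a := pow_le_pow_right₀ hc1 ha1
    have eb : c ^ b' ≤ c ^ b := pow_le_pow_right₀ hc1 hb1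
    have hM : ∀ i : Fin 2, (0 : ℝ) ≤ wordMatrix (capWord B w) i 0 := fun i => Nat.cast_nonneg _
    have hM' : ∀ i : Fin 2, (0 : ℝ) ≤ wordMatrix w i 0 := fun i => Nat.cast_nonneg _
    -- a single product of digits with the capped weights
    have hab : (a : ℝ) * b * (c ^ a' * c ^ (2 * b')) ≤ c ^ a * c ^ (2 * b) * (a' * b') := by
      have e1 : (a : ℝ) * c ^ a' * (b * c ^ b') ≤ c ^ a * a' * (c ^ b * b') := by gcongr
      calc (a : ℝ) * b * (c ^ a' * c ^ (2 * b'))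
          = (a * c ^ a' * (b * c ^ b')) * c ^ b' := by ring
        _ ≤ (c ^ a * a' * (c ^ b * b')) * c ^ b := by gcongr
        _ = _ := by ring
    have hone : (c ^ a' * c ^ (2 * b')) ≤ c ^ a * c ^ (2 * b) := by
      gcongr
    have ha2 : (a : ℝ) * (c ^ a' * c ^ (2 * b')) ≤ c ^ a * c ^ (2 * b) * a' := by
      calc (a : ℝ) * (c ^ a' * c ^ (2 * b')) = a * c ^ a' * c ^ (2 * b') := by ring
        _ ≤ c ^ a * a' * c ^ (2 * b) := by
          gcongr
        _ = _ := by ring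
    have hb2 : (b : ℝ) * (c ^ a' * c ^ (2 * b')) ≤ c ^ a * c ^ (2 * b) * b' := by
      calc (b : ℝ) * (c ^ a' * c ^ (2 * b')) = c ^ a' * (b * c ^ b') * c ^ b' := by ring
        _ ≤ c ^ a * (c ^ b * b') * c ^ b := by gcongr
        _ = _ := by ring
    have key : ∀ (i : Fin 2) {t t' : ℝ}, 0 ≤ t → 0 ≤ t' →
        t * (c ^ a' * c ^ (2 * b')) ≤ c ^ a * c ^ (2 * b) * t' →
        t * wordMatrix w i 0 * (c ^ a' * c ^ (2 * b') * c ^ S') ≤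
          c ^ a * c ^ (2 * b) * c ^ S * (t' * wordMatrix (capWord B w) i 0) := by
      intro i t t' ht ht' hle
      calc t * wordMatrix w i 0 * (c ^ a' * c ^ (2 * b') * c ^ S')
          = (t * (c ^ a' * c ^ (2 * b'))) * (wordMatrix w i 0 * c ^ S') := by ring
        _ ≤ (c ^ a * c ^ (2 * b) * t') * (c ^ S * wordMatrix (capWord B w) i 0) :=
          mul_le_mul hle (ih hw i) (mul_nonneg (hM' i) (by positivity)) (by positivity)
        _ = _ := by ring
    have e1 : c ^ wordWeight 1 2 ((a', b') :: capWord B w) = c ^ a' * c ^ (2 * b') * c ^ S' := by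
      rw [wordWeight_cons, one_mul, pow_add, pow_add]
    have e2 : c ^ wordWeight 1 2 ((a, b) :: w) = c ^ a * c ^ (2 * b) * c ^ S := by
      rw [wordWeight_cons, one_mul, pow_add, pow_add]
    intro i
    rw [e1, e2]
    fin_cases i
    · simp only [Fin.zero_eta, wordMatrix_cons_zero]
      push_cast
      have k1 := key 0 (by positivity) (by positivity) hab
      have k2 := key 0 (t := 1) (t' := 1) (by norm_num) (by norm_num) (by simpa using hone)
      have k3 := key 1 (by positivity) (by positivity) ha2
      linarith
    · simp only [Fin.mk_one, wordMatrix_cons_one]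
      push_cast
      have k1 := key 0 (by positivity) (by positivity) hb2
      have k2 := key 1 (t := 1) (t' := 1) (by norm_num) (by norm_num) (by simpa using hone)
      linarith

theorem capWord_mem {B : ℕ} (hB : 0 < B) {w : List (ℕ × ℕ)} (h : PositiveWord w) :
    capWord B w ∈ boundedWords B w.length := by
  rw [mem_boundedWords]
  refine ⟨by simp [capWord], fun p hp => ?_⟩
  simp only [capWord, List.mem_map] at hp
  obtain ⟨q, hq, rfl⟩ := hp
  obtain ⟨h1, h2⟩ := h q hq
  rw [mem_boundedPairs]
  simp only
  omega

/-- A bound for the words of one length and bounded digits implies a bound for all words. -/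
theorem weight_le_of_bounded {n B M P : ℕ} (hn : 0 < n) (hB : 0 < B) (hP : 0 < P) {C D : ℝ}
    (hD : 0 ≤ D) (hC : (1 + 1 / (B : ℝ)) ^ 2 ≤ C) (hCφ : C < Real.goldenRatio)
    (hCD : C ^ M * D ^ P < Real.goldenRatio ^ M)
    (hb : ∀ u ∈ boundedWords B n, 4 * (wordCont u : ℝ) ^ 2 ≤ C ^ wordWeight 1 2 u * D ^ n)
    {w : List (ℕ × ℕ)} (hw : w ∈ growingWords 1 2) :
    wordWeight 1 2 w * P ≤ M * w.length := by
  have hφ := Real.goldenRatio_pos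
  have hB' : (0 : ℝ) < B := by exact_mod_cast hB
  have hC0 : 0 < C := lt_of_lt_of_le (by positivity) hC
  set c := √C with hcdef
  have hcC : c ^ 2 = C := Real.sq_sqrt hC0.le
  have hc : 1 + 1 / (B : ℝ) ≤ c := Real.le_sqrt_of_sq_le hC
  have hc0 : 0 < c := Real.sqrt_pos.2 hC0
  -- arbitrary digits
  have h1 : ∀ u : List (ℕ × ℕ), PositiveWord u → u.length = n →
      (2 * wordCont u : ℝ) ^ 2 ≤ C ^ wordWeight 1 2 u * D ^ n := by
    intro u hu hlen
    have e1 := hb (capWord B u) (by rw [← hlen]; exact capWord_mem hB hu)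
    have e2 : (wordCont u : ℝ) * c ^ wordWeight 1 2 (capWord B u) ≤
      c ^ wordWeight 1 2 u * wordCont (capWord B u) := capWord_bound hB hc hu 0
    have e3 := pow_le_pow_left₀ (by positivity) e2 2
    rw [mul_pow, mul_pow, ← pow_mul, ← pow_mul, mul_comm _ 2, mul_comm _ 2, pow_mul, pow_mul,
      hcC] at e3
    have e4 : 0 < C ^ wordWeight 1 2 (capWord B u) := by positivity
    refine le_of_mul_le_mul_right ?_ e4
    calc (2 * wordCont u : ℝ) ^ 2 * C ^ wordWeight 1 2 (capWord B u)
        = 4 * ((wordCont u : ℝ) ^ 2 * C ^ wordWeight 1 2 (capWord B u)) := by ring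
      _ ≤ 4 * (C ^ wordWeight 1 2 u * (wordCont (capWord B u) : ℝ) ^ 2) := by gcongr
      _ = C ^ wordWeight 1 2 u * (4 * (wordCont (capWord B u) : ℝ) ^ 2) := by ring
      _ ≤ C ^ wordWeight 1 2 u * (C ^ wordWeight 1 2 (capWord B u) * D ^ n) := by gcongr
      _ = _ := by ring
  -- arbitrary multiples of the length
  have h2 : ∀ k : ℕ, ∀ u : List (ℕ × ℕ), PositiveWord u → u.length = n * k →
      (wordCont u : ℝ) ^ 2 ≤ C ^ wordWeight 1 2 u * D ^ u.length := by
    intro k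
    induction k with
    | zero =>
      intro u _ hlen
      have : u = [] := List.length_eq_zero_iff.1 (by simpa using hlen)
      simp [this, wordCont_nil, wordWeight_nil]
    | succ k ih =>
      intro u hu hlen
      rw [mul_add, mul_one] at hlen
      have hsplit : u.take n ++ u.drop n = u := List.take_append_drop n u
      have p1 : PositiveWord (u.take n) := fun p hp => hu p (List.mem_of_mem_take hp)
      have p2 : PositiveWord (u.drop n) := fun p hp => hu p (List.mem_of_mem_drop hp)
      have l1 : (u.take n).length = n := by simp [hlen]
      have l2 : (u.drop n).length = n * k := by simp [hlen]
      have e1 := h1 _ p1 l1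
      have e2 := ih _ p2 l2
      rw [l2] at e2
      have e3 : (wordCont u : ℝ) ≤ 2 * wordCont (u.take n) * wordCont (u.drop n) := by
        conv_lhs => rw [← hsplit]
        exact_mod_cast wordCont_append_le p1 p2
      have e4 : wordWeight 1 2 u = wordWeight 1 2 (u.take n) + wordWeight 1 2 (u.drop n) := by
        rw [← wordWeight_append, hsplit]
      calc (wordCont u : ℝ) ^ 2 ≤ (2 * wordCont (u.take n) * wordCont (u.drop n)) ^ 2 := by gcongr
        _ = (2 * wordCont (u.take n) : ℝ) ^ 2 * (wordCont (u.drop n) : ℝ) ^ 2 := by ring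
        _ ≤ (C ^ wordWeight 1 2 (u.take n) * D ^ n) *
            (C ^ wordWeight 1 2 (u.drop n) * D ^ (n * k)) := by gcongr
        _ = _ := by rw [e4, hlen, pow_add, pow_add]; ring
  -- the powers of `w`
  have h3 : (wordCont w : ℝ) ^ 2 ≤ C ^ wordWeight 1 2 w * D ^ w.length := by
    have e1 := h2 w.length (wordPow w n) (hw.1.pow n) (length_wordPow w n)
    have e2 : (wordCont w : ℝ) ^ n ≤ wordCont (wordPow w n) := by
      exact_mod_cast pow_le_wordCont_wordPow w n
    rw [wordWeight_wordPow, length_wordPow] at e1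
    refine le_of_pow_le_pow_left₀ hn.ne' (by positivity) ?_
    calc ((wordCont w : ℝ) ^ 2) ^ n = ((wordCont w : ℝ) ^ n) ^ 2 := by
          rw [← pow_mul, ← pow_mul, mul_comm]
      _ ≤ (wordCont (wordPow w n) : ℝ) ^ 2 := by gcongr
      _ ≤ _ := e1
      _ = _ := by rw [mul_pow, ← pow_mul, ← pow_mul]; congr 2 <;> ring
  set S := wordWeight 1 2 w
  set ℓ := w.length
  set g := Real.goldenRatio / C with hg
  have hg1 : 1 < g := (one_lt_div hC0).2 hCφ
  have h4 : g ^ S < D ^ ℓ := by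
    rw [hg, div_pow, div_lt_iff₀ (by positivity)]
    calc _ < _ := hw.2
      _ ≤ _ := h3
      _ = _ := by ring
  have h5 : D ^ P ≤ g ^ M := by
    rw [hg, div_pow, le_div_iff₀ (by positivity)]
    linarith
  have h6 : g ^ (S * P) < g ^ (M * ℓ) :=
    calc g ^ (S * P) = (g ^ S) ^ P := pow_mul _ _ _
      _ < (D ^ ℓ) ^ P := pow_lt_pow_left₀ h4 (by positivity) hP.ne'
      _ = (D ^ P) ^ ℓ := by rw [← pow_mul, ← pow_mul, mul_comm]
      _ ≤ (g ^ M) ^ ℓ := by gcongr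
      _ = _ := (pow_mul _ _ _).symm
  exact ((pow_lt_pow_iff_right₀ hg1).1 h6).le

theorem LowerCert.le_criticalAverage {N m : ℕ} {w : List (ℕ × ℕ)} {e f : ℕ}
    (h : LowerCert N m w e f) : (m : ℝ) / 2 ^ N - 1 / 2 ^ N ≤ criticalAverage 1 2 := by
  obtain ⟨hpos, h1, h2, h3⟩ := h
  have hf : (0 : ℝ) < (f : ℝ) + 1 := by positivity
  have hr : Real.goldenRatio < (e : ℝ) / (f + 1) := by
    refine goldenRatio_lt_of (by positivity) ?_
    have h1' : (e : ℝ) * (f + 1) + (f + 1) ^ 2 < (e : ℝ) ^ 2 := by exact_mod_cast h1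
    rw [div_pow, lt_div_iff₀ (by positivity)]
    field_simp
    linarith
  have h2' : (e : ℝ) ^ wordWeight 1 2 w <
      (wordCont w : ℝ) ^ 2 * ((f : ℝ) + 1) ^ wordWeight 1 2 w := by exact_mod_cast h2
  have hmem : w ∈ growingWords 1 2 := by
    refine ⟨hpos, ?_⟩
    calc Real.goldenRatio ^ wordWeight 1 2 w ≤ ((e : ℝ) / (f + 1)) ^ wordWeight 1 2 w :=
          pow_le_pow_left₀ Real.goldenRatio_pos.le hr.le _
      _ < _ := by rw [div_pow, div_lt_iff₀ (by positivity)]; exact h2'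
  have hlen : (0 : ℝ) < w.length := by exact_mod_cast length_pos_of_mem_growingWords hmem
  have hκ := wordWeight_le_criticalAverage hmem
  have h3' : (m : ℝ) * w.length ≤ wordWeight 1 2 w * 2 ^ N + w.length := by exact_mod_cast h3
  have hN : (0 : ℝ) < 2 ^ N := by positivity
  rw [← sub_div, div_le_iff₀ hN]
  refine le_of_mul_le_mul_right ?_ hlen
  nlinarith [mul_le_mul_of_nonneg_right hκ hN.le]

theorem UpperCert.criticalAverage_le {N m n B c c' d d' e e' : ℕ}
    (h : UpperCert N m n B c c' d d' e e') :
    criticalAverage 1 2 ≤ (m : ℝ) / 2 ^ N + 1 / 2 ^ N := by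
  obtain ⟨⟨hn, hB⟩, h1, h2, h3, h4, h5⟩ := h
  have hB' : (0 : ℝ) < B := by exact_mod_cast hB
  have hr : (e : ℝ) / (e' + 1) < Real.goldenRatio := by
    refine lt_goldenRatio_of ?_
    have h1' : (e : ℝ) ^ 2 < (e : ℝ) * (e' + 1) + (e' + 1) ^ 2 := by exact_mod_cast h1
    rw [div_pow, div_lt_iff₀ (by positivity)]
    field_simp
    linarith
  have hC : (1 + 1 / (B : ℝ)) ^ 2 ≤ (c : ℝ) / (c' + 1) := by
    have h2' : ((B : ℝ) + 1) ^ 2 * (c' + 1) ≤ c * (B : ℝ) ^ 2 := by exact_mod_cast h2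
    rw [le_div_iff₀ (by positivity)]
    have : (1 + 1 / (B : ℝ)) ^ 2 = ((B : ℝ) + 1) ^ 2 / (B : ℝ) ^ 2 := by field_simp
    rw [this, div_mul_eq_mul_div, div_le_iff₀ (by positivity)]
    exact h2'
  have hCρ : (c : ℝ) / (c' + 1) ≤ (e : ℝ) / (e' + 1) := by
    rw [div_le_div_iff₀ (by positivity) (by positivity)]
    exact_mod_cast h3
  have hCD : ((c : ℝ) / (c' + 1)) ^ (m + 1) * ((d : ℝ) / (d' + 1)) ^ 2 ^ N <
      Real.goldenRatio ^ (m + 1) := by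
    refine lt_of_le_of_lt ?_ (pow_lt_pow_left₀ hr (by positivity) (Nat.succ_ne_zero m))
    have h4' : (c : ℝ) ^ (m + 1) * (d : ℝ) ^ 2 ^ N * ((e' : ℝ) + 1) ^ (m + 1) ≤
      (e : ℝ) ^ (m + 1) * ((c' : ℝ) + 1) ^ (m + 1) * ((d' : ℝ) + 1) ^ 2 ^ N := by
      exact_mod_cast h4
    rw [div_pow, div_pow, div_pow, div_mul_div_comm, div_le_div_iff₀ (by positivity)
      (by positivity), ← mul_assoc]
    exact h4'
  refine csSup_le ⟨_, heavyWord, heavyWord_mem, rfl⟩ ?_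
  rintro _ ⟨w, hw, rfl⟩
  have key := weight_le_of_bounded (M := m + 1) (P := 2 ^ N) hn hB (by positivity)
    (show (0 : ℝ) ≤ (d : ℝ) / (d' + 1) by positivity) hC (hCρ.trans_lt hr) hCD (fun u hu => by
      have h5' : 4 * (wordCont u : ℝ) ^ 2 *
          (((c' : ℝ) + 1) ^ wordWeight 1 2 u * ((d' : ℝ) + 1) ^ n) ≤
          (c : ℝ) ^ wordWeight 1 2 u * (d : ℝ) ^ n := by exact_mod_cast h5 u hu
      rw [div_pow, div_pow, div_mul_div_comm, le_div_iff₀ (by positivity)]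
      exact h5') hw
  have hlen : (0 : ℝ) < w.length := by exact_mod_cast length_pos_of_mem_growingWords hw
  have key' : (wordWeight 1 2 w : ℝ) * 2 ^ N ≤ (m + 1) * w.length := by exact_mod_cast key
  rw [← add_div, div_le_div_iff₀ hlen (by positivity)]
  exact key'

end Soundness

/-! ### Existence of the certificates -/

section Completeness

theorem exists_nat_div_between {a b : ℝ} (ha : 0 ≤ a) (hab : a < b) :
    ∃ e f : ℕ, a < (e : ℝ) / (f + 1) ∧ (e : ℝ) / (f + 1) < b := by
  obtain ⟨q, h1, h2⟩ := exists_rat_btwn hab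
  have hq : 0 < q := by exact_mod_cast ha.trans_lt h1
  have hnum : (0 : ℤ) ≤ q.num := (Rat.num_pos.2 hq).le
  have hden : 0 < q.den := q.den_pos
  have e : ((q.num.toNat : ℕ) : ℝ) / ((q.den - 1 : ℕ) + 1) = (q : ℝ) := by
    have e1 : ((q.num.toNat : ℕ) : ℝ) = (q.num : ℝ) := by
      exact_mod_cast Int.toNat_of_nonneg hnum
    have e2 : (((q.den - 1 : ℕ) : ℝ) + 1) = (q.den : ℝ) := by
      exact_mod_cast Nat.sub_add_cancel hden
    rw [e1, e2, Rat.cast_def]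
  exact ⟨q.num.toNat, q.den - 1, by rw [e]; exact h1, by rw [e]; exact h2⟩

theorem exists_lowerCert {N m : ℕ} (hm : (m : ℝ) / 2 ^ N ≤ criticalAverage 1 2) :
    ∃ w e f, LowerCert N m w e f := by
  have hN : (0 : ℝ) < 2 ^ N := by positivity
  obtain ⟨_, ⟨w, hw, rfl⟩, hlt⟩ := exists_lt_of_lt_csSup
    (s := {r : ℝ | ∃ w ∈ growingWords 1 2, (wordWeight 1 2 w : ℝ) / w.length = r})
    ⟨_, heavyWord, heavyWord_mem, rfl⟩
    (show criticalAverage 1 2 - 1 / 2 ^ N < _ from sub_lt_self _ (by positivity))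
  have hlen : (0 : ℝ) < w.length := by exact_mod_cast length_pos_of_mem_growingWords hw
  obtain ⟨r, hr, hr'⟩ : ∃ r : ℝ, r ^ wordWeight 1 2 w < (wordCont w : ℝ) ^ 2 ∧
      Real.goldenRatio < r := by
    have h := ((continuous_pow (wordWeight 1 2 w)).tendsto Real.goldenRatio).eventually
      (gt_mem_nhds hw.2)
    exact ((h.filter_mono nhdsWithin_le_nhds).and
      (self_mem_nhdsWithin (s := Set.Ioi Real.goldenRatio))).exists
  obtain ⟨e, f, h1, h2⟩ := exists_nat_div_between Real.goldenRatio_pos.le hr'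
  refine ⟨w, e, f, hw.1, ?_, ?_, ?_⟩
  · have hφ := Real.goldenRatio_sq
    have hφ1 := Real.one_lt_goldenRatio
    have h : (e : ℝ) / (f + 1) + 1 < ((e : ℝ) / (f + 1)) ^ 2 := by nlinarith
    rw [div_pow, lt_div_iff₀ (by positivity)] at h
    field_simp at h
    have h' : (e : ℝ) * (f + 1) + (f + 1) ^ 2 < (e : ℝ) ^ 2 := by linarith
    exact_mod_cast h'
  · have h : ((e : ℝ) / (f + 1)) ^ wordWeight 1 2 w < (wordCont w : ℝ) ^ 2 :=
      (pow_le_pow_left₀ (by positivity) h2.le _).trans_lt hr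
    rw [div_pow, div_lt_iff₀ (by positivity)] at h
    exact_mod_cast h
  · have h : (m : ℝ) / 2 ^ N < (wordWeight 1 2 w : ℝ) / w.length + 1 / 2 ^ N := by linarith
    rw [div_add_div _ _ hlen.ne' hN.ne', div_lt_div_iff₀ hN (by positivity)] at h
    have h' : ((m : ℝ) * w.length) * 2 ^ N < (wordWeight 1 2 w * 2 ^ N + w.length) * 2 ^ N := by
      linarith
    have := lt_of_mul_lt_mul_right h' hN.le
    exact_mod_cast this.le

/-- The logarithmic growth of a word relative to its weight; positive words with positive excess are
the growing ones. -/
noncomputable def wordExcess (w : List (ℕ × ℕ)) : ℝ :=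
  2 * Real.log (wordCont w) - wordWeight 1 2 w * Real.log Real.goldenRatio

theorem mem_growingWords_iff_excess {w : List (ℕ × ℕ)} (hw : PositiveWord w) :
    w ∈ growingWords 1 2 ↔ 0 < wordExcess w := by
  have hK : (0 : ℝ) < wordCont w := by exact_mod_cast wordCont_pos w
  have hφ := Real.goldenRatio_pos
  have h : Real.goldenRatio ^ wordWeight 1 2 w < (wordCont w : ℝ) ^ 2 ↔ 0 < wordExcess w := by
    rw [← Real.log_lt_log_iff (by positivity) (by positivity), Real.log_pow, Real.log_pow,
      wordExcess, sub_pos]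
    norm_num
  exact ⟨fun h' => h.1 h'.2, fun h' => ⟨hw, h.2 h'⟩⟩

theorem excess_append_ge (u v : List (ℕ × ℕ)) :
    wordExcess u + wordExcess v ≤ wordExcess (u ++ v) := by
  have hu : (0 : ℝ) < wordCont u := by exact_mod_cast wordCont_pos u
  have hv : (0 : ℝ) < wordCont v := by exact_mod_cast wordCont_pos v
  have h : (wordCont u * wordCont v : ℝ) ≤ wordCont (u ++ v) := by
    exact_mod_cast wordCont_mul_le u v
  have h' := Real.log_le_log (by positivity) h
  rw [Real.log_mul hu.ne' hv.ne'] at h'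
  simp only [wordExcess, wordWeight_append, Nat.cast_add]
  linarith

theorem excess_wordPow_ge (u : List (ℕ × ℕ)) (n : ℕ) :
    n * wordExcess u ≤ wordExcess (wordPow u n) := by
  have hu : (0 : ℝ) < wordCont u := by exact_mod_cast wordCont_pos u
  have h : (wordCont u : ℝ) ^ n ≤ wordCont (wordPow u n) := by
    exact_mod_cast pow_le_wordCont_wordPow u n
  have h' := Real.log_le_log (by positivity) h
  rw [Real.log_pow] at h'
  simp only [wordExcess, wordWeight_wordPow, Nat.cast_mul]
  linarith

/-- No convex combination of two words lies in the quadrant of positive excess and average above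
`r > criticalAverage 1 2`, since a product of powers of the two words would violate the definition of
the critical average. -/
theorem excess_mul_le {r : ℝ} (hr : criticalAverage 1 2 < r) {u v : List (ℕ × ℕ)}
    (hu : PositiveWord u) (hXu : 0 < wordWeight 1 2 u - r * u.length) (hv : v ∈ growingWords 1 2) :
    (wordWeight 1 2 u - r * u.length) * wordExcess v ≤
      -wordExcess u * (r * v.length - wordWeight 1 2 v) := by
  set X := (wordWeight 1 2 u : ℝ) - r * u.length with hX
  set Z := r * (v.length : ℝ) - wordWeight 1 2 v with hZ
  have hκ := wordWeight_le_criticalAverage hv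
  have hlen : (0 : ℝ) < v.length := by exact_mod_cast length_pos_of_mem_growingWords hv
  have hZ0 : 0 < Z := by nlinarith
  by_contra! hcon
  have hYu : wordExcess u ≤ 0 := by
    by_contra! h
    have hmem := (mem_growingWords_iff_excess hu).2 h
    have h1 := wordWeight_le_criticalAverage hmem
    have h2 : (0 : ℝ) ≤ u.length := Nat.cast_nonneg _
    nlinarith
  have hY' : 0 < -wordExcess u + 1 := by linarith
  have h0 : 0 < wordExcess v - Z / X * -wordExcess u := by
    rw [sub_pos, div_mul_eq_mul_div, div_lt_iff₀ hXu]
    linarith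
  obtain ⟨e, f, h1, h2⟩ := exists_nat_div_between (a := Z / X)
    (b := Z / X + (wordExcess v - Z / X * -wordExcess u) / (-wordExcess u + 1)) (by positivity)
    (by linarith [div_pos h0 hY'])
  have hf : (0 : ℝ) < (f : ℝ) + 1 := by positivity
  have g1 : Z * (f + 1) < e * X := by
    rwa [div_lt_div_iff₀ hXu hf] at h1
  have g2 : (e : ℝ) * -wordExcess u < (f + 1) * wordExcess v := by
    have h3 : ((e : ℝ) / (f + 1) - Z / X) * (-wordExcess u + 1) <
        wordExcess v - Z / X * -wordExcess u := by
      rw [← lt_div_iff₀ hY']; linarith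
    have h4 : (e : ℝ) / (f + 1) * -wordExcess u < wordExcess v := by nlinarith
    rw [div_mul_eq_mul_div, div_lt_iff₀ hf] at h4
    linarith
  have hpos : PositiveWord (wordPow u e ++ wordPow v (f + 1)) := (hu.pow e).append (hv.1.pow _)
  have hexc : 0 < wordExcess (wordPow u e ++ wordPow v (f + 1)) := by
    have a1 := excess_append_ge (wordPow u e) (wordPow v (f + 1))
    have a2 := excess_wordPow_ge u e
    have a3 := excess_wordPow_ge v (f + 1)
    push_cast at a3
    linarith
  have hκ' := wordWeight_le_criticalAverage ((mem_growingWords_iff_excess hpos).2 hexc)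
  rw [wordWeight_append, wordWeight_wordPow, wordWeight_wordPow, List.length_append,
    length_wordPow, length_wordPow] at hκ'
  push_cast at hκ'
  have h5 : (0 : ℝ) ≤ u.length := Nat.cast_nonneg _
  have h6 : criticalAverage 1 2 * ((u.length : ℝ) * e + v.length * (f + 1)) ≤
    r * ((u.length : ℝ) * e + v.length * (f + 1)) := by gcongr
  rw [hX, hZ] at g1
  nlinarith

/-- A line separating the pairs (weight, excess) of all words from the forbidden quadrant gives a
bound for the continuants of all words. -/
theorem exists_slope {r : ℝ} (hr : criticalAverage 1 2 < r) (hr14 : r < 14) :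
    ∃ θ : ℝ, 0 < θ ∧ θ ≤ Real.log Real.goldenRatio ∧ ∀ w, PositiveWord w →
      2 * Real.log (wordCont w) ≤
        wordWeight 1 2 w * (Real.log Real.goldenRatio - θ) + θ * r * w.length := by
  set T : Set ℝ := {y | ∃ v ∈ growingWords 1 2, y = wordExcess v / (r * v.length - wordWeight 1 2 v)}
    with hT
  have hden : ∀ v ∈ growingWords 1 2, 0 < r * (v.length : ℝ) - wordWeight 1 2 v := by
    intro v hv
    have hκ := wordWeight_le_criticalAverage hv
    have hlen : (0 : ℝ) < v.length := by exact_mod_cast length_pos_of_mem_growingWords hv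
    nlinarith
  have hub : ∀ u, PositiveWord u → 0 < wordWeight 1 2 u - r * u.length →
      ∀ y ∈ T, y ≤ -wordExcess u / (wordWeight 1 2 u - r * u.length) := by
    rintro u hu hX _ ⟨v, hv, rfl⟩
    rw [div_le_div_iff₀ (hden v hv) hX, mul_comm]
    exact excess_mul_le hr hu hX hv
  have hne : T.Nonempty := ⟨_, heavyWord, heavyWord_mem, rfl⟩
  -- the word `(20, 20)` has average `60`, far above `r`, and bounds the slopes
  have hu0 : PositiveWord [(20, 20)] := by simp [PositiveWord]
  have hw0 : (wordWeight 1 2 [(20, 20)] : ℝ) = 60 := by norm_num [wordWeight]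
  have hX0 : 0 < (wordWeight 1 2 [(20, 20)] : ℝ) - r * ([(20, 20)] : List (ℕ × ℕ)).length := by
    rw [hw0]; simp; linarith
  have hbdd : BddAbove T := ⟨_, fun y hy => hub _ hu0 hX0 y hy⟩
  have hpos : 0 < sSup T := by
    refine lt_of_lt_of_le ?_ (le_csSup hbdd ⟨heavyWord, heavyWord_mem, rfl⟩)
    exact div_pos ((mem_growingWords_iff_excess heavyWord_mem.1).1 heavyWord_mem)
      (hden _ heavyWord_mem)
  refine ⟨sSup T, hpos, ?_, ?_⟩
  · refine (csSup_le hne (hub _ hu0 hX0)).trans ?_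
    rw [div_le_iff₀ hX0, wordExcess, hw0]
    have hK : wordCont [(20, 20)] = 401 := by decide
    have hlog : 14 * Real.log Real.goldenRatio ≤ 2 * Real.log 401 := by
      have h : Real.goldenRatio ^ 14 ≤ (401 : ℝ) ^ 2 :=
        (pow_le_pow_left₀ Real.goldenRatio_pos.le Real.goldenRatio_lt_two.le 14).trans
          (by norm_num)
      have := Real.log_le_log (pow_pos Real.goldenRatio_pos _) h
      rw [Real.log_pow, Real.log_pow] at this
      exact_mod_cast this
    have hl : 0 < Real.log Real.goldenRatio := Real.log_pos Real.one_lt_goldenRatio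
    rw [hK]
    simp only [List.length_singleton]
    push_cast
    nlinarith
  · intro w hw
    suffices h : wordExcess w + sSup T * (wordWeight 1 2 w - r * w.length) ≤ 0 by
      rw [wordExcess] at h
      linarith
    by_cases hg : w ∈ growingWords 1 2
    · have h := le_csSup hbdd (show _ ∈ T from ⟨w, hg, rfl⟩)
      rw [div_le_iff₀ (hden w hg)] at h
      linarith
    · have hY : wordExcess w ≤ 0 := by
        by_contra! h
        exact hg ((mem_growingWords_iff_excess hw).2 h)
      rcases le_or_gt ((wordWeight 1 2 w : ℝ) - r * w.length) 0 with hX | hX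
      · nlinarith
      · have h := csSup_le hne (hub w hw hX)
        rw [le_div_iff₀ hX] at h
        linarith

/-- Rational approximation of the constants `exp (log φ - θ)` and `exp (θ * r)` of the bound from
`exists_slope`. -/
theorem exists_upperCert {N m : ℕ} (hm : criticalAverage 1 2 < ((m : ℝ) + 1) / 2 ^ N) :
    ∃ n B c c' d d' e e', UpperCert N m n B c c' d d' e e' := by
  obtain ⟨r, hr, hr'⟩ := exists_between
    (lt_min hm (criticalAverage_bounds.2.trans (by norm_num : (13.06 : ℝ) < 14)))
  have hN : (0 : ℝ) < 2 ^ N := by positivity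
  have hr0 : 0 < r := by linarith [criticalAverage_bounds.1]
  have hrM : r * 2 ^ N < (m : ℝ) + 1 := (lt_div_iff₀ hN).1 (hr'.trans_le (min_le_left _ _))
  obtain ⟨θ, hθ, hθ', hline⟩ := exists_slope hr (hr'.trans_le (min_le_right _ _))
  set l := Real.log Real.goldenRatio with hl
  have hφ := Real.goldenRatio_pos
  have hm0 : (0 : ℝ) < (m : ℝ) + 1 := by positivity
  -- the room for the rational approximations
  set ε := θ * (((m : ℝ) + 1) - r * 2 ^ N) / (2 * ((m : ℝ) + 1) + 2 ^ N) with hε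
  have hden : 0 < 2 * ((m : ℝ) + 1) + 2 ^ N := by positivity
  have hε0 : 0 < ε := div_pos (mul_pos hθ (by linarith)) hden
  have hεeq : ε * (2 * ((m : ℝ) + 1) + 2 ^ N) = θ * (((m : ℝ) + 1) - r * 2 ^ N) :=
    div_mul_cancel₀ _ hden.ne'
  have hε2 : 2 * ε ≤ θ := by
    have : 2 * ε * ((m : ℝ) + 1) ≤ θ * ((m : ℝ) + 1) := by
      have h1 : 0 < ε * 2 ^ N := by positivity
      have h2 : 0 < θ * (r * 2 ^ N) := by positivity
      linarith
    exact le_of_mul_le_mul_right this hm0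
  obtain ⟨c, c', hc1, hc2⟩ := exists_nat_div_between (Real.exp_pos (l - θ)).le
    (Real.exp_lt_exp.2 (show l - θ < l - θ + ε by linarith))
  obtain ⟨d, d', hd1, hd2⟩ := exists_nat_div_between (Real.exp_pos (θ * r)).le
    (Real.exp_lt_exp.2 (show θ * r < θ * r + ε by linarith))
  obtain ⟨e, e', he1, he2⟩ := exists_nat_div_between (Real.exp_pos (l - ε)).le
    (Real.exp_lt_exp.2 (show l - ε < l by linarith))
  rw [hl, Real.exp_log hφ] at he2
  set C : ℝ := (c : ℝ) / (c' + 1) with hC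
  set D : ℝ := (d : ℝ) / (d' + 1) with hD
  set ρ : ℝ := (e : ℝ) / (e' + 1) with hρ
  have hC0 : 0 < C := (Real.exp_pos _).trans hc1
  have hD0 : 0 < D := (Real.exp_pos _).trans hd1
  have hρ0 : 0 < ρ := (Real.exp_pos _).trans he1
  have hC1 : 1 < C := (Real.one_le_exp (by linarith)).trans_lt hc1
  have hCρ : C ≤ ρ := (hc2.trans_le (Real.exp_le_exp.2 (by linarith))).le.trans he1.le
  have hCD : C ^ (m + 1) * D ^ 2 ^ N ≤ ρ ^ (m + 1) := by
    calc C ^ (m + 1) * D ^ 2 ^ N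
        ≤ Real.exp (l - θ + ε) ^ (m + 1) * Real.exp (θ * r + ε) ^ 2 ^ N := by gcongr
      _ = Real.exp (l - ε) ^ (m + 1) := by
        rw [← Real.exp_nat_mul, ← Real.exp_nat_mul, ← Real.exp_nat_mul, ← Real.exp_add]
        congr 1
        push_cast
        linarith
      _ ≤ _ := by gcongr
  -- long words make up for the factor `4`
  obtain ⟨n, hn⟩ := pow_unbounded_of_one_lt 4 ((one_lt_div (Real.exp_pos _)).2 hd1)
  have hn0 : 0 < n := by
    rcases Nat.eq_zero_or_pos n with rfl | h
    · norm_num at hn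
    · exact h
  -- `(1 + 1 / B) ^ 2 ≤ 1 + 3 / B < C`
  obtain ⟨B, hB⟩ := exists_nat_gt (3 / (C - 1))
  have hB0 : (0 : ℝ) < B := lt_trans (div_pos (by norm_num) (by linarith)) hB
  have hB1 : (1 : ℝ) ≤ B := by exact_mod_cast (show 0 < B by exact_mod_cast hB0)
  rw [div_lt_iff₀ (by linarith)] at hB
  refine ⟨n, B, c, c', d, d', e, e', ⟨hn0, by exact_mod_cast hB0⟩, ?_, ?_, ?_, ?_, ?_⟩
  · have h1 := Real.goldenRatio_sq
    have h2 := Real.one_lt_goldenRatio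
    have h : ρ ^ 2 < ρ + 1 := by nlinarith
    rw [hρ, div_pow, div_lt_iff₀ (by positivity)] at h
    field_simp at h
    have h' : (e : ℝ) ^ 2 < (e : ℝ) * (e' + 1) + (e' + 1) ^ 2 := by linarith
    exact_mod_cast h'
  · have h : ((B : ℝ) + 1) ^ 2 ≤ C * (B : ℝ) ^ 2 := by nlinarith
    rw [hC, div_mul_eq_mul_div, le_div_iff₀ (by positivity)] at h
    exact_mod_cast h
  · have h := hCρ
    rw [hC, hρ, div_le_div_iff₀ (by positivity) (by positivity)] at h
    exact_mod_cast h
  · have h := hCD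
    rw [hC, hD, hρ, div_pow, div_pow, div_pow, div_mul_div_comm, div_le_div_iff₀ (by positivity)
      (by positivity), ← mul_assoc] at h
    exact_mod_cast h
  · intro u hu
    rw [mem_boundedWords] at hu
    have hpos : PositiveWord u := fun p hp => by
      have := mem_boundedPairs.1 (hu.2 p hp)
      exact ⟨this.1.1, this.2.1⟩
    have hK : (0 : ℝ) < wordCont u := by exact_mod_cast wordCont_pos u
    have h1 := Real.exp_le_exp.2 (hline u hpos)
    have e1 : Real.exp (2 * Real.log (wordCont u)) = (wordCont u : ℝ) ^ 2 := by
      have := Real.exp_nat_mul (Real.log (wordCont u)) 2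
      rw [Real.exp_log hK] at this
      exact_mod_cast this
    have e2 : Real.exp (wordWeight 1 2 u * (l - θ) + θ * r * u.length) =
        Real.exp (l - θ) ^ wordWeight 1 2 u * Real.exp (θ * r) ^ n := by
      rw [Real.exp_add, Real.exp_nat_mul, mul_comm (θ * r), Real.exp_nat_mul, hu.1]
    rw [e1, e2] at h1
    rw [div_pow, lt_div_iff₀ (by positivity)] at hn
    have h : 4 * (wordCont u : ℝ) ^ 2 ≤ C ^ wordWeight 1 2 u * D ^ n :=
      calc 4 * (wordCont u : ℝ) ^ 2
          ≤ 4 * (Real.exp (l - θ) ^ wordWeight 1 2 u * Real.exp (θ * r) ^ n) := by gcongr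
        _ = Real.exp (l - θ) ^ wordWeight 1 2 u * (4 * Real.exp (θ * r) ^ n) := by ring
        _ ≤ C ^ wordWeight 1 2 u * D ^ n := by gcongr
    rw [hC, hD, div_pow, div_pow, div_mul_div_comm, le_div_iff₀ (by positivity)] at h
    exact_mod_cast h

theorem isComputableReal_criticalAverage : IsComputableReal (criticalAverage 1 2) := by
  refine isComputableReal_of_certs (fun _ _ _ _ _ h => h.le_criticalAverage)
    (fun _ _ _ _ _ _ _ _ _ _ h => h.criticalAverage_le) fun N => ?_
  have hN : (0 : ℝ) < 2 ^ N := by positivity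
  have h0 : 0 ≤ criticalAverage 1 2 * 2 ^ N :=
    mul_nonneg (by linarith [criticalAverage_bounds.1]) hN.le
  refine ⟨⌊criticalAverage 1 2 * 2 ^ N⌋₊, exists_lowerCert ?_, exists_upperCert ?_⟩
  · rw [div_le_iff₀ hN]
    exact Nat.floor_le h0
  · rw [lt_div_iff₀ hN]
    exact Nat.lt_floor_add_one _

end Completeness

/-! ### Average weight below or near four -/

section SmallWeight

/-- If the average weight of the pairs stays below `4`, then the trivial bound `q_{2t} ≥ φ ^ (2t - 1)`
makes the squared denominators outgrow the values. -/
theorem tendsto_atTop_of_average_lt_four {α β : ℕ} {d : ℕ → ℕ} (hd : ∀ n, 0 < d n) {c : ℝ}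
    (hc : c < 4) (hlim : ∀ᶠ t : ℕ in atTop, (digitSum α β d (2 * t) : ℝ) ≤ c * t) :
    Tendsto (fun t => (contDen d (2 * t + 1) : ℝ) ^ 2 /
      Real.goldenRatio ^ digitSum α β d (2 * t + 2)) atTop atTop := by
  have hφ := Real.goldenRatio_pos
  have hφ1 := Real.one_lt_goldenRatio
  have hexp : Tendsto (fun t : ℕ => 4 * t - digitSum α β d (2 * t + 2)) atTop atTop := by
    rw [← tendsto_natCast_atTop_iff (R := ℝ)]
    have hlin : Tendsto (fun t : ℕ => (4 - c) * (t : ℝ) + -c) atTop atTop :=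
      tendsto_atTop_add_const_right _ _
        (tendsto_natCast_atTop_atTop.const_mul_atTop (by linarith))
    refine tendsto_atTop_mono' _ ?_ hlin
    filter_upwards [(tendsto_add_atTop_nat 1).eventually hlim] with t ht
    have h1 : (4 * t : ℕ) ≤ ((4 * t - digitSum α β d (2 * t + 2) : ℕ) : ℝ) +
        digitSum α β d (2 * t + 2) := by
      exact_mod_cast Nat.sub_le_iff_le_add.1 le_rfl
    rw [show 2 * (t + 1) = 2 * t + 2 by ring] at ht
    push_cast at h1 ht
    linarith
  have hbase : Tendsto (fun t : ℕ => Real.goldenRatio ^ (4 * t - digitSum α β d (2 * t + 2)) /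
      Real.goldenRatio ^ 2) atTop atTop :=
    (goldenRatio_tendsto_pow.comp hexp).atTop_div_const (by positivity)
  refine tendsto_atTop_mono' _ ?_ hbase
  filter_upwards [hexp.eventually (eventually_gt_atTop 0)] with t ht
  have h1 := goldenRatio_pow_le_wordCont (positiveWord_prefixWord hd t)
  rw [length_prefixWord, wordCont_prefixWord] at h1
  have h2 := pow_le_pow_left₀ (by positivity) h1 2
  rw [← pow_mul, mul_pow] at h2
  rw [div_le_div_iff₀ (by positivity) (by positivity), ← pow_add, Nat.sub_add_cancel (by omega)]
  calc Real.goldenRatio ^ (4 * t) = Real.goldenRatio ^ (2 * t * 2) := by ring_nf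
    _ ≤ _ := h2
    _ = _ := mul_comm _ _

theorem wordMatrix_wordPow_one_one (M : ℕ) :
    Real.goldenRatio * wordMatrix (wordPow [(1, 1)] M) 0 0 + wordMatrix (wordPow [(1, 1)] M) 0 1 =
        Real.goldenRatio ^ (2 * M + 1) ∧
      Real.goldenRatio * wordMatrix (wordPow [(1, 1)] M) 1 0 + wordMatrix (wordPow [(1, 1)] M) 1 1 =
        Real.goldenRatio ^ (2 * M) := by
  have hsq := Real.goldenRatio_sq
  induction M with
  | zero => simp [wordPow_zero, wordMatrix_nil]
  | succ M ih =>
    obtain ⟨h0, h1⟩ := ih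
    rw [wordPow_succ, List.singleton_append, wordMatrix_cons_zero, wordMatrix_cons_zero,
      wordMatrix_cons_one, wordMatrix_cons_one]
    push_cast
    have e1 : Real.goldenRatio ^ (2 * (M + 1) + 1) =
        2 * Real.goldenRatio ^ (2 * M + 1) + Real.goldenRatio ^ (2 * M) := by
      calc _ = Real.goldenRatio ^ (2 * M) * (Real.goldenRatio * Real.goldenRatio ^ 2) := by ring
        _ = Real.goldenRatio ^ (2 * M) * (Real.goldenRatio ^ 2 + Real.goldenRatio) := by
          rw [hsq]; linear_combination Real.goldenRatio ^ (2 * M) * hsq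
        _ = Real.goldenRatio ^ (2 * M) * (2 * Real.goldenRatio + 1) := by rw [hsq]; ring
        _ = _ := by ring
    have e2 : Real.goldenRatio ^ (2 * (M + 1)) =
        Real.goldenRatio ^ (2 * M + 1) + Real.goldenRatio ^ (2 * M) := by
      calc _ = Real.goldenRatio ^ (2 * M) * Real.goldenRatio ^ 2 := by ring
        _ = _ := by rw [hsq]; ring
    rw [e1, e2, ← h0, ← h1]
    constructor <;> ring

/-- Many pairs `(1, 1)` followed by one pair with a large second digit: the average weight is close
to `4`, but the weight wins over the denominator. -/
theorem exists_word_average_lt {δ : ℝ} (hδ : 0 < δ) :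
    ∃ w : List (ℕ × ℕ), PositiveWord w ∧ 0 < w.length ∧
      (wordWeight 2 1 w : ℝ) / w.length < 4 + δ ∧
      (2 * wordCont w : ℝ) ^ 2 < Real.goldenRatio ^ wordWeight 2 1 w := by
  have hφ := Real.goldenRatio_pos
  have hφ1 := Real.one_lt_goldenRatio
  have hlim := tendsto_pow_const_mul_const_pow_of_abs_lt_one 4
    (show |Real.goldenRatio⁻¹| < 1 by
      rw [abs_of_pos (by positivity)]; exact inv_lt_one_of_one_lt₀ hφ1)
  obtain ⟨p, hp⟩ := exists_nat_gt (1 / δ)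
  obtain ⟨k, ⟨hk1, hk2⟩, hk3⟩ := ((hlim.eventually
    (gt_mem_nhds (show (0 : ℝ) < 1 / 36 by norm_num))).and (eventually_ge_atTop 2)).and
    (eventually_ge_atTop p) |>.exists
  have hk2' : (2 : ℝ) ≤ k := by exact_mod_cast hk2
  have hk3' : (p : ℝ) ≤ k := by exact_mod_cast hk3
  have hpow : 4 * ((k : ℝ) ^ 2 + k + 1) ^ 2 < Real.goldenRatio ^ k := by
    rw [inv_pow, ← div_eq_mul_inv, div_lt_iff₀ (by positivity)] at hk1
    have h1 : (k : ℝ) ^ 2 + k + 1 ≤ 3 * (k : ℝ) ^ 2 := by nlinarith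
    have h2 := pow_le_pow_left₀ (by positivity) h1 2
    have h3 : (3 * (k : ℝ) ^ 2) ^ 2 = 9 * (k : ℝ) ^ 4 := by ring
    linarith
  have hpos1 : PositiveWord [((1 : ℕ), (1 : ℕ))] := by simp [PositiveWord]
  have hpos2 : PositiveWord [((1 : ℕ), k ^ 2 + k)] := by
    simpa [PositiveWord] using by omega
  have hlen : (wordPow [(1, 1)] (k ^ 2) ++ [(1, k ^ 2 + k)]).length = k ^ 2 + 1 := by
    simp [length_wordPow]
  have hwt : wordWeight 2 1 (wordPow [(1, 1)] (k ^ 2) ++ [(1, k ^ 2 + k)]) =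
      4 * k ^ 2 + k + 2 := by
    rw [wordWeight_append, wordWeight_wordPow, wordWeight_cons, wordWeight_cons, wordWeight_nil]
    ring
  -- the large digit exceeds the number of pairs `(1, 1)` by `k`, and `φ ^ k` beats its square
  refine ⟨wordPow [(1, 1)] (k ^ 2) ++ [(1, k ^ 2 + k)], (hpos1.pow _).append hpos2, ?_, ?_, ?_⟩
  · rw [hlen]; omega
  · rw [hlen, hwt, div_lt_iff₀ (by positivity)]
    push_cast
    have h1 : 1 < k * δ := by
      rw [div_lt_iff₀ hδ] at hp
      nlinarith
    nlinarith
  · rw [hwt]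
    set a : ℝ := ((wordMatrix (wordPow [(1, 1)] (k ^ 2)) 0 0 : ℕ) : ℝ) with ha
    set b : ℝ := ((wordMatrix (wordPow [(1, 1)] (k ^ 2)) 0 1 : ℕ) : ℝ) with hb
    have ha0 : 0 ≤ a := Nat.cast_nonneg _
    have hb0 : 0 ≤ b := Nat.cast_nonneg _
    have hab : Real.goldenRatio * a + b = Real.goldenRatio ^ (2 * k ^ 2 + 1) :=
      (wordMatrix_wordPow_one_one (k ^ 2)).1
    have hK : (wordCont (wordPow [(1, 1)] (k ^ 2) ++ [(1, k ^ 2 + k)]) : ℝ) =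
        a * ((k : ℝ) ^ 2 + k + 1) + b * ((k : ℝ) ^ 2 + k) := by
      rw [wordCont, wordMatrix_concat_zero]
      push_cast
      rw [one_mul]
    have hK' : (wordCont (wordPow [(1, 1)] (k ^ 2) ++ [(1, k ^ 2 + k)]) : ℝ) ≤
        ((k : ℝ) ^ 2 + k + 1) * Real.goldenRatio ^ (2 * k ^ 2 + 1) := by
      rw [hK, ← hab]
      have h1 : a * ((k : ℝ) ^ 2 + k + 1) ≤
          Real.goldenRatio * a * ((k : ℝ) ^ 2 + k + 1) := by
        gcongr
        nlinarith
      linarith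
    calc (2 * wordCont (wordPow [(1, 1)] (k ^ 2) ++ [(1, k ^ 2 + k)]) : ℝ) ^ 2
        ≤ (2 * (((k : ℝ) ^ 2 + k + 1) * Real.goldenRatio ^ (2 * k ^ 2 + 1))) ^ 2 := by gcongr
      _ = (4 * ((k : ℝ) ^ 2 + k + 1) ^ 2) * Real.goldenRatio ^ (4 * k ^ 2 + 2) := by ring
      _ < Real.goldenRatio ^ k * Real.goldenRatio ^ (4 * k ^ 2 + 2) := by gcongr
      _ = _ := by rw [← pow_add]; congr 1; ring

end SmallWeight

/-! ### Small partial quotients -/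

section SmallDigits

/-- The growth over one pair `(a, b)` of digits at most `2`, when the previous denominator is at
least a third of the current one. The pair `(2, 1)` is the critical one. -/
theorem goldenRatio_pow_le_of_le_two {a b : ℕ} (ha : 0 < a) (ha2 : a ≤ 2) (hb : 0 < b)
    (hb2 : b ≤ 2) :
    1.001 * Real.goldenRatio ^ (2 * a + b) ≤ ((a : ℝ) * b + 1 + b / 3) ^ 2 := by
  have hlt := goldenRatio_bounds.2
  have hφ := Real.goldenRatio_pos
  have h : Real.goldenRatio ^ (2 * a + b) ≤ 1.618034 ^ (2 * a + b) :=
    pow_le_pow_left₀ hφ.le hlt.le _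
  refine (mul_le_mul_of_nonneg_left h (by norm_num)).trans ?_
  interval_cases a <;> interval_cases b <;> norm_num

theorem tendsto_atTop_of_digit_le_two {d : ℕ → ℕ} (hd : ∀ n, 0 < d n) (hd2 : ∀ n, d n ≤ 2) :
    Tendsto (fun t => (contDen d (2 * t + 1) : ℝ) ^ 2 /
      Real.goldenRatio ^ digitSum 2 1 d (2 * t + 2)) atTop atTop := by
  have hφ := Real.goldenRatio_pos
  have hφ1 := Real.one_lt_goldenRatio
  have hsum : ∀ t, digitSum 2 1 d (2 * t + 2) =
      digitSum 2 1 d (2 * t) + (2 * d (2 * t) + d (2 * t + 1)) := by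
    intro t
    have : ¬ Even (2 * t + 1) := by simp
    rw [show 2 * t + 2 = 2 * t + 1 + 1 by ring, digitSum_succ, digitSum_succ]
    simp only [letterWeight, even_two_mul, this, if_true, if_false]
    ring
  have hrec : ∀ t, (contDen d (2 * (t + 1) + 1) : ℝ) =
      ((d (2 * t) : ℝ) * d (2 * t + 1) + 1) * contDen d (2 * t + 1) +
        d (2 * t + 1) * contDen d (2 * t) := by
    intro t
    rw [show 2 * (t + 1) + 1 = 2 * t + 1 + 2 by ring]
    simp only [contDen]
    push_cast
    ring
  have hthird : ∀ t, (contDen d (2 * (t + 1) + 1) : ℝ) ≤ 3 * contDen d (2 * (t + 1)) := by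
    intro t
    have h1 := contDen_le_succ hd (2 * t + 1)
    have h2 : contDen d (2 * (t + 1) + 1) =
        d (2 * t + 1) * contDen d (2 * t + 2) + contDen d (2 * t + 1) := rfl
    have h3 := Nat.mul_le_mul_right (contDen d (2 * t + 2)) (hd2 (2 * t + 1))
    have h4 : contDen d (2 * (t + 1) + 1) ≤ 3 * contDen d (2 * t + 2) := by
      rw [h2]
      have h1' : contDen d (2 * t + 1) ≤ contDen d (2 * t + 2) := h1
      omega
    exact_mod_cast h4
  -- exponential growth, from the first full pair onwards
  have hgrow : ∀ t, (Real.goldenRatio ^ 6)⁻¹ * 1.001 ^ t *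
      Real.goldenRatio ^ digitSum 2 1 d (2 * (t + 1)) ≤ (contDen d (2 * (t + 1) + 1) : ℝ) ^ 2 := by
    intro t
    induction t with
    | zero =>
      have h1 : (1 : ℝ) ≤ contDen d (2 * (0 + 1) + 1) := by
        exact_mod_cast contDen_pos hd _
      have h2 : digitSum 2 1 d (2 * (0 + 1)) ≤ 6 := by
        have := hsum 0
        have e : digitSum 2 1 d (2 * 0) = 0 := by simp [digitSum]
        have g1 := hd2 (2 * 0)
        have g2 := hd2 (2 * 0 + 1)
        rw [e] at this
        have this' : digitSum 2 1 d (2 * (0 + 1)) = 0 + (2 * d (2 * 0) + d (2 * 0 + 1)) := this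
        omega
      have h3 : Real.goldenRatio ^ digitSum 2 1 d (2 * (0 + 1)) ≤ Real.goldenRatio ^ 6 :=
        pow_le_pow_right₀ hφ1.le h2
      calc _ ≤ (Real.goldenRatio ^ 6)⁻¹ * 1.001 ^ 0 * Real.goldenRatio ^ 6 := by gcongr
        _ = 1 := by rw [pow_zero, mul_one, inv_mul_cancel₀ (by positivity)]
        _ ≤ _ := one_le_pow₀ h1
    | succ t ih =>
      set q : ℝ := ((contDen d (2 * (t + 1) + 1) : ℕ) : ℝ) with hq
      have hq0 : 0 ≤ q := Nat.cast_nonneg _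
      have key := goldenRatio_pow_le_of_le_two (hd (2 * (t + 1))) (hd2 _)
        (hd (2 * (t + 1) + 1)) (hd2 _)
      set a := d (2 * (t + 1)) with ha
      set b := d (2 * (t + 1) + 1) with hb
      have hle : ((a : ℝ) * b + 1 + b / 3) * q ≤ contDen d (2 * (t + 1 + 1) + 1) := by
        rw [hrec (t + 1)]
        have h1 : (b : ℝ) * q ≤ b * (3 * contDen d (2 * (t + 1))) := by
          gcongr
          exact hthird t
        linarith
      rw [show 2 * (t + 1 + 1) = 2 * (t + 1) + 2 by ring, hsum (t + 1)]
      rw [show 2 * (t + 1 + 1) = 2 * (t + 1) + 2 by ring] at hle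
      calc (Real.goldenRatio ^ 6)⁻¹ * 1.001 ^ (t + 1) *
            Real.goldenRatio ^ (digitSum 2 1 d (2 * (t + 1)) + (2 * a + b))
          = ((Real.goldenRatio ^ 6)⁻¹ * 1.001 ^ t *
              Real.goldenRatio ^ digitSum 2 1 d (2 * (t + 1))) *
              (1.001 * Real.goldenRatio ^ (2 * a + b)) := by ring
        _ ≤ q ^ 2 * ((a : ℝ) * b + 1 + b / 3) ^ 2 := by gcongr
        _ = (((a : ℝ) * b + 1 + b / 3) * q) ^ 2 := by ring
        _ ≤ _ := by gcongr
  rw [← tendsto_add_atTop_iff_nat 1]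
  have hbase : Tendsto (fun t : ℕ => (1.001 : ℝ) ^ t / Real.goldenRatio ^ 12) atTop atTop :=
    (tendsto_pow_atTop_atTop_of_one_lt (by norm_num)).atTop_div_const (by positivity)
  refine tendsto_atTop_mono (fun t => ?_) hbase
  have hle : digitSum 2 1 d (2 * (t + 1) + 2) ≤ digitSum 2 1 d (2 * (t + 1)) + 6 := by
    rw [hsum]
    have g1 := hd2 (2 * (t + 1))
    have g2 := hd2 (2 * (t + 1) + 1)
    omega
  rw [div_le_div_iff₀ (by positivity) (by positivity)]
  calc (1.001 : ℝ) ^ t * Real.goldenRatio ^ digitSum 2 1 d (2 * (t + 1) + 2)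
      ≤ 1.001 ^ t * Real.goldenRatio ^ (digitSum 2 1 d (2 * (t + 1)) + 6) := by
        gcongr
        exact hφ1.le
    _ = ((Real.goldenRatio ^ 6)⁻¹ * 1.001 ^ t *
          Real.goldenRatio ^ digitSum 2 1 d (2 * (t + 1))) * Real.goldenRatio ^ 12 := by
        have h6 : Real.goldenRatio ^ 6 ≠ 0 := by positivity
        rw [pow_add, show (12 : ℕ) = 6 + 6 from rfl, pow_add _ 6 6]
        generalize Real.goldenRatio ^ 6 = P at h6
        field_simp
    _ ≤ _ := by gcongr; exact hgrow t

theorem periodicDigit_replicate {p : ℕ × ℕ} {k : ℕ} (hk : 0 < k) (n : ℕ) :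
    periodicDigit (List.replicate k p) n = if Even n then p.1 else p.2 := by
  have h : n / 2 % k < (List.replicate k p).length := by
    rw [List.length_replicate]; exact Nat.mod_lt _ hk
  rw [periodicDigit, List.length_replicate, List.getD_eq_getElem _ _ (by simpa using h),
    List.getElem_replicate]

/-- `(√21 - 3) / 6 = [0; 3, 1, 3, 1, …]`. -/
theorem isExpansion_three_one {d : ℕ → ℕ} (hd : ∀ n, d n = if Even n then 3 else 1) :
    IsExpansion ((√21 - 3) / 6) d
      fun n => if Even n then (√21 - 3) / 6 else 3 * ((√21 - 3) / 6) := by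
  have h21 : √21 ^ 2 = 21 := Real.sq_sqrt (by norm_num)
  have h1 : (4 : ℝ) < √21 := Real.lt_sqrt_of_sq_lt (by norm_num)
  have h2 : √21 < 5 := (Real.sqrt_lt' (by norm_num)).2 (by norm_num)
  set y := (√21 - 3) / 6 with hy
  have hy0 : 0 < y := by rw [hy]; linarith
  have hy1 : 3 * y < 1 := by rw [hy]; linarith
  have hq : y * (3 * y + 3) = 1 := by rw [hy]; nlinarith
  refine ⟨by simp, fun n => by rw [hd]; split_ifs <;> norm_num, fun n => ?_⟩
  rw [hd]
  by_cases hn : Even n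
  · have hn' : ¬ Even (n + 1) := by simpa [Nat.even_add_one] using hn
    simp only [hn, hn', if_true, if_false]
    refine ⟨hy0, by linarith, ?_⟩
    rw [inv_eq_of_mul_eq_one_right hq]
    push_cast
    ring
  · have hn' : Even (n + 1) := by simpa [Nat.even_add_one] using hn
    simp only [hn, hn', if_true, if_false]
    refine ⟨by linarith, hy1, ?_⟩
    have hq' : 3 * y * (y + 1) = 1 := by linarith
    rw [inv_eq_of_mul_eq_one_right hq']
    push_cast
    ring

end SmallDigits

/-! ### Derivatives in terms of the average weight -/

section AverageWeight

variable {lam : ℝ} {α β : ℕ}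

theorem IsExpansion.hasDerivAt_zero_of_liminf (h0 : 0 < lam) (h1 : lam < 1)
    (hα : lam = (Real.goldenRatio ^ α)⁻¹) (hβ : 1 - lam = (Real.goldenRatio ^ β)⁻¹)
    (hα1 : 1 ≤ α) (hβ1 : 1 ≤ β) (hαβ : α + β = 3) {κ : ℝ} (hκ0 : 0 ≤ κ)
    (hκ : ∀ w ∈ growingWords α β, (wordWeight α β w : ℝ) ≤ κ * w.length) {x : ℝ} {d : ℕ → ℕ}
    {z : ℕ → ℝ} (h : IsExpansion x d z)
    (hlim : (κ : EReal) <
      liminf (fun t : ℕ => (((digitSum α β d (2 * t) : ℝ) / t : ℝ) : EReal)) atTop) :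
    HasDerivAt (dtu lam) 0 x := by
  obtain ⟨c, hc1, hc2⟩ := EReal.lt_iff_exists_real_btwn.1 hlim
  refine h.hasDerivAt_zero_of_even h0 h1 hα hβ hα1 hβ1
    (tendsto_zero_of_lt_average hαβ h.2.1 hκ hκ0 (EReal.coe_lt_coe_iff.1 hc1) ?_)
  filter_upwards [eventually_lt_of_lt_liminf hc2, eventually_gt_atTop 0] with t ht ht0
  have ht0' : (0 : ℝ) < t := by exact_mod_cast ht0
  exact ((lt_div_iff₀ ht0').1 (EReal.coe_lt_coe_iff.1 ht)).le

theorem exists_isExpansion_hasInfiniteDerivAt (h0 : 0 < lam) (h1 : lam < 1)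
    (hα : lam = (Real.goldenRatio ^ α)⁻¹) (hβ : 1 - lam = (Real.goldenRatio ^ β)⁻¹)
    (hne : (growingWords α β).Nonempty) {δ : ℝ} (hδ : 0 < δ) :
    ∃ x d z, IsExpansion x d z ∧ (∃ L : ℝ,
      Tendsto (fun t : ℕ => (digitSum α β d (2 * t) : ℝ) / t) atTop (𝓝 L) ∧
      criticalAverage α β - δ < L) ∧ HasInfiniteDerivAt (dtu lam) x := by
  obtain ⟨_, ⟨w, hw, rfl⟩, hlt⟩ := exists_lt_of_lt_csSup (hne.image _)
    (show criticalAverage α β - δ < _ from sub_lt_self _ hδ)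
  obtain ⟨x, z, h⟩ := exists_isExpansion (periodicDigit_pos hw.1)
  exact ⟨x, _, z, h, ⟨_, tendsto_average_periodicDigit (length_pos_of_mem_growingWords hw), hlt⟩,
    h.hasInfiniteDerivAt_of_even h0 h1 hα hβ (tendsto_atTop_periodicDigit hw.1 hw.2)⟩

theorem one_sub_inv_goldenRatio : 1 - Real.goldenRatio⁻¹ = (Real.goldenRatio ^ 2)⁻¹ := by
  have hφ := Real.goldenRatio_pos
  have hsq := Real.goldenRatio_sq
  refine eq_inv_of_mul_eq_one_left ?_
  have h : Real.goldenRatio⁻¹ * Real.goldenRatio = 1 := inv_mul_cancel₀ hφ.ne'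
  linear_combination hsq - Real.goldenRatio * h

end AverageWeight

theorem theorem4 :
    -- derivative of `g_τ` and the constant `κ₁ = 4` (`τ = 1 - 1/φ`)
    (∀ x ∈ Set.Ioo (0 : ℝ) 1, Irrational x →
      limsup (fun t : ℕ => ((Stau x (2 * t) / t : ℝ) : EReal)) atTop < 4 →
      HasInfiniteDerivAt (dtu (1 - Real.goldenRatio⁻¹)) x) ∧
    (∀ δ : ℝ, 0 < δ → ∃ y ∈ Set.Ioo (0 : ℝ) 1, Irrational y ∧
      (∃ L : ℝ, Tendsto (fun t : ℕ => Stau y (2 * t) / t) atTop (𝓝 L) ∧ L < 4 + δ) ∧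
      HasDerivAt (dtu (1 - Real.goldenRatio⁻¹)) 0 y) ∧
    -- the constant `κ₂`, common to `g_{1/φ}` and `g_τ`
    (∃ κ₂ : ℝ, IsComputableReal κ₂ ∧ 13.05 ≤ κ₂ ∧ κ₂ < 13.06 ∧
      -- the two properties that single out `κ₂` for `g_{1/φ}`
      (∀ x ∈ Set.Ioo (0 : ℝ) 1, Irrational x →
        (κ₂ : EReal) < liminf (fun t : ℕ => ((Sphi x (2 * t) / t : ℝ) : EReal)) atTop →
        HasDerivAt (dtu Real.goldenRatio⁻¹) 0 x) ∧
      (∀ δ : ℝ, 0 < δ → ∃ y ∈ Set.Ioo (0 : ℝ) 1, Irrational y ∧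
        (∃ L : ℝ, Tendsto (fun t : ℕ => Sphi y (2 * t) / t) atTop (𝓝 L) ∧ κ₂ - δ < L) ∧
        HasInfiniteDerivAt (dtu Real.goldenRatio⁻¹) y) ∧
      -- the same two properties for `g_τ`
      (∀ x ∈ Set.Ioo (0 : ℝ) 1, Irrational x →
        (κ₂ : EReal) < liminf (fun t : ℕ => ((Stau x (2 * t) / t : ℝ) : EReal)) atTop →
        HasDerivAt (dtu (1 - Real.goldenRatio⁻¹)) 0 x) ∧
      (∀ δ : ℝ, 0 < δ → ∃ y ∈ Set.Ioo (0 : ℝ) 1, Irrational y ∧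
        (∃ L : ℝ, Tendsto (fun t : ℕ => Stau y (2 * t) / t) atTop (𝓝 L) ∧ κ₂ - δ < L) ∧
        HasInfiniteDerivAt (dtu (1 - Real.goldenRatio⁻¹)) y)) ∧
    -- partial quotients at most `2`, and at most `3`, for `g_τ`
    (∀ x ∈ Set.Icc (0 : ℝ) 1, Irrational x → (∀ i : ℕ, 1 ≤ i → partialQuotient x i ≤ 2) →
      HasInfiniteDerivAt (dtu (1 - Real.goldenRatio⁻¹)) x) ∧
    (∃ y ∈ Set.Icc (0 : ℝ) 1, Irrational y ∧
      (∃ a b c : ℤ, a ≠ 0 ∧ (a : ℝ) * y ^ 2 + b * y + c = 0) ∧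
      (∀ i : ℕ, 1 ≤ i → partialQuotient y i ≤ 3) ∧
      HasDerivAt (dtu (1 - Real.goldenRatio⁻¹)) 0 y) := by
  have hφ := Real.goldenRatio_pos
  have hφ1 := Real.one_lt_goldenRatio
  have hinv0 : 0 < Real.goldenRatio⁻¹ := by positivity
  have hinv1 : Real.goldenRatio⁻¹ < 1 := inv_lt_one_of_one_lt₀ hφ1
  have hinv : Real.goldenRatio⁻¹ = (Real.goldenRatio ^ 1)⁻¹ := by rw [pow_one]
  have hτ0 : 0 < 1 - Real.goldenRatio⁻¹ := by linarith
  have hτ1 : 1 - Real.goldenRatio⁻¹ < 1 := by linarith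
  have hτ := one_sub_inv_goldenRatio
  have hτ' : 1 - (1 - Real.goldenRatio⁻¹) = (Real.goldenRatio ^ 1)⁻¹ := by rw [pow_one]; ring
  have hκ0 : 0 ≤ criticalAverage 1 2 := by linarith [criticalAverage_bounds.1]
  refine ⟨?_, ?_, ⟨criticalAverage 1 2, isComputableReal_criticalAverage,
    criticalAverage_bounds.1, criticalAverage_bounds.2, ?_, ?_, ?_, ?_⟩, ?_, ?_⟩
  · intro x hx hirr hlim
    have h := isExpansion_cfDigit hirr hx.1 hx.2
    obtain ⟨c, hc1, hc2⟩ := EReal.lt_iff_exists_real_btwn.1 hlim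
    refine h.hasInfiniteDerivAt_of_even hτ0 hτ1 hτ hτ'
      (tendsto_atTop_of_average_lt_four h.2.1 (c := c) (EReal.coe_lt_coe_iff.1 hc2) ?_)
    filter_upwards [eventually_lt_of_limsup_lt hc1, eventually_gt_atTop 0] with t ht ht0
    have ht0' : (0 : ℝ) < t := by exact_mod_cast ht0
    rw [h.stau] at ht
    exact ((div_lt_iff₀ ht0').1 (EReal.coe_lt_coe_iff.1 ht)).le
  · intro δ hδ
    obtain ⟨w, hw, hlen, havg, hcont⟩ := exists_word_average_lt hδ
    obtain ⟨y, z, h⟩ := exists_isExpansion (periodicDigit_pos hw)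
    refine ⟨y, h.mem_Ioo, h.irrational, ⟨_, ?_, havg⟩,
      h.hasDerivAt_zero_of_even hτ0 hτ1 hτ hτ' (by norm_num) le_rfl
        (tendsto_zero_periodicDigit hw hlen hcont)⟩
    simp only [h.stau]
    exact tendsto_average_periodicDigit hlen
  · intro x hx hirr hlim
    have h := isExpansion_cfDigit hirr hx.1 hx.2
    simp only [h.sphi] at hlim
    exact h.hasDerivAt_zero_of_liminf hinv0 hinv1 hinv hτ le_rfl (by norm_num) rfl hκ0
      (fun w hw => wordWeight_le_criticalAverage hw) hlim
  · intro δ hδ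
    obtain ⟨y, d, z, h, hL, hy⟩ := exists_isExpansion_hasInfiniteDerivAt hinv0 hinv1 hinv hτ
      ⟨_, heavyWord_mem⟩ hδ
    refine ⟨y, h.mem_Ioo, h.irrational, ?_, hy⟩
    simp only [h.sphi]
    exact hL
  · intro x hx hirr hlim
    have h := isExpansion_cfDigit hirr hx.1 hx.2
    simp only [h.stau] at hlim
    refine h.hasDerivAt_zero_of_liminf hτ0 hτ1 hτ hτ' (by norm_num) le_rfl rfl hκ0
      (fun w hw => ?_) hlim
    have := wordWeight_le_criticalAverage (reverseWord_mem_growingWords hw)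
    rwa [wordWeight_reverseWord, length_reverseWord] at this
  · intro δ hδ
    obtain ⟨y, d, z, h, hL, hy⟩ := exists_isExpansion_hasInfiniteDerivAt hτ0 hτ1 hτ hτ'
      ⟨_, reverseWord_mem_growingWords heavyWord_mem⟩ hδ
    refine ⟨y, h.mem_Ioo, h.irrational, ?_, hy⟩
    simp only [h.stau, criticalAverage_comm 1 2]
    exact hL
  · intro x hx hirr hdig
    have h0 : 0 < x := lt_of_le_of_ne hx.1 (fun e => hirr.ne_zero e.symm)
    have h1 : x < 1 := lt_of_le_of_ne hx.2 hirr.ne_one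
    have h := isExpansion_cfDigit hirr h0 h1
    refine h.hasInfiniteDerivAt_of_even hτ0 hτ1 hτ hτ'
      (tendsto_atTop_of_digit_le_two h.2.1 fun n => ?_)
    have := hdig (n + 1) (by omega)
    rw [h.partialQuotient] at this
    exact_mod_cast this
  · have hd := periodicDigit_replicate (p := (3, 1)) (k := 7) (by norm_num)
    have h := isExpansion_three_one hd
    have hpos : PositiveWord (List.replicate 7 (3, 1)) := by
      intro p hp
      rw [List.eq_of_mem_replicate hp]
      norm_num
    have h21 : √(21 : ℝ) ^ 2 = 21 := Real.sq_sqrt (by norm_num)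
    refine ⟨_, Set.Ioo_subset_Icc_self h.mem_Ioo, h.irrational, ⟨3, 3, -1, by norm_num, ?_⟩, ?_,
      h.hasDerivAt_zero_of_even hτ0 hτ1 hτ hτ' (by norm_num) le_rfl
        (tendsto_zero_periodicDigit hpos (by norm_num) ?_)⟩
    · push_cast
      nlinarith
    · intro i hi
      obtain ⟨n, rfl⟩ := Nat.exists_eq_add_of_le' hi
      rw [h.partialQuotient, hd]
      split_ifs <;> norm_num
    · have hK : wordCont (List.replicate 7 (3, 1)) = 47956 := by
        rw [wordCont_eq_foldr]; decide
      have hS : wordWeight 2 1 (List.replicate 7 (3, 1)) = 49 := by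
        simp [wordWeight]
      rw [hK, hS]
      calc ((2 : ℝ) * (47956 : ℕ)) ^ 2 < 1.618 ^ 49 := by norm_num
        _ ≤ _ := pow_le_pow_left₀ (by norm_num) (by linarith [goldenRatio_bounds.1]) _
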